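/- **Conventions.** For $0<r\le 1$ let $C_r=\{|\lambda|=r\}$, $I_r=\{|\lambda|<r\}$, $A_r=\{r<|\lambda|<1/r\}$, $\sigma_3=\mathrm{diag}[1,-1]$. - $\Lambda_r SL_\sigma$ is the group of smooth maps $g:C_r\to SL(2,\mathbb C)$ with $\sigma_3 g(-\lambda)\sigma_3^{-1}=g(\lambda)$. $\Lambda_r^+SL_\sigma$ is the subgroup of those $g$ that extend analytically to $I_r$ (continuously up to $C_r$). $\Lambda_rSU(2)_\sigma$ is the subgroup of those that extend analytically to $A_r$ (continuously up to its boundary) with values in $SU(2)$ on $S^1$. $\Lambda_{\mathbb C^*}SU(2)_\sigma=\bigcap_{0<r\le1}\Lambda_rSU(2)_\sigma$. $U(1)$ denotes the constant matrices $\mathrm{diag}[u,\bar u]$, $|u|=1$. - Let $M$ be a connected Riemann surface with universal cover $\widetilde M$ and $\tau$ a deck transformation. An extended frame is a smooth map $F:\widetilde M\to\Lambda_{\mathbb C^*}SU(2)_\sigma$ with $F^{-1}dF=\lambda^{-1}\alpha_{\mathfrak p}'+\alpha_{\mathfrak k}+\lambda\alpha_{\mathfrak p}''$, where $\alpha_{\mathfrak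 p}',\alpha_{\mathfrak p}''$ are off-diagonal of type $(1,0)$ and $(0,1)$, and $\alpha_{\mathfrak k}$ is diagonal and trace-free. It is normalized at $z_0\in\widetilde M$ if $F(z_0)=\mathrm{Id}$. - For $h\in\Lambda_rSL_\sigma$, $[h\#F]$ is the set of extended frames $\hat F$ with $hF=\hat FB$ on $C_r$ for some $B:\widetilde M\to\Lambda_r^+SL_\sigma$. For $F$ normalized at $z_0$ and $h\in \Lambda_r^+SL_\sigma$, $\hat F=h\#F$ means that $\hat F\in[h\#F]$ and $\hat F(z_0)=\mathrm{Id}$. The isotropy group is $\mathrm{Iso}_r(F)=\{h\in\Lambda_rSL_\sigma: F\in[h\#F]\}$, and $\mathrm{Iso}(F)=\mathrm{Iso}_1(F)$. - A monodromy of $F$ with respect to $\tau$ (on $C_r$) is a $\chi\in\Lambda_rSU(2)_\sigma$ such that $F\circ\tau=\chi Fk$ on $C_r$ for some smooth $k:\widetilde M\to U(1)$. - Let $P\subset\mathbb C^*$ accumulate at most at $0$ and $\infty$ and be invariant under $\lambda\mapsto1/\bar\lambda$ and $\lambda\mapsto-\lambda$. Suppose that $P\cap S^1=\emptyset$. Then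 $\mathbb S_P$ is $\mathbb C^*$ with a radial cut removed from each $\alpha\in P$ (including $\alpha$), to $0$ if $|\alpha|<1$ and to $\infty$ if $|\alpha|>1$. **Statement.** Let $F$ be an extended frame that is normalized at $z_0$ and has $\mathrm{Iso}(F)=\{\pm\mathrm{Id}\}$. Let $r\in(0,1]$, and let $\chi\in\Lambda_{\mathbb C^*}SU(2)_\sigma$ be a monodromy of $F$ with respect to $\tau$ whose trace is not a constant function of $\lambda$. Let $h\in\Lambda_r^+SL_\sigma$ be such that $\hat F=h\#F$ also has a monodromy with respect to $\tau$ (on $C_r$). Then there are $r'\in[r,1]$, a set $P$ as above that does not meet $\{r'\le|\lambda|\le1/r'\}$, and matrix functions $U,C$ such that 1. $U$ is meromorphic on $\mathbb S_P$ and is the meromorphic extension of an element of $\Lambda_{r'}SU(2)_\sigma$; 2. $C$ is meromorphic on $\mathbb S_P\cap I_r$; 3. at every $\lambda\in\mathbb S_P$ with $|\lambda|\le r$ at which $U$ is analytic (in particular on the segmented circles $C_l\cap\mathbb S_P$, $0<l\le r$, off the poles of $U$), $h=U\,C$, $[C,\chi]=0$, $\det C=1$ and $\sigma_3C(-\lambda)\sigma_3^{-1}=C(\lambda)$.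 -/

import Mathlib

open Complex Metric Set
open scoped Manifold ContDiff

/-- Complex `2 × 2` matrices. -/
abbrev Mat2 := Matrix (Fin 2) (Fin 2) ℂ

/-- `σ₃ = diag[1, -1]`; note `σ₃⁻¹ = σ₃`. -/
def sigma3 : Mat2 := !![1, 0; 0, -1]

/-- The group `U(1)` of the constant diagonal unitary matrices `diag[u, ū]`, `|u| = 1`. -/
def diagU1 (u : ℂ) : Mat2 := !![u, 0; 0, starRingEnd ℂ u]

/-! ### Loop groups

A loop is represented by a total function `ℂ → Mat2`. Only its values on the circle `C_r` matter,
or on the set to which it is required to extend (the closed disc `|λ| ≤ r` for positive loops, the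
closed annulus `r ≤ |λ| ≤ 1/r` for unitary loops): an extendable loop is represented by its
(unique) extension. -/

/-- `Λ_r SL(2,ℂ)_σ`: smooth `SL(2,ℂ)`-valued maps on the circle `C_r = {|λ| = r}` with
`σ₃ g(-λ) σ₃⁻¹ = g(λ)`. -/
structure IsLoopSL (r : ℝ) (g : ℂ → Mat2) : Prop where
  smooth : ∀ i j, ContDiff ℝ ∞ (fun t : ℝ => g (circleMap 0 r t) i j)
  det_eq_one : ∀ l ∈ sphere (0 : ℂ) r, (g l).det = 1
  twisted : ∀ l ∈ sphere (0 : ℂ) r, sigma3 * g (-l) * sigma3 = g l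

/-- `Λ_r⁺ SL(2,ℂ)_σ`: the loops that extend analytically to the disc `I_r = {|λ| < r}` (continuously
up to the boundary circle `C_r`). -/
structure IsLoopSLPlus (r : ℝ) (g : ℂ → Mat2) : Prop extends IsLoopSL r g where
  extends_disc : ∀ i j, DiffContOnCl ℂ (fun l => g l i j) (ball 0 r)

/-- `Λ_r SU(2)_σ`: the loops that extend analytically to the annulus
`A_r = {r < |λ| < 1/r}` (continuously up to the boundary) and are `SU(2)`-valued on `S¹`. -/
structure IsLoopSU (r : ℝ) (g : ℂ → Mat2) : Prop extends IsLoopSL r g where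
  continuousOn : ∀ i j, ContinuousOn (fun l => g l i j) {l : ℂ | r ≤ ‖l‖ ∧ ‖l‖ ≤ 1 / r}
  analytic : ∀ i j, DifferentiableOn ℂ (fun l => g l i j) {l : ℂ | r < ‖l‖ ∧ ‖l‖ < 1 / r}
  unitary : ∀ l ∈ sphere (0 : ℂ) 1, g l ∈ Matrix.specialUnitaryGroup (Fin 2) ℂ

/-- `Λ_{ℂ*} SU(2)_σ`, the intersection of all `Λ_r SU(2)_σ`, `0 < r ≤ 1`: twisted
`SL(2,ℂ)`-valued maps, holomorphic on `ℂ*` and `SU(2)`-valued on `S¹`. -/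
structure IsLoopSUCstar (g : ℂ → Mat2) : Prop where
  analytic : ∀ i j, DifferentiableOn ℂ (fun l => g l i j) {l : ℂ | l ≠ 0}
  det_eq_one : ∀ l : ℂ, l ≠ 0 → (g l).det = 1
  twisted : ∀ l : ℂ, l ≠ 0 → sigma3 * g (-l) * sigma3 = g l
  unitary : ∀ l ∈ sphere (0 : ℂ) 1, g l ∈ Matrix.specialUnitaryGroup (Fin 2) ℂ

/-! ### Extended unitary frames on a Riemann surface `X` -/

section Frames

variable {X : Type*} [TopologicalSpace X] [ChartedSpace ℂ X]

/-- The real differential of a function `f : X → ℂ` at `z`, in the direction `v ∈ T_z X = ℂ`. -/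
noncomputable def realDiff (f : X → ℂ) (z : X) (v : ℂ) : ℂ :=
  mfderiv 𝓘(ℝ, ℂ) 𝓘(ℝ, ℂ) f z v

/-- The Maurer–Cartan form `F⁻¹ dF` at the point `z` and the spectral parameter `l`. -/
noncomputable def maurerCartan (F : X → ℂ → Mat2) (l : ℂ) (z : X) (v : ℂ) : Mat2 :=
  (F z l)⁻¹ * Matrix.of fun i j => realDiff (fun w => F w l i j) z v

/-- The tangent space `T_z X` is the model space `ℂ` (through the preferred chart at `z`), so a
`(1,0)`-form is a complex linear, and a `(0,1)`-form a conjugate linear, function of `v`. The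
conditions say that `F⁻¹ dF = λ⁻¹ α_𝔭' + α_𝔨 + λ α_𝔭''` at `z`, where `𝔭` and `𝔨` are the
off-diagonal and the diagonal matrices in `sl(2,ℂ)`. -/
def HasFrameMaurerCartan (F : X → ℂ → Mat2) (z : X) : Prop :=
  ∃ (a' : ℂ →ₗ[ℂ] Mat2) (ak : ℂ →ₗ[ℝ] Mat2) (a'' : ℂ →ₛₗ[starRingEnd ℂ] Mat2),
    (∀ v, a' v 0 0 = 0 ∧ a' v 1 1 = 0) ∧
    (∀ v, ak v 0 1 = 0 ∧ ak v 1 0 = 0 ∧ (ak v).trace = 0) ∧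
    (∀ v, a'' v 0 0 = 0 ∧ a'' v 1 1 = 0) ∧
    ∀ l : ℂ, l ≠ 0 → ∀ v : ℂ, maurerCartan F l z v = l⁻¹ • a' v + ak v + l • a'' v

/-- Extended unitary frames `F : X → Λ_{ℂ*} SU(2)_σ`. -/
structure IsExtendedFrame (F : X → ℂ → Mat2) : Prop where
  loop : ∀ z, IsLoopSUCstar (F z)
  smooth : ∀ l : ℂ, l ≠ 0 → ∀ i j, ContMDiff 𝓘(ℝ, ℂ) 𝓘(ℝ, ℂ) ∞ (fun z => F z l i j)
  maurerCartan : ∀ z, HasFrameMaurerCartan F z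

/-- Extended unitary frames that are normalized at the base point `z₀`: `F(z₀) = Id`. -/
structure IsNormalizedFrame (z₀ : X) (F : X → ℂ → Mat2) : Prop extends IsExtendedFrame F where
  normalized : ∀ l : ℂ, l ≠ 0 → F z₀ l = 1

/-- `F ∈ [h # F₀]`: there is a pointwise Iwasawa decomposition `h F₀ = F B` on `C_r`, with the
unitary factor `F` an extended frame and the factor `B` with values in `Λ_r⁺ SL(2,ℂ)_σ`. -/
def InDressingClass (r : ℝ) (h : ℂ → Mat2) (F₀ F : X → ℂ → Mat2) : Prop :=
  IsExtendedFrame F ∧ ∃ B : X → ℂ → Mat2, (∀ z, IsLoopSLPlus r (B z)) ∧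
    ∀ z, ∀ l ∈ sphere (0 : ℂ) r, h l * F₀ z l = F z l * B z l

/-- `F = h # F₀`: the frame `F` lies in `[h # F₀]` and is normalized at `z₀`. -/
def IsDressing (r : ℝ) (z₀ : X) (h : ℂ → Mat2) (F₀ F : X → ℂ → Mat2) : Prop :=
  InDressingClass r h F₀ F ∧ IsNormalizedFrame z₀ F

/-- The isotropy group `Iso_r(F) = {h ∈ Λ_r SL(2,ℂ)_σ : F ∈ [h # F]}`. -/
def Iso (r : ℝ) (F : X → ℂ → Mat2) : Set (ℂ → Mat2) :=
  {h | IsLoopSL r h ∧ InDressingClass r h F F}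

/-- `Iso_r(F) = {±Id}`, as an equality of sets of maps on the circle `C_r`. -/
def HasTrivialIso (r : ℝ) (F : X → ℂ → Mat2) : Prop :=
  ∀ h : ℂ → Mat2, h ∈ Iso r F ↔
    EqOn h (fun _ => 1) (sphere (0 : ℂ) r) ∨ EqOn h (fun _ => -1) (sphere (0 : ℂ) r)

/-- `χ ∈ Λ_r SU(2)_σ` is a monodromy of `F` with respect to `τ`: `τ^* F = χ F k` on `C_r`, for some
smooth `k : X → U(1)`. -/
def IsMonodromy (r : ℝ) (F : X → ℂ → Mat2) (τ : X → X) (χ : ℂ → Mat2) : Prop :=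
  IsLoopSU r χ ∧ ∃ u : X → ℂ, ContMDiff 𝓘(ℝ, ℂ) 𝓘(ℝ, ℂ) ∞ u ∧ (∀ z, ‖u z‖ = 1) ∧
    ∀ z, ∀ l ∈ sphere (0 : ℂ) r, F (τ z) l = χ l * F z l * diagU1 (u z)

end Frames

/-! ### Cut planes -/

/-- `ℂ*` with radial cuts from the points `α ∈ P`: to the origin if `|α| < 1`, and to infinity if
`|α| > 1`. -/
def cutPlane (P : Set ℂ) : Set ℂ :=
  {l | l ≠ 0 ∧ ∀ α ∈ P,
    (‖α‖ < 1 → ∀ t : ℝ, 0 < t → t ≤ 1 → l ≠ t * α) ∧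
    (1 < ‖α‖ → ∀ t : ℝ, 1 ≤ t → l ≠ t * α)}

/-- Admissible sets of branch points for an annulus `r ≤ |λ| ≤ 1/r`: subsets of `ℂ*` that
accumulate at most at `0` and `∞`, are invariant under `λ ↦ 1/λ̄` and `λ ↦ -λ`, and do not meet the
closed annulus. -/
structure IsBranchSet (r : ℝ) (P : Set ℂ) : Prop where
  ne_zero : ∀ α ∈ P, α ≠ 0
  locally_finite : ∀ ρ : ℝ, 0 < ρ → {α ∈ P | ρ ≤ ‖α‖ ∧ ‖α‖ ≤ 1 / ρ}.Finite
  reflect : ∀ α ∈ P, 1 / (starRingEnd ℂ α) ∈ P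
  neg : ∀ α ∈ P, -α ∈ P
  avoids : ∀ α ∈ P, ‖α‖ < r ∨ 1 / r < ‖α‖

/-! The proof has two halves: `h` conjugates `χ` into a unitary loop, and any such conjugation is
also achieved by a unitary loop `U` on a cut plane. Then `C = U⁻¹h` commutes with `χ`.

First half. Let `χ̂` be the monodromy of `F̂` and put `G = (χ̂h)⁻¹hχ` on `C_r`. Comparing `hF = F̂B`
at `z` and at `τ z` shows that `G` and all `F⁻¹GF` extend to the disc, so `G` is a positive element
of the isotropy group on `C_r`. The hypothesis concerns the isotropy group on `C_1`, and the passage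
from `r` to `1` is the heart of the proof (`eq_one_or_neg_one_of_mem_positiveAlgebra`). The
functions `G` for which `G` and `F⁻¹GF` extend are stable under conjugation by `χ` and `χ⁻¹`,
because `τ` permutes the points `z`. The differences `D = χ⁻¹Gχ - G` satisfy `χ⁻¹Dχ + χDχ⁻¹ = ((tr
χ)² - 2) D`. If some `D` is nonzero, an entry of minimal vanishing order at the origin bounds `tr χ`
there; reflection bounds it at infinity as well, and `tr χ` is constant by Liouville, a
contradiction (`commute_of_conj_invariant`). So the trace-free part of `G` commutes with that of
`χ`. Commuting trace-free matrices are proportional, and `χ` lives on all of `ℂ*`; hence a scalar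
multiple of the trace-free part of `G` continues across the closed unit disc
(`exists_extension_of_commute`). The Cayley transform of a small multiple of this continuation lies
in the isotropy group on `C_1`, so it is `±1` and the continuation vanishes
(`eq_zero_of_hasTrivialIso`). Therefore `G = ±1` and `hχh⁻¹ = ±χ̂`.

Second half. By reflection `Ψ = hχh⁻¹` extends to `ℂ*`, with the trace of `χ`
(`exists_conjugate_loop`). Let `X`, `X'` be the trace-free parts of `χ`, `Ψ`. Their squares are the
same scalar, so `X'a + aX` intertwines them for every `a`. For a suitable `a`, once the zeros on
`S¹` are divided out and the twist is corrected, this gives an intertwiner `V` with values in `ℝ ·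
SU(2)` and positive determinant on `S¹`. Then `U = V / √(det V)` is unitary on `S¹` and holomorphic
off radial cuts from the zeros of `det V`; these zeros form `P` (`exists_isLoopSU_intertwiner`). The
zeros avoid `S¹`, so `r' = 1` serves. -/

/-! ### Removability of lines and circles -/

open Topology Interval in
/-- A continuous function on a disc that is holomorphic off a vertical line is holomorphic. -/
theorem differentiableOn_ball_of_off_vertical_line {f : ℂ → ℂ} {c : ℂ} {R a : ℝ}
    (hc : ContinuousOn f (ball c R))
    (hd : DifferentiableOn ℂ f (ball c R \ {z | z.re = a})) : DifferentiableOn ℂ f (ball c R) := by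
  -- Morera's theorem: it suffices that the integrals over the boundaries of rectangles vanish.
  rw [← Complex.isConservativeOn_and_continuousOn_iff_isDifferentiableOn isOpen_ball]
  refine ⟨fun z w hzw => ?_, hc⟩
  rw [← add_eq_zero_iff_eq_neg, wedgeIntegral_add_wedgeIntegral_eq]
  have key : ∀ z w : ℂ, Rectangle z w ⊆ ball c R →
      a ∉ Ioo (min z.re w.re) (max z.re w.re) →
      (∫ x : ℝ in z.re..w.re, f (x + z.im * I)) -
      (∫ x : ℝ in z.re..w.re, f (x + w.im * I)) +
      I • (∫ y : ℝ in z.im..w.im, f (w.re + y * I)) -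
      I • (∫ y : ℝ in z.im..w.im, f (z.re + y * I)) = 0 := by
    intro z w hzw ha
    apply integral_boundary_rect_eq_zero_of_continuousOn_of_differentiableOn
    · exact hc.mono hzw
    · refine hd.mono fun x hx => ⟨hzw ?_, ?_⟩
      · rw [mem_reProdIm] at hx
        exact mem_reProdIm.2 ⟨Ioo_subset_Icc_self hx.1, Ioo_subset_Icc_self hx.2⟩
      · rintro rfl
        exact ha hx.1
  -- A rectangle crossed by the line is cut along it. Each half meets the line only in its boundary,
  -- where continuity suffices for Cauchy's theorem, and the integrals along the cut cancel.
  by_cases ha : a ∈ Ioo (min z.re w.re) (max z.re w.re)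
  swap
  · exact key z w hzw ha
  have haI : a ∈ [[z.re, w.re]] := Ioo_subset_Icc_self ha
  have h1 : Rectangle z (a + w.im * I) ⊆ Rectangle z w := by
    apply Complex.reProdIm_subset_iff.2
    apply Set.prod_mono
    · simpa using uIcc_subset_uIcc_left haI
    · simp
  have h2 : Rectangle (a + z.im * I) w ⊆ Rectangle z w := by
    apply Complex.reProdIm_subset_iff.2
    apply Set.prod_mono
    · simpa using uIcc_subset_uIcc_right haI
    · simp
  have e1 := key z (a + w.im * I) (h1.trans hzw) (by
    simp only [add_re, ofReal_re, mul_re, ofReal_im, I_re, I_im]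
    intro h; simp only [mem_Ioo, min_lt_iff, lt_max_iff] at h ha; grind)
  have e2 := key (a + z.im * I) w (h2.trans hzw) (by
    simp only [add_re, ofReal_re, mul_re, ofReal_im, I_re, I_im]
    intro h; simp only [mem_Ioo, min_lt_iff, lt_max_iff] at h ha; grind)
  have int : ∀ b ∈ [[z.im, w.im]], ∀ s ∈ [[z.re, w.re]], ∀ t ∈ [[z.re, w.re]],
      IntervalIntegrable (fun x : ℝ => f (x + b * I)) MeasureTheory.volume s t := by
    intro b hb s hs t ht
    apply ContinuousOn.intervalIntegrable
    refine hc.comp (by fun_prop) fun x hx => hzw ?_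
    refine mem_reProdIm.2 ⟨?_, ?_⟩
    · simpa using uIcc_subset_uIcc hs ht hx
    · simpa using hb
  have i1 := intervalIntegral.integral_add_adjacent_intervals
    (int z.im left_mem_uIcc _ left_mem_uIcc _ haI) (int z.im left_mem_uIcc _ haI _ right_mem_uIcc)
  have i2 := intervalIntegral.integral_add_adjacent_intervals
    (int w.im right_mem_uIcc _ left_mem_uIcc _ haI) (int w.im right_mem_uIcc _ haI _ right_mem_uIcc)
  simp only [add_re, ofReal_re, mul_re, ofReal_im, I_re, I_im, add_im, mul_im] at e1 e2
  simp only [mul_zero, mul_one, add_zero, sub_zero, zero_add] at e1 e2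
  rw [← i1, ← i2]
  linear_combination e1 + e2

/-- A continuous function on an open subset of `ℂ*` that is holomorphic off a circle centered at the
origin is holomorphic. -/
theorem differentiableOn_of_off_sphere {V : Set ℂ} (hV : IsOpen V) (h0 : (0 : ℂ) ∉ V) {ρ : ℝ}
    {f : ℂ → ℂ} (hc : ContinuousOn f V)
    (hd : DifferentiableOn ℂ f (V \ sphere 0 ρ)) : DifferentiableOn ℂ f V := by
  rcases le_or_gt ρ 0 with hρ | hρ
  · refine hd.mono fun z hz => ⟨hz, fun h => h0 ?_⟩
    have : ‖z‖ ≤ 0 := (mem_sphere_zero_iff_norm.1 h).trans_le hρ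
    rw [norm_le_zero_iff] at this
    rwa [this] at hz
  intro z hz
  have hz0 : z ≠ 0 := fun h => h0 (h ▸ hz)
  -- In the coordinate `log λ` the circle becomes the vertical line `re = log ρ`.
  have hVo : IsOpen (Complex.exp ⁻¹' V) := hV.preimage continuous_exp
  obtain ⟨ε, hε, hball⟩ := Metric.isOpen_iff.1 hVo (log z) (by simpa [exp_log hz0] using hz)
  have hg : DifferentiableOn ℂ (f ∘ Complex.exp) (ball (log z) ε) := by
    refine differentiableOn_ball_of_off_vertical_line (a := Real.log ρ)
      (hc.comp continuous_exp.continuousOn hball) ?_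
    refine hd.comp differentiable_exp.differentiableOn fun w hw => ⟨hball hw.1, fun h => hw.2 ?_⟩
    rw [mem_sphere_zero_iff_norm, norm_exp] at h
    simp [← h]
  -- A branch of the logarithm adapted to `z`: near `z` the quotient `ζ / z` is close to `1`, away
  -- from the cut of `log`.
  have hlog : DifferentiableAt ℂ (fun ζ => log z + log (ζ / z)) z := by
    refine (differentiableAt_const _).add (DifferentiableAt.clog (by fun_prop) ?_)
    simp [div_self hz0]
  have hval : log z + log (z / z) = log z := by simp [div_self hz0]
  have hcomp : DifferentiableAt ℂ (fun ζ => (f ∘ Complex.exp) (log z + log (ζ / z))) z := by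
    refine DifferentiableAt.comp (g := f ∘ Complex.exp) z ?_ hlog
    rw [hval]
    exact hg.differentiableAt (isOpen_ball.mem_nhds (mem_ball_self hε))
  refine (hcomp.congr_of_eventuallyEq ?_).differentiableWithinAt
  filter_upwards [isOpen_ne.mem_nhds hz0] with ζ hζ
  simp only [Function.comp_apply, exp_add, exp_log hz0, exp_log (div_ne_zero hζ hz0)]
  rw [mul_div_cancel₀ _ hz0]

/-! ### Matrix functions with entries in an algebra of functions -/

/-- The algebra of the functions that are complex differentiable on `V`. -/
def holoAlg (V : Set ℂ) : Subalgebra ℂ (ℂ → ℂ) where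
  carrier := {f | DifferentiableOn ℂ f V}
  mul_mem' hf hg := DifferentiableOn.mul hf hg
  add_mem' hf hg := DifferentiableOn.add hf hg
  algebraMap_mem' c := differentiableOn_const c

/-- The algebra of the functions that are continuous on `V`. -/
def contAlg (V : Set ℂ) : Subalgebra ℂ (ℂ → ℂ) where
  carrier := {f | ContinuousOn f V}
  mul_mem' hf hg := ContinuousOn.mul hf hg
  add_mem' hf hg := ContinuousOn.add hf hg
  algebraMap_mem' c := continuousOn_const (c := c)

/-- The entries of the matrix function `A` belong to the algebra `S`. -/
def EntriesIn (S : Subalgebra ℂ (ℂ → ℂ)) (A : ℂ → Mat2) : Prop :=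
  ∀ i j, (fun l => A l i j) ∈ S

theorem mem_holoAlg {V : Set ℂ} {f : ℂ → ℂ} : f ∈ holoAlg V ↔ DifferentiableOn ℂ f V := Iff.rfl

theorem mem_contAlg {V : Set ℂ} {f : ℂ → ℂ} : f ∈ contAlg V ↔ ContinuousOn f V := Iff.rfl

namespace EntriesIn

variable {S : Subalgebra ℂ (ℂ → ℂ)} {A B : ℂ → Mat2} {f : ℂ → ℂ}

theorem mul (hA : EntriesIn S A) (hB : EntriesIn S B) : EntriesIn S fun l => A l * B l := by
  intro i j
  simp only [Matrix.mul_apply, Fin.sum_univ_two]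
  exact S.add_mem (S.mul_mem (hA i 0) (hB 0 j)) (S.mul_mem (hA i 1) (hB 1 j))

theorem add (hA : EntriesIn S A) (hB : EntriesIn S B) : EntriesIn S fun l => A l + B l :=
  fun i j => S.add_mem (hA i j) (hB i j)

theorem sub (hA : EntriesIn S A) (hB : EntriesIn S B) : EntriesIn S fun l => A l - B l :=
  fun i j => S.sub_mem (hA i j) (hB i j)

theorem smul (hf : f ∈ S) (hA : EntriesIn S A) : EntriesIn S fun l => f l • A l :=
  fun i j => S.mul_mem hf (hA i j)

theorem const (S : Subalgebra ℂ (ℂ → ℂ)) (A : Mat2) : EntriesIn S fun _ => A :=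
  fun i j => S.algebraMap_mem (A i j)

theorem trace_mem (hA : EntriesIn S A) : (fun l => (A l).trace) ∈ S := by
  simp only [Matrix.trace_fin_two]
  exact S.add_mem (hA 0 0) (hA 1 1)

theorem det_mem (hA : EntriesIn S A) : (fun l => (A l).det) ∈ S := by
  simp only [Matrix.det_fin_two]
  exact S.sub_mem (S.mul_mem (hA 0 0) (hA 1 1)) (S.mul_mem (hA 0 1) (hA 1 0))

theorem adjugate (hA : EntriesIn S A) : EntriesIn S fun l => (A l).adjugate := by
  intro i j
  simp only [Matrix.adjugate_fin_two]
  fin_cases i <;> fin_cases j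
  · exact hA 1 1
  · exact S.neg_mem (hA 0 1)
  · exact S.neg_mem (hA 1 0)
  · exact hA 0 0

theorem mono {S' : Subalgebra ℂ (ℂ → ℂ)} (hA : EntriesIn S A) (h : S ≤ S') : EntriesIn S' A :=
  fun i j => h (hA i j)

theorem comp_neg {V : Set ℂ} (hV : ∀ l ∈ V, -l ∈ V) (hA : EntriesIn (holoAlg V) A) :
    EntriesIn (holoAlg V) fun l => A (-l) :=
  fun i j => DifferentiableOn.comp (g := fun l => A l i j) (hA i j)
    differentiable_neg.differentiableOn hV

end EntriesIn

theorem holoAlg_anti {V W : Set ℂ} (h : V ⊆ W) : holoAlg W ≤ holoAlg V :=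
  fun _ hf => DifferentiableOn.mono hf h

theorem contAlg_anti {V W : Set ℂ} (h : V ⊆ W) : contAlg W ≤ contAlg V :=
  fun _ hf => ContinuousOn.mono hf h

theorem holoAlg_le_contAlg (V : Set ℂ) : holoAlg V ≤ contAlg V :=
  fun _ hf => DifferentiableOn.continuousOn hf

/-! ### Uniqueness of analytic continuation -/

theorem isOpen_Cstar : IsOpen {l : ℂ | l ≠ 0} := isOpen_ne

theorem isPreconnected_Cstar : IsPreconnected {l : ℂ | l ≠ 0} :=
  (isConnected_compl_singleton_of_one_lt_rank (by simp) (0 : ℂ)).isPreconnected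

/-- Scaling a point of `ℂ*` radially to modulus `ρ`. -/
theorem norm_radial {ρ : ℝ} (hρ : 0 < ρ) {l : ℂ} (hl : l ≠ 0) : ‖((ρ / ‖l‖ : ℝ) : ℂ) * l‖ = ρ := by
  have : 0 < ‖l‖ := norm_pos_iff.2 hl
  rw [norm_mul, norm_real, Real.norm_of_nonneg (by positivity)]
  field_simp

theorem eq_zero_of_eqOn_puncturedBall {f : ℂ → ℂ} (hf : DifferentiableOn ℂ f {l | l ≠ 0}) {r : ℝ}
    (hr : 0 < r) (h : ∀ l, l ≠ 0 → ‖l‖ < r → f l = 0) (l : ℂ) (hl : l ≠ 0) : f l = 0 := by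
  have hz : ((r / 2 : ℝ) : ℂ) ≠ 0 := by exact_mod_cast (half_pos hr).ne'
  refine (hf.analyticOnNhd isOpen_Cstar).eqOn_zero_of_preconnected_of_eventuallyEq_zero
    isPreconnected_Cstar (z₀ := ((r / 2 : ℝ) : ℂ)) hz ?_ hl
  have : ‖((r / 2 : ℝ) : ℂ)‖ < r := by
    rw [norm_real, Real.norm_of_nonneg (by positivity)]; linarith
  filter_upwards [isOpen_Cstar.mem_nhds hz, (isOpen_lt continuous_norm continuous_const).mem_nhds
    this] with w hw hw' using h w hw hw'

theorem continuousOn_ite_norm_le {V : Set ℂ} {f g : ℂ → ℂ} {ρ : ℝ}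
    (hf : ContinuousOn f (V ∩ {l | ‖l‖ ≤ ρ})) (hg : ContinuousOn g (V ∩ {l | ρ ≤ ‖l‖}))
    (hfg : ∀ l ∈ V, ‖l‖ = ρ → f l = g l) :
    ContinuousOn (fun l => if ‖l‖ ≤ ρ then f l else g l) V := by
  refine ContinuousOn.if (fun l hl => ?_) (hf.mono ?_) (hg.mono ?_)
  · exact hfg l hl.1 (frontier_le_subset_eq continuous_norm continuous_const hl.2)
  · rw [(isClosed_le continuous_norm continuous_const).closure_eq]
  · simp only [not_le]
    exact inter_subset_inter_right _ (closure_lt_subset_le continuous_const continuous_norm)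

theorem differentiableOn_ite_norm_le {V : Set ℂ} (hV : IsOpen V) {f g : ℂ → ℂ} {ρ : ℝ}
    (hf : DifferentiableOn ℂ f (V ∩ {l | ‖l‖ < ρ}))
    (hg : DifferentiableOn ℂ g (V ∩ {l | ρ < ‖l‖})) :
    DifferentiableOn ℂ (fun l => if ‖l‖ ≤ ρ then f l else g l) (V \ sphere 0 ρ) := by
  rintro l ⟨hl, hlρ⟩
  rcases lt_or_gt_of_ne (fun h => hlρ (mem_sphere_zero_iff_norm.2 h)) with hlρ | hlρ
  · have ho := (hV.inter (isOpen_lt continuous_norm continuous_const)).mem_nhds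
      (show l ∈ V ∩ {l | ‖l‖ < ρ} from ⟨hl, hlρ⟩)
    refine ((hf.differentiableAt ho).congr_of_eventuallyEq ?_).differentiableWithinAt
    filter_upwards [ho] with w hw
    rw [if_pos (le_of_lt hw.2)]
  · have ho := (hV.inter (isOpen_lt continuous_const continuous_norm)).mem_nhds
      (show l ∈ V ∩ {l | ρ < ‖l‖} from ⟨hl, hlρ⟩)
    refine ((hg.differentiableAt ho).congr_of_eventuallyEq ?_).differentiableWithinAt
    filter_upwards [ho] with w hw
    rw [if_neg (not_le.2 hw.2)]

/-- A function that is holomorphic on a punctured disc, continuous up to the boundary circle, and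
zero there, vanishes. -/
theorem eq_zero_of_eq_zero_on_sphere {f : ℂ → ℂ} {r : ℝ} (hr : 0 < r)
    (hc : ContinuousOn f {l | l ≠ 0 ∧ ‖l‖ ≤ r}) (hd : DifferentiableOn ℂ f {l | l ≠ 0 ∧ ‖l‖ < r})
    (h : ∀ l ∈ sphere (0 : ℂ) r, f l = 0) (l : ℂ) (hl : l ≠ 0) (hlr : ‖l‖ ≤ r) : f l = 0 := by
  -- The origin may be an essential singularity, so the maximum principle is not available. Instead,
  -- the extension by zero is holomorphic across `C_r`, and the identity theorem on `ℂ*` applies.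
  set g : ℂ → ℂ := fun l => if ‖l‖ ≤ r then f l else 0 with hg
  have hgd : DifferentiableOn ℂ g {l | l ≠ 0} := by
    refine differentiableOn_of_off_sphere (ρ := r) isOpen_Cstar (by simp)
      (continuousOn_ite_norm_le hc continuousOn_const fun l _ hl =>
        h l (mem_sphere_zero_iff_norm.2 hl))
      (differentiableOn_ite_norm_le isOpen_Cstar hd (differentiableOn_const 0))
  have hz : ((2 * r : ℝ) : ℂ) ≠ 0 := by exact_mod_cast (by positivity : (2 * r) ≠ 0)
  have := (hgd.analyticOnNhd isOpen_Cstar).eqOn_zero_of_preconnected_of_eventuallyEq_zero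
    isPreconnected_Cstar (z₀ := ((2 * r : ℝ) : ℂ)) hz (by
      have : r < ‖((2 * r : ℝ) : ℂ)‖ := by
        rw [norm_real, Real.norm_of_nonneg (by positivity)]; linarith
      filter_upwards [(isOpen_lt continuous_const continuous_norm).mem_nhds this] with w hw
      simp only [hg, Pi.zero_apply]
      rw [if_neg (not_le.2 hw)]) hl
  simpa [hg, hlr] using this

/-- Carries the identities that define dressing and monodromy from `C_r` into the punctured disc,
although frames are singular at the origin. -/
theorem EntriesIn.eq_of_eqOn_sphere {A B : ℂ → Mat2} {r : ℝ} (hr : 0 < r)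
    (hAc : EntriesIn (contAlg {l | l ≠ 0 ∧ ‖l‖ ≤ r}) A)
    (hAd : EntriesIn (holoAlg {l | l ≠ 0 ∧ ‖l‖ < r}) A)
    (hBc : EntriesIn (contAlg {l | l ≠ 0 ∧ ‖l‖ ≤ r}) B)
    (hBd : EntriesIn (holoAlg {l | l ≠ 0 ∧ ‖l‖ < r}) B)
    (h : ∀ l ∈ sphere (0 : ℂ) r, A l = B l) (l : ℂ) (hl : l ≠ 0) (hlr : ‖l‖ ≤ r) : A l = B l := by
  ext i j
  rw [← sub_eq_zero]
  exact eq_zero_of_eq_zero_on_sphere (f := fun l => A l i j - B l i j) hr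
    ((hAc i j).sub (hBc i j)) ((hAd i j).sub (hBd i j)) (fun l hl => by rw [h l hl, sub_self]) l
    hl hlr

theorem EntriesIn.eq_of_eqOn_puncturedBall {A B : ℂ → Mat2} {r : ℝ} (hr : 0 < r)
    (hA : EntriesIn (holoAlg {l | l ≠ 0}) A) (hB : EntriesIn (holoAlg {l | l ≠ 0}) B)
    (h : ∀ l, l ≠ 0 → ‖l‖ < r → A l = B l) (l : ℂ) (hl : l ≠ 0) : A l = B l := by
  ext i j
  rw [← sub_eq_zero]
  exact eq_zero_of_eqOn_puncturedBall (f := fun l => A l i j - B l i j)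
    ((hA i j).sub (hB i j)) hr (fun l hl hlr => by rw [h l hl hlr, sub_self]) l hl

/-- A function that is holomorphic on `ℂ*` and zero on the circle `C_r` vanishes. -/
theorem eq_zero_of_eqOn_sphere_Cstar {f : ℂ → ℂ} (hf : DifferentiableOn ℂ f {l | l ≠ 0}) {r : ℝ}
    (hr : 0 < r) (h : ∀ l ∈ sphere (0 : ℂ) r, f l = 0) (l : ℂ) (hl : l ≠ 0) : f l = 0 :=
  eq_zero_of_eqOn_puncturedBall hf hr (fun l hl hlr =>
    eq_zero_of_eq_zero_on_sphere hr (hf.continuousOn.mono fun _ h => h.1)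
      (hf.mono fun _ h => h.1) h l hl hlr.le) l hl

/-! ### Reflection in the unit circle -/

/-- The reflection `λ ↦ 1/λ̄` in the unit circle. -/
noncomputable def circRefl (l : ℂ) : ℂ := (starRingEnd ℂ l)⁻¹

theorem circRefl_ne_zero {l : ℂ} (hl : l ≠ 0) : circRefl l ≠ 0 := by simpa [circRefl] using hl

@[simp] theorem norm_circRefl (l : ℂ) : ‖circRefl l‖ = ‖l‖⁻¹ := by simp [circRefl]

theorem circRefl_eq_self {l : ℂ} (hl : ‖l‖ = 1) : circRefl l = l := by
  rw [circRefl, inv_eq_iff_eq_inv, inv_eq_conj hl]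

theorem continuousOn_circRefl : ContinuousOn circRefl {l | l ≠ 0} :=
  ContinuousOn.inv₀ (continuous_conj.continuousOn) (by simp)

/-- The function is the composition of `conj ∘ f ∘ conj`, in which the two conjugations compensate,
with `λ ↦ 1/λ`. -/
theorem differentiableAt_conj_comp_circRefl {f : ℂ → ℂ} {l : ℂ} (hl : l ≠ 0)
    (hf : DifferentiableAt ℂ f (circRefl l)) :
    DifferentiableAt ℂ (fun l => starRingEnd ℂ (f (circRefl l))) l := by
  have h1 : DifferentiableAt ℂ (fun l => starRingEnd ℂ (f (starRingEnd ℂ l))) l⁻¹ := by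
    have := DifferentiableAt.conj_conj (f := f) (x := circRefl l) hf
    simpa [circRefl, Function.comp_def] using this
  have := DifferentiableAt.comp l h1 (differentiableAt_inv hl)
  simpa [Function.comp_def, circRefl] using this

theorem EntriesIn.conjTranspose_circRefl {A : ℂ → Mat2} (hA : EntriesIn (holoAlg {l | l ≠ 0}) A) :
    EntriesIn (holoAlg {l | l ≠ 0}) fun l => (A (circRefl l)).conjTranspose := by
  intro i j l hl
  exact (differentiableAt_conj_comp_circRefl (f := fun l => A l j i) hl
    (DifferentiableOn.differentiableAt (hA j i)
      (isOpen_Cstar.mem_nhds (circRefl_ne_zero hl)))).differentiableWithinAt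

/-! ### Square roots of nonvanishing functions -/

/-- Lifting of a homotopy of nonvanishing functions along the squaring map. -/
theorem exists_continuous_sqrt_of_homotopy {A : Type*} [TopologicalSpace A] (H : unitInterval × A → ℂ)
    (hHc : Continuous H) (hH : ∀ x, H x ≠ 0) (f : A → ℂ) (hfc : Continuous f)
    (hf : ∀ a, f a ^ 2 = H (0, a)) :
    ∃ b : A → ℂ, Continuous b ∧ (∀ a, b a ^ 2 = H (1, a)) ∧
      ∀ a, (∀ t, H (t, a) = H (0, a)) → b a = f a := by
  have cov := isCoveringMap_npow (𝕜 := ℂ) 2 (by norm_num)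
  have hf0 : ∀ a, f a ≠ 0 := fun a h => hH (0, a) (by rw [← hf, h]; norm_num)
  let H' : C(unitInterval × A, {x : ℂ // x ≠ 0}) := ⟨fun x => ⟨H x, hH x⟩, by fun_prop⟩
  let f' : C(A, {x : ℂ // x ≠ 0}) := ⟨fun a => ⟨f a, hf0 a⟩, by fun_prop⟩
  have h0 : ∀ a, H' (0, a) = (fun x : {x : ℂ // x ≠ 0} => (⟨x ^ 2, pow_ne_zero 2 x.2⟩ :
      {x : ℂ // x ≠ 0})) (f' a) := fun a => Subtype.ext (hf a).symm
  let L := cov.liftHomotopy H' f' h0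
  have hL : ∀ x, ((L x : {x : ℂ // x ≠ 0}) : ℂ) ^ 2 = H x := fun x =>
    congrArg Subtype.val (congrFun (cov.liftHomotopy_lifts H' f' h0) x)
  refine ⟨fun a => (L (1, a)).1, by fun_prop, fun a => hL (1, a), fun a ha => ?_⟩
  -- Where the homotopy is stationary, its lift runs in a discrete fibre of the squaring map, so it
  -- is stationary too.
  have h1 : L (1, a) = L (0, a) := by
    refine cov.const_of_comp (g := fun t : unitInterval => L (t, a)) (by fun_prop) ?_ 1 0
    intro t t'
    refine Subtype.ext ?_
    exact (hL _).trans ((ha t).trans ((ha t').symm.trans (hL _).symm))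
  refine (congrArg Subtype.val h1).trans ?_
  exact congrArg Subtype.val (cov.liftHomotopy_zero H' f' h0 a)

/-- A continuous square root of a nonvanishing holomorphic function is holomorphic. -/
theorem differentiableOn_of_sq {V : Set ℂ} (hV : IsOpen V) {b E : ℂ → ℂ} (hb : ContinuousOn b V)
    (hE : DifferentiableOn ℂ E V) (h0 : ∀ l ∈ V, E l ≠ 0) (hbE : ∀ l ∈ V, b l ^ 2 = E l) :
    DifferentiableOn ℂ b V := by
  intro l hl
  have hbc : ContinuousAt b l := hb.continuousAt (hV.mem_nhds hl)
  have hb0 : b l ≠ 0 := fun h => h0 l hl (by rw [← hbE l hl, h]; norm_num)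
  -- The holomorphic root of `w` near `E l` with the value `b l` at `E l`, built from the principal
  -- logarithm of a quotient near `1`.
  have hinv : HasDerivAt (fun w => (b l) * cexp (log (w / E l) / 2))
      (deriv (fun w => (b l) * cexp (log (w / E l) / 2)) (E l)) (E l) := by
    refine DifferentiableAt.hasDerivAt (DifferentiableAt.const_mul (DifferentiableAt.cexp
      (DifferentiableAt.div_const (DifferentiableAt.clog (by fun_prop) ?_) 2)) _)
    simp [div_self (h0 l hl)]
  have hcomp : DifferentiableAt ℂ (fun z => b l * cexp (log (E z / E l) / 2)) l :=
    DifferentiableAt.comp (g := fun w => (b l) * cexp (log (w / E l) / 2)) l hinv.differentiableAt (hE.differentiableAt (hV.mem_nhds hl))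
  refine (hcomp.congr_of_eventuallyEq ?_).differentiableWithinAt
  -- the quotient of the two roots is close to `1`, and its square is `1`
  have hlim : Filter.Tendsto (fun z => b z + b l * cexp (log (E z / E l) / 2)) (nhds l)
      (nhds (b l + b l * cexp (log (E l / E l) / 2))) :=
    hbc.add hcomp.continuousAt
  have hne : b l + b l * cexp (log (E l / E l) / 2) ≠ 0 := by
    simp [div_self (h0 l hl), ← two_mul, hb0]
  filter_upwards [hlim.eventually_ne hne, hV.mem_nhds hl] with z hz hzV
  have hsq : (b l * cexp (log (E z / E l) / 2)) ^ 2 = E z := by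
    rw [mul_pow, ← exp_nat_mul]
    have : ((2 : ℕ) : ℂ) * (log (E z / E l) / 2) = log (E z / E l) := by push_cast; ring
    rw [this, exp_log (div_ne_zero (h0 z hzV) (h0 l hl)), hbE l hl,
      mul_div_cancel₀ _ (h0 l hl)]
  rcases sq_eq_sq_iff_eq_or_eq_neg.1 ((hbE z hzV).trans hsq.symm) with h | h
  · exact h
  · exact absurd (by rw [h]; ring) hz

/-- A square root on a circle extends along radial segments. -/
theorem exists_continuousOn_sqrt_radial {S : Set ℂ} {ρ : ℝ} (hρ : 0 < ρ) (hS0 : (0 : ℂ) ∉ S)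
    (hS : ∀ l ∈ S, ∀ s ∈ uIcc (ρ / ‖l‖) 1, (s : ℂ) * l ∈ S) {E f : ℂ → ℂ} (hE : ContinuousOn E S)
    (hE0 : ∀ l ∈ S, E l ≠ 0) (hf : ContinuousOn f (S ∩ sphere 0 ρ))
    (hfE : ∀ l ∈ S, ‖l‖ = ρ → f l ^ 2 = E l) :
    ∃ b : ℂ → ℂ, ContinuousOn b S ∧ (∀ l ∈ S, b l ^ 2 = E l) ∧
      ∀ l ∈ S, ‖l‖ = ρ → b l = f l := by
  classical
  have hne : ∀ l : S, (l : ℂ) ≠ 0 := fun l h => hS0 (h ▸ l.2)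
  have hnorm : ∀ l : S, ‖(l : ℂ)‖ ≠ 0 := fun l => norm_ne_zero_iff.2 (hne l)
  -- The homotopy joins the radial projection to the circle with the identity. It is stationary on
  -- the circle, so the given root is preserved there.
  let s : unitInterval × S → ℝ := fun x => (1 - x.1) * (ρ / ‖(x.2 : ℂ)‖) + x.1
  have hsc : Continuous s := by
    refine Continuous.add (Continuous.mul (by fun_prop) (Continuous.div (by fun_prop)
      (by fun_prop) fun x => hnorm x.2)) (by fun_prop)
  have hs : ∀ x, s x ∈ uIcc (ρ / ‖(x.2 : ℂ)‖) 1 := by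
    rintro ⟨t, l⟩
    rw [← segment_eq_uIcc]
    exact ⟨1 - t, t, by linarith [t.2.2], t.2.1, by ring, by simp [s]⟩
  have hsS : ∀ x, (s x : ℂ) * x.2 ∈ S := fun x => hS _ x.2.2 _ (hs x)
  have hHc : Continuous fun x : unitInterval × S => E ((s x : ℂ) * x.2) :=
    hE.comp_continuous (by fun_prop) hsS
  have hs0 : ∀ l : S, s (0, l) = ρ / ‖(l : ℂ)‖ := fun l => by simp [s]
  have hs1 : ∀ l : S, s (1, l) = 1 := fun l => by simp [s]
  have hn0 : ∀ l : S, ‖((s (0, l) : ℝ) : ℂ) * l‖ = ρ := fun l => by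
    rw [hs0]; exact norm_radial hρ (hne l)
  obtain ⟨b, hb, hbE, hbf⟩ := exists_continuous_sqrt_of_homotopy
    (fun x : unitInterval × S => E ((s x : ℂ) * x.2)) hHc (fun x => hE0 _ (hsS x))
    (fun l : S => f (((s (0, l) : ℝ) : ℂ) * l))
    (hf.comp_continuous (by fun_prop) fun l => ⟨hsS (0, l), by simpa using hn0 l⟩)
    (fun l => hfE _ (hsS (0, l)) (hn0 l))
  refine ⟨fun l => if h : l ∈ S then b ⟨l, h⟩ else 0, ?_, ?_, ?_⟩
  · rw [continuousOn_iff_continuous_domRestrict]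
    refine hb.congr fun l => ?_
    simp
  · intro l hl
    have := hbE ⟨l, hl⟩
    simp only [hs1] at this
    simpa [hl] using this
  · intro l hl hlρ
    have h1 : ∀ t, s (t, ⟨l, hl⟩) = 1 := fun t => by
      simp [s, hlρ, div_self hρ.ne']
    have := hbf ⟨l, hl⟩ (fun t => by simp only [h1])
    simp only [h1] at this
    simpa [hl] using this

/-- A nonvanishing holomorphic function on a disc has a holomorphic square root. -/
theorem exists_sqrt_ball {R : ℝ} {E : ℂ → ℂ} (hE : DifferentiableOn ℂ E (ball 0 R))
    (hE0 : ∀ l ∈ ball (0 : ℂ) R, E l ≠ 0) :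
    ∃ b : ℂ → ℂ, DifferentiableOn ℂ b (ball 0 R) ∧ ∀ l ∈ ball (0 : ℂ) R, b l ^ 2 = E l := by
  classical
  have hmem : ∀ x : unitInterval × ball (0 : ℂ) R, ((x.1 : ℝ) : ℂ) * x.2 ∈ ball (0 : ℂ) R := by
    rintro ⟨t, l⟩
    have hl := mem_ball_zero_iff.1 l.2
    rw [mem_ball_zero_iff, norm_mul, norm_real, Real.norm_of_nonneg t.2.1]
    exact (mul_le_of_le_one_left (norm_nonneg _) t.2.2).trans_lt hl
  obtain ⟨c, hc⟩ := IsAlgClosed.exists_pow_nat_eq (E 0) (n := 2) (by norm_num)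
  -- The disc is contracted to the origin, so the lift starts from the constant root `c` of `E 0`.
  obtain ⟨b, hb, hbE, -⟩ := exists_continuous_sqrt_of_homotopy
    (fun x : unitInterval × ball (0 : ℂ) R => E (((x.1 : ℝ) : ℂ) * x.2))
    (hE.continuousOn.comp_continuous (by fun_prop) hmem) (fun x => hE0 _ (hmem x))
    (fun _ => c) continuous_const (fun l => by simp [hc])
  have hb2 : ∀ l ∈ ball (0 : ℂ) R, (if h : l ∈ ball (0 : ℂ) R then b ⟨l, h⟩ else 0) ^ 2 = E l := by
    intro l hl
    have := hbE ⟨l, hl⟩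
    simp only [hl, dif_pos]
    simpa using this
  refine ⟨fun l => if h : l ∈ ball (0 : ℂ) R then b ⟨l, h⟩ else 0,
    differentiableOn_of_sq isOpen_ball ?_ hE hE0 hb2, hb2⟩
  rw [continuousOn_iff_continuous_domRestrict]
  refine hb.congr fun l => ?_
  change b l = if h : (l : ℂ) ∈ ball (0 : ℂ) R then b ⟨l, h⟩ else 0
  rw [dif_pos l.2]

/-! ### Zeros of holomorphic functions -/

theorem exists_factor_zero {V : Set ℂ} (hV : IsOpen V) {u : ℂ → ℂ} (hu : DifferentiableOn ℂ u V)
    {z : ℂ} (hz : z ∈ V) (h0 : ¬ ∀ᶠ w in nhds z, u w = 0) :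
    ∃ (n : ℕ) (v : ℂ → ℂ), DifferentiableOn ℂ v V ∧ (∀ w ∈ V, u w = (w - z) ^ n * v w) ∧
      v z ≠ 0 := by
  classical
  have ha : AnalyticAt ℂ u z := hu.analyticAt (hV.mem_nhds hz)
  obtain ⟨n, g, hg, hgz, hug⟩ := ha.exists_eventuallyEq_pow_smul_nonzero_iff.2 h0
  have hne : ∀ w, w ≠ z → (w - z) ^ n ≠ 0 := fun w hw => pow_ne_zero n (sub_ne_zero.2 hw)
  set v : ℂ → ℂ := fun w => if w = z then g z else u w / (w - z) ^ n with hv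
  have hvg : v =ᶠ[nhds z] g := by
    filter_upwards [hug] with w hw
    by_cases hwz : w = z
    · simp [hv, hwz]
    · simp only [hv, if_neg hwz, hw, smul_eq_mul]
      rw [mul_div_cancel_left₀ _ (hne w hwz)]
  refine ⟨n, v, ?_, ?_, by simpa [hv] using hgz⟩
  · intro w hw
    by_cases hwz : w = z
    · subst hwz
      exact (hg.differentiableAt.congr_of_eventuallyEq hvg).differentiableWithinAt
    · have : DifferentiableAt ℂ (fun w => u w / (w - z) ^ n) w :=
        (hu.differentiableAt (hV.mem_nhds hw)).div (by fun_prop) (hne w hwz)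
      refine (this.congr_of_eventuallyEq ?_).differentiableWithinAt
      filter_upwards [isOpen_ne.mem_nhds hwz] with x hx
      simp only [hv, if_neg hx]
  · intro w hw
    by_cases hwz : w = z
    · subst hwz
      have := hug.self_of_nhds
      simpa [hv] using this
    · simp only [hv, if_neg hwz]
      rw [mul_div_cancel₀ _ (hne w hwz)]

/-- The zeros are collected in an entire factor `Q`, because `Q` has to be evaluated near the origin
as well, where `u` may be singular. -/
theorem exists_factor_zeros {V : Set ℂ} (hV : IsOpen V) {u : ℂ → ℂ} (hu : DifferentiableOn ℂ u V)
    (Z : Finset ℂ) (hZ : ∀ z ∈ Z, z ∈ V) (h0 : ∀ z ∈ Z, ¬ ∀ᶠ w in nhds z, u w = 0) :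
    ∃ Q v : ℂ → ℂ, Differentiable ℂ Q ∧ (∀ w, w ∉ Z → Q w ≠ 0) ∧ DifferentiableOn ℂ v V ∧
      (∀ w ∈ V, u w = Q w * v w) ∧ ∀ z ∈ Z, v z ≠ 0 := by
  classical
  induction Z using Finset.induction_on with
  | empty => exact ⟨fun _ => 1, u, differentiable_const _, by simp, hu, by simp, by simp⟩
  | insert z Z hzZ ih =>
    obtain ⟨Q, v, hQ, hQ0, hv, huv, hvZ⟩ := ih (fun w hw => hZ w (Finset.mem_insert_of_mem hw))
      fun w hw => h0 w (Finset.mem_insert_of_mem hw)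
    have hzV := hZ z (Finset.mem_insert_self z Z)
    obtain ⟨n, v', hv', hvv', hz'⟩ := exists_factor_zero hV hv hzV fun h => by
      refine h0 z (Finset.mem_insert_self z Z) ?_
      filter_upwards [h, hV.mem_nhds hzV] with w hw hwV
      rw [huv w hwV, hw, mul_zero]
    refine ⟨fun w => Q w * (w - z) ^ n, v', by fun_prop, ?_, hv', ?_, ?_⟩
    · intro w hw
      rw [Finset.mem_insert, not_or] at hw
      exact mul_ne_zero (hQ0 w hw.2) (pow_ne_zero n (sub_ne_zero.2 hw.1))
    · intro w hw
      rw [huv w hw, hvv' w hw]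
      ring
    · intro w hw
      rcases Finset.mem_insert.1 hw with rfl | hw
      · exact hz'
      · intro h
        refine hvZ w hw ?_
        rw [hvv' w (hZ w (Finset.mem_insert_of_mem hw)), h, mul_zero]

theorem eq_zero_of_eventually_eq_zero {f : ℂ → ℂ} (hf : DifferentiableOn ℂ f {l | l ≠ 0}) {z : ℂ}
    (hz : z ≠ 0) (h : ∀ᶠ w in nhds z, f w = 0) (l : ℂ) (hl : l ≠ 0) : f l = 0 :=
  (hf.analyticOnNhd isOpen_Cstar).eqOn_zero_of_preconnected_of_eventuallyEq_zero
    isPreconnected_Cstar (z₀ := z) hz h hl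

theorem finite_zeros_of_isCompact {f : ℂ → ℂ} (hf : DifferentiableOn ℂ f {l | l ≠ 0})
    (h0 : ∃ l, l ≠ 0 ∧ f l ≠ 0) {K : Set ℂ} (hK : IsCompact K) (hK0 : (0 : ℂ) ∉ K) :
    {z ∈ K | f z = 0}.Finite := by
  by_contra hinf
  obtain ⟨z, hzK, hz⟩ := Set.Infinite.exists_accPt_of_subset_isCompact hinf hK (sep_subset _ _)
  have hz0 : z ≠ 0 := fun h => hK0 (h ▸ hzK)
  obtain ⟨l, hl, hfl⟩ := h0
  refine hfl ((hf.analyticOnNhd isOpen_Cstar).eqOn_zero_of_preconnected_of_frequently_eq_zero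
    isPreconnected_Cstar (z₀ := z) hz0 ?_ hl)
  exact (accPt_iff_frequently_nhdsNE.1 hz).mono fun w hw => hw.2

theorem isCompact_annulus (a b : ℝ) : IsCompact {l : ℂ | a ≤ ‖l‖ ∧ ‖l‖ ≤ b} := by
  have : {l : ℂ | a ≤ ‖l‖ ∧ ‖l‖ ≤ b} = closedBall 0 b ∩ {l | a ≤ ‖l‖} := by
    ext l; simp [and_comm]
  rw [this]
  exact (isCompact_closedBall 0 b).inter_right (isClosed_le continuous_const continuous_norm)

theorem finite_zeros_annulus {f : ℂ → ℂ} (hf : DifferentiableOn ℂ f {l | l ≠ 0})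
    (h0 : ∃ l, l ≠ 0 ∧ f l ≠ 0) {a : ℝ} (ha : 0 < a) (b : ℝ) :
    {z : ℂ | (a ≤ ‖z‖ ∧ ‖z‖ ≤ b) ∧ f z = 0}.Finite :=
  finite_zeros_of_isCompact hf h0 (isCompact_annulus a b) fun h => absurd h.1 (by simpa using ha)

/-- There are arbitrarily small circles without zeros. -/
theorem exists_radius_ne_zero {f : ℂ → ℂ} (hf : DifferentiableOn ℂ f {l | l ≠ 0})
    (h0 : ∃ l, l ≠ 0 ∧ f l ≠ 0) {r : ℝ} (hr : 0 < r) :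
    ∃ ρ, 0 < ρ ∧ ρ < r ∧ ∀ l : ℂ, ‖l‖ = ρ → f l ≠ 0 := by
  have hfin := (finite_zeros_annulus hf h0 (half_pos hr) r).image fun z => ‖z‖
  obtain ⟨ρ, hρ, hρ'⟩ := (Ioo_infinite (half_lt_self hr)).exists_notMem_finite hfin
  exact ⟨ρ, (half_pos hr).trans hρ.1, hρ.2, fun l hl hfl => hρ'
    ⟨l, ⟨⟨hl ▸ hρ.1.le, hl ▸ hρ.2.le⟩, hfl⟩, hl⟩⟩

/-- A function that is holomorphic on `ℂ*`, bounded near the origin, and real on the unit circle, is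
constant. -/
theorem eq_const_of_bounded_near_zero {f : ℂ → ℂ} (hf : DifferentiableOn ℂ f {l | l ≠ 0})
    (hrefl : ∀ l, l ≠ 0 → starRingEnd ℂ (f (circRefl l)) = f l) {ε M : ℝ} (hε : 0 < ε)
    (hM : ∀ l, l ≠ 0 → ‖l‖ < ε → ‖f l‖ ≤ M) : ∃ c, ∀ l, l ≠ 0 → f l = c := by
  have hs : ({0}ᶜ : Set ℂ) = {l | l ≠ 0} := rfl
  have hb : BddAbove (norm ∘ f '' (ball 0 ε \ {0})) := by
    refine ⟨M, ?_⟩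
    rintro _ ⟨l, ⟨hl, hl0⟩, rfl⟩
    exact hM l hl0 (mem_ball_zero_iff.1 hl)
  -- The bound makes the origin a removable singularity, so `g` is entire.
  set g := Function.update f 0 ((nhdsWithin 0 {0}ᶜ).limUnder f) with hg
  have hgf : ∀ l, l ≠ 0 → g l = f l := fun l hl => by simp [hg, hl]
  have hgb : DifferentiableOn ℂ g (ball 0 ε) :=
    Complex.differentiableOn_update_limUnder_of_bddAbove (ball_mem_nhds 0 hε)
      (hf.mono fun l hl => hl.2) hb
  have hgd : Differentiable ℂ g := by
    intro l
    by_cases hl : l = 0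
    · subst hl
      exact hgb.differentiableAt (ball_mem_nhds 0 hε)
    · refine (hf.differentiableAt (isOpen_Cstar.mem_nhds hl)).congr_of_eventuallyEq ?_
      filter_upwards [isOpen_Cstar.mem_nhds hl] with w hw using hgf w hw
  -- Reflection carries the bound near the origin to a neighborhood of infinity; Liouville's theorem
  -- then applies.
  have hbdd : Bornology.IsBounded (range g) := by
    have hK : IsCompact (g '' closedBall 0 (2 / ε)) :=
      (isCompact_closedBall 0 _).image hgd.continuous
    refine (hK.isBounded.union (isBounded_closedBall (x := (0 : ℂ)) (r := M))).subset ?_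
    rintro _ ⟨l, rfl⟩
    rcases le_or_gt ‖l‖ (2 / ε) with h | h
    · exact Or.inl ⟨l, mem_closedBall_zero_iff.2 h, rfl⟩
    · right
      have hl0 : 0 < ‖l‖ := lt_trans (by positivity) h
      have hl : l ≠ 0 := norm_pos_iff.1 hl0
      rw [mem_closedBall_zero_iff, hgf l hl, ← hrefl l hl, norm_conj]
      refine hM _ (circRefl_ne_zero hl) ?_
      rw [norm_circRefl, inv_lt_comm₀ hl0 hε]
      refine lt_of_lt_of_le ?_ h.le
      rw [inv_eq_one_div]
      gcongr
      norm_num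
  refine ⟨g 0, fun l hl => ?_⟩
  rw [← hgf l hl]
  exact hgd.apply_eq_apply_of_bounded hbdd l 0

/-! ### Conjugation by a loop with nonconstant trace -/

/-- The Cayley–Hamilton theorem for `2 × 2` matrices. The adjugate replaces the inverse in what
follows: it is linear in the entries, so it preserves holomorphy. -/
theorem adjugate_eq_trace_sub (A : Mat2) : A.adjugate = A.trace • (1 : Mat2) - A := by
  ext i j
  fin_cases i <;> fin_cases j <;> simp [Matrix.adjugate_fin_two, Matrix.trace_fin_two]

/-- The part of `X` off the commutant of `χ` satisfies the recursion
`χ⁻¹ D χ + χ D χ⁻¹ = (tr χ² - 2) D`. -/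
theorem conj_recursion {χ G G' P N : Mat2} (hdet : χ.det = 1) (h1 : χ * G' = G * χ)
    (h2 : χ * P = (G' - G) * χ) (h3 : χ * (G' - G) = N * χ) :
    P + N = (χ.trace ^ 2 - 2) • (G' - G) := by
  set A := χ.adjugate with hA
  have hχA : χ * A = 1 := by rw [hA, Matrix.mul_adjugate, hdet, one_smul]
  have hAχ : A * χ = 1 := by rw [hA, Matrix.adjugate_mul, hdet, one_smul]
  have hsum : A = χ.trace • (1 : Mat2) - χ := adjugate_eq_trace_sub χ
  set t := χ.trace
  -- The commutator `K` anticommutes with the trace-free part of `χ`, so moving `χ` past `K` turns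
  -- it into `χ⁻¹`. Hence `D = Kχ`, `P = Kχ·χ²` and `N = Kχ·χ⁻²`, and `χ² + χ⁻²` is the scalar `t² -
  -- 2`.
  set K := G * χ - χ * G with hK
  have hsq : χ * χ = t • χ - 1 := by
    have : χ * A = t • χ - χ * χ := by rw [hsum]; simp [mul_sub]
    rw [← hχA, this]; abel
  have hpol : K * χ + χ * K = t • K := by
    have : K * χ + χ * K = G * (χ * χ) - χ * χ * G := by rw [hK]; noncomm_ring
    rw [this, hsq, hK]
    simp only [mul_sub, sub_mul, mul_smul_comm, smul_mul_assoc, mul_one, one_mul, smul_sub]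
    abel
  have hAK : A * K = K * χ := by
    rw [hsum, sub_mul, smul_mul_assoc, one_mul, ← hpol]; abel
  have hD : G' - G = K * χ := by
    rw [← hAK, hK, mul_sub, ← h1, ← mul_assoc, ← mul_assoc, hAχ, one_mul, one_mul]
  have hP : P = K * χ * (χ * χ) := by
    calc P = A * (χ * P) := by rw [← mul_assoc, hAχ, one_mul]
      _ = A * K * χ * χ := by rw [h2, hD]; simp only [mul_assoc]
      _ = _ := by rw [hAK]; simp only [mul_assoc]
  have hN : N = K * χ * (A * A) := by
    calc N = N * χ * A := by rw [mul_assoc, hχA, mul_one]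
      _ = χ * (G' - G) * A := by rw [h3]
      _ = χ * (A * K) * A := by rw [hD, hAK]
      _ = K * A := by rw [← mul_assoc, hχA, one_mul]
      _ = K * (χ * A) * A := by rw [hχA, mul_one]
      _ = _ := by simp only [mul_assoc]
  have hAA : A * A = (t ^ 2 - 1) • (1 : Mat2) - t • χ := by
    have : A * A = t • A - A * χ := by
      nth_rewrite 2 [hsum]; simp [mul_sub]
    rw [this, hAχ, hsum, smul_sub, smul_smul, sub_smul, one_smul, pow_two]; abel
  have hs : χ * χ + A * A = (t ^ 2 - 2) • (1 : Mat2) := by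
    rw [hsq, hAA]; module
  rw [hP, hN, ← mul_add, hs, hD, mul_smul_comm, mul_one]

open Topology in
/-- A holomorphic family of matrices that remains holomorphic at the origin under all conjugations by
powers of a reflection-symmetric loop `χ` with nonconstant trace commutes with `χ`. -/
theorem commute_of_conj_invariant {χ : ℂ → Mat2} (hχ : EntriesIn (holoAlg {l | l ≠ 0}) χ)
    (hdet : ∀ l, l ≠ 0 → (χ l).det = 1)
    (hrefl : ∀ l, l ≠ 0 → starRingEnd ℂ (χ (circRefl l)).trace = (χ l).trace)
    (htr : ¬ ∃ c : ℂ, ∀ l : ℂ, l ≠ 0 → (χ l).trace = c) {r : ℝ} (hr : 0 < r)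
    (𝒜 : Set (ℂ → Mat2)) (hol : ∀ G ∈ 𝒜, EntriesIn (holoAlg (ball 0 r)) G)
    (hfwd : ∀ G ∈ 𝒜, ∃ G' ∈ 𝒜, ∀ l, l ≠ 0 → ‖l‖ < r → χ l * G' l = G l * χ l)
    (hbwd : ∀ G ∈ 𝒜, ∃ G' ∈ 𝒜, ∀ l, l ≠ 0 → ‖l‖ < r → χ l * G l = G' l * χ l)
    {G : ℂ → Mat2} (hG : G ∈ 𝒜) (l : ℂ) (hl : l ≠ 0) (hlr : ‖l‖ < r) :
    χ l * G l = G l * χ l := by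
  by_contra hne
  obtain ⟨G', hG', hGG'⟩ := hfwd G hG
  let T : Set (ℂ → Mat2) := {D | ∃ G ∈ 𝒜, ∃ G' ∈ 𝒜,
    (∀ l, l ≠ 0 → ‖l‖ < r → χ l * G' l = G l * χ l) ∧ D = fun l => G' l - G l}
  have hTan : ∀ D ∈ T, ∀ i j, AnalyticAt ℂ (fun l => D l i j) 0 := by
    rintro _ ⟨G, hG, G', hG', -, rfl⟩ i j
    exact DifferentiableOn.analyticAt ((hol G' hG').sub (hol G hG) i j) (ball_mem_nhds 0 hr)
  -- The finite vanishing orders at the origin of entries of differences. If there were none, the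
  -- first difference would vanish and `G` would commute with `χ`. An entry of minimal order is then
  -- compared with the same entry of the two neighboring differences.
  let N : Set ℕ := {n | ∃ D ∈ T, ∃ i j, analyticOrderAt (fun l => D l i j) 0 = n}
  have hN : N.Nonempty := by
    have hD : (fun l => G' l - G l) ∈ T := ⟨G, hG, G', hG', hGG', rfl⟩
    have : ∃ i j, analyticOrderAt (fun l => G' l i j - G l i j) 0 ≠ ⊤ := by
      by_contra hall
      push Not at hall
      refine hne ?_
      have : G' l = G l := by
        ext i j
        rw [← sub_eq_zero]
        have hd : DifferentiableOn ℂ (fun l => G' l i j - G l i j) (ball 0 r) :=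
          (hol G' hG').sub (hol G hG) i j
        exact (hd.analyticOnNhd isOpen_ball).eqOn_zero_of_preconnected_of_eventuallyEq_zero
          (convex_ball 0 r).isPreconnected (mem_ball_self hr)
          (analyticOrderAt_eq_top.1 (hall i j)) (mem_ball_zero_iff.2 hlr)
      rw [← hGG' l hl hlr, this]
    obtain ⟨i, j, hij⟩ := this
    exact ⟨_, _, hD, i, j, (ENat.natCast_toNat hij).symm⟩
  classical
  set n := sInf N
  obtain ⟨D, ⟨G, hG, G', hG', hGG', rfl⟩, i, j, hn⟩ : n ∈ N := Nat.sInf_mem hN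
  have hle : ∀ D ∈ T, (n : ℕ∞) ≤ analyticOrderAt (fun l => D l i j) 0 := by
    intro D hD
    by_cases htop : analyticOrderAt (fun l => D l i j) 0 = ⊤
    · rw [htop]; exact le_top
    · rw [← ENat.natCast_toNat htop]
      exact Nat.cast_le.2 (Nat.sInf_le (s := N) ⟨D, hD, i, j, (ENat.natCast_toNat htop).symm⟩)
  obtain ⟨G₂, hG₂, hGG₂⟩ := hfwd G' hG'
  obtain ⟨G₀, hG₀, hGG₀⟩ := hbwd G hG
  have hP : (fun l => G₂ l - G' l) ∈ T := ⟨G', hG', G₂, hG₂, hGG₂, rfl⟩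
  have hM : (fun l => G l - G₀ l) ∈ T := ⟨G₀, hG₀, G, hG, hGG₀, rfl⟩
  have hD : (fun l => G' l - G l) ∈ T := ⟨G, hG, G', hG', hGG', rfl⟩
  obtain ⟨p, hp, hp'⟩ := (natCast_le_analyticOrderAt (hTan _ hP i j)).1 (hle _ hP)
  obtain ⟨m, hm, hm'⟩ := (natCast_le_analyticOrderAt (hTan _ hM i j)).1 (hle _ hM)
  obtain ⟨d, hd, hd0, hd'⟩ := ((hTan _ hD i j).analyticOrderAt_eq_natCast).1 hn
  -- near the origin, `tr² - 2` is the quotient `(p + m) / d`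
  have hquot : ∀ᶠ l in 𝓝 (0 : ℂ), l ≠ 0 → (χ l).trace ^ 2 = (p l + m l) / d l + 2 := by
    filter_upwards [hp', hm', hd', hd.continuousAt.eventually_ne hd0, ball_mem_nhds 0 hr]
      with l hp hm hd hd0 hlr hl
    have hlr' := mem_ball_zero_iff.1 hlr
    have := conj_recursion (hdet l hl) (hGG' l hl hlr') (P := G₂ l - G' l) (N := G l - G₀ l)
      (by rw [mul_sub, sub_mul, hGG₂ l hl hlr', hGG' l hl hlr'])
      (by rw [mul_sub, sub_mul, hGG' l hl hlr', hGG₀ l hl hlr'])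
    have hij := congrFun (congrFun this i) j
    simp only [Matrix.add_apply, Matrix.sub_apply, Matrix.smul_apply, smul_eq_mul, sub_zero]
      at hij hp hm hd
    rw [hp, hm, hd] at hij
    have hln : l ^ n ≠ 0 := pow_ne_zero n hl
    rw [eq_comm, ← eq_sub_iff_add_eq, div_eq_iff hd0]
    exact mul_left_cancel₀ hln (by linear_combination hij)
  have hcont : ContinuousAt (fun l => (p l + m l) / d l + 2) 0 :=
    ((hp.continuousAt.add hm.continuousAt).div hd.continuousAt hd0).add continuousAt_const
  obtain ⟨B, hB⟩ : ∃ B, ∀ᶠ l in 𝓝 (0 : ℂ), ‖(p l + m l) / d l + 2‖ ≤ B :=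
    ⟨_, (hcont.norm.eventually_lt_const (lt_add_one _)).mono fun _ h => le_of_lt h⟩
  obtain ⟨ε, hε, hball⟩ := Metric.eventually_nhds_iff_ball.1 (hquot.and hB)
  -- The bound `B` is for the square of the trace `t`, and `|t| ≤ |t|² + 1`.
  refine htr (eq_const_of_bounded_near_zero (f := fun l => (χ l).trace) (ε := ε) (M := B + 1)
    hχ.trace_mem hrefl hε fun l hl hlε => ?_)
  obtain ⟨h1, h2⟩ := hball l (mem_ball_zero_iff.2 hlε)
  rw [← h1 hl, norm_pow] at h2
  nlinarith [norm_nonneg (χ l).trace, sq_nonneg (‖(χ l).trace‖ - 1)]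

/-! ### Continuation of a matrix function proportional to a loop -/

/-- Trace-free matrices satisfy `XG + GX = tr(GX)`, so for commuting ones `GX` is the scalar
`tr(GX)/2`. Multiplication by `X` and `X² = -det X` give the proportionality, without division by
`det X`. -/
theorem smul_eq_smul_of_commute {X G : Mat2} (hX : X.trace = 0) (hG : G.trace = 0)
    (h : X * G = G * X) : (-X.det) • G = ((G * X).trace / 2) • X := by
  have e : ∀ i j, (X * G) i j = (G * X) i j := fun i j => by rw [h]
  have e00 := e 0 0
  have e01 := e 0 1
  have e10 := e 1 0
  simp only [Matrix.mul_apply, Fin.sum_univ_two] at e00 e01 e10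
  rw [Matrix.trace_fin_two] at hX hG
  have hX' : X 1 1 = -X 0 0 := by linear_combination hX
  have hG' : G 1 1 = -G 0 0 := by linear_combination hG
  rw [hX', hG'] at e01 e10
  ext i j
  simp only [Matrix.smul_apply, smul_eq_mul, Matrix.trace_fin_two, Matrix.mul_apply,
    Fin.sum_univ_two, Matrix.det_fin_two]
  fin_cases i <;> fin_cases j <;> simp only [Fin.zero_eta, Fin.mk_one, hX', hG']
  · linear_combination (-X 1 0 / 4) * e01 + (X 0 1 / 4) * e10
  · linear_combination (X 0 0 / 2) * e01 + (-X 0 1 / 2) * e00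
  · linear_combination (-X 0 0 / 2) * e10 + (X 1 0 / 2) * e00
  · linear_combination (X 1 0 / 4) * e01 - (X 0 1 / 4) * e10

/-- Determinants of the preceding proportionality, with a factor `det X` cancelled. This is what
makes the factor of proportionality a square root. -/
theorem trace_mul_sq_of_commute {X G : Mat2} (hX : X.trace = 0) (hG : G.trace = 0)
    (h : X * G = G * X) (hd : X.det ≠ 0) : ((G * X).trace / 2) ^ 2 = X.det * G.det := by
  have h1 := smul_eq_smul_of_commute hX hG h
  have h2 := congrArg Matrix.det h1
  rw [Matrix.det_smul, Matrix.det_smul, Fintype.card_fin] at h2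
  refine mul_right_cancel₀ hd ?_
  rw [← h2]
  ring

/-- If a holomorphic trace-free matrix function `G` on a disc commutes with a trace-free loop `X` on
`ℂ*`, then a nonzero multiple of `G` near the origin extends holomorphically to a large disc. -/
theorem exists_extension_of_commute {X : ℂ → Mat2} (hX : EntriesIn (holoAlg {l | l ≠ 0}) X)
    (hXtr : ∀ l, l ≠ 0 → (X l).trace = 0) (hXdet : ∃ l, l ≠ 0 ∧ (X l).det ≠ 0) {r : ℝ}
    (hr : 0 < r) {G : ℂ → Mat2} (hG : EntriesIn (holoAlg (ball 0 r)) G)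
    (hGtr : ∀ l ∈ ball (0 : ℂ) r, (G l).trace = 0)
    (hcomm : ∀ l, l ≠ 0 → ‖l‖ < r → X l * G l = G l * X l)
    (hG0 : ∃ l ∈ ball (0 : ℂ) r, G l ≠ 0) :
    ∃ (Y : ℂ → Mat2) (w : ℂ → ℂ) (ρ : ℝ), 0 < ρ ∧ ρ < r ∧ ρ < 1 ∧
      EntriesIn (holoAlg (ball 0 2)) Y ∧ (∀ l ∈ ball (0 : ℂ) 2, (Y l).trace = 0) ∧
      DifferentiableOn ℂ w (ball 0 ρ) ∧ (∀ l ∈ ball (0 : ℂ) ρ, Y l = w l • G l) ∧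
      ∃ l ∈ ball (0 : ℂ) ρ, l ≠ 0 ∧ Y l ≠ 0 := by
  classical
  have hdhol : DifferentiableOn ℂ (fun l => (X l).det) {l | l ≠ 0} := hX.det_mem
  have hdGhol : DifferentiableOn ℂ (fun l => (G l).det) (ball 0 r) := hG.det_mem
  have hsub : {l : ℂ | l ≠ 0 ∧ ‖l‖ < r} ⊆ ball 0 r := fun l hl => mem_ball_zero_iff.2 hl.2
  have hsub' : {l : ℂ | l ≠ 0 ∧ ‖l‖ < r} ⊆ {l | l ≠ 0} := fun l hl => hl.1
  have hphol : DifferentiableOn ℂ (fun l => (G l * X l).trace / 2) {l | l ≠ 0 ∧ ‖l‖ < r} :=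
    ((hG.mono (holoAlg_anti hsub)).mul (hX.mono (holoAlg_anti hsub'))).trace_mem.div_const 2
  have hGtr' : ∀ l : ℂ, ‖l‖ < r → (G l).trace = 0 := fun l hl => hGtr l (mem_ball_zero_iff.2 hl)
  -- a matrix function vanishing near some point of the disc vanishes
  have hGzero : ∀ z ∈ ball (0 : ℂ) r, ¬ ∀ᶠ l in nhds z, G l = 0 := by
    intro z hz h
    obtain ⟨l, hl, hne⟩ := hG0
    refine hne ?_
    ext i j
    exact (DifferentiableOn.analyticOnNhd (hG i j)
      isOpen_ball).eqOn_zero_of_preconnected_of_eventuallyEq_zero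
      (convex_ball 0 r).isPreconnected hz (h.mono fun w hw => by simp [hw]) hl
  -- Where `det X ≠ 0`, a commuting `G` with zero determinant is zero.
  have hdG0 : ¬ ∀ᶠ l in nhds (0 : ℂ), (G l).det = 0 := by
    intro h
    have hz : ∀ l ∈ ball (0 : ℂ) r, (G l).det = 0 := fun l hl =>
      (hdGhol.analyticOnNhd isOpen_ball).eqOn_zero_of_preconnected_of_eventuallyEq_zero
        (convex_ball 0 r).isPreconnected (mem_ball_self hr) h hl
    obtain ⟨ρ, hρ, hρr, hdρ⟩ := exists_radius_ne_zero hdhol hXdet hr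
    have hz0 : ((ρ : ℝ) : ℂ) ≠ 0 := by exact_mod_cast hρ.ne'
    have hzn : ‖((ρ : ℝ) : ℂ)‖ = ρ := by rw [norm_real, Real.norm_of_nonneg hρ.le]
    refine hGzero (ρ : ℂ) (mem_ball_zero_iff.2 (hzn.trans_lt hρr)) ?_
    filter_upwards [isOpen_Cstar.mem_nhds hz0, isOpen_ball.mem_nhds
      (mem_ball_zero_iff.2 (hzn.trans_lt hρr)), (hdhol.continuousOn.continuousAt
        (isOpen_Cstar.mem_nhds hz0)).eventually_ne (hdρ _ hzn)] with l hl hlr hld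
    have hlr' := mem_ball_zero_iff.1 hlr
    have h1 := smul_eq_smul_of_commute (hXtr l hl) (hGtr l hlr) (hcomm l hl hlr')
    have h2 := trace_mul_sq_of_commute (hXtr l hl) (hGtr l hlr) (hcomm l hl hlr') hld
    rw [hz l hlr, mul_zero, sq_eq_zero_iff] at h2
    rw [h2, zero_smul, smul_eq_zero] at h1
    exact h1.resolve_left (neg_ne_zero.2 hld)
  -- the factorization of the determinant of `G` at the origin
  obtain ⟨k, v, hv, hGv, hv0⟩ := exists_factor_zero isOpen_ball hdGhol (mem_ball_self hr) hdG0
  obtain ⟨r₁, hr₁, hr₁v⟩ : ∃ r₁ > 0, ball (0 : ℂ) r₁ ⊆ {l | v l ≠ 0} := Metric.mem_nhds_iff.1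
    ((hv.continuousOn.continuousAt (ball_mem_nhds 0 hr)).eventually_ne hv0)
  set R := min r₁ (min r 1) with hR
  have hRpos : 0 < R := lt_min hr₁ (lt_min hr one_pos)
  have hRr₁ : R ≤ r₁ := min_le_left _ _
  have hRr : R ≤ r := (min_le_right _ _).trans (min_le_left _ _)
  have hR1 : R ≤ 1 := (min_le_right _ _).trans (min_le_right _ _)
  obtain ⟨ρ, hρ, hρR, hdρ⟩ := exists_radius_ne_zero hdhol hXdet hRpos
  -- the zeros of `det X` in the annulus
  have hZfin := finite_zeros_annulus hdhol hXdet hρ 2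
  set Z := hZfin.toFinset with hZ
  have hZmem : ∀ z, z ∈ Z ↔ (ρ ≤ ‖z‖ ∧ ‖z‖ ≤ 2) ∧ (X z).det = 0 := fun z => by simp [hZ]
  have hZne : ∀ z ∈ Z, z ≠ 0 := fun z hz =>
    norm_pos_iff.1 (hρ.trans_le ((hZmem z).1 hz).1.1)
  obtain ⟨Q, u, hQ, hQ0, hu, hdu, huZ⟩ := exists_factor_zeros isOpen_Cstar hdhol Z hZne
    fun z hz h => by
      obtain ⟨l, hl, hne⟩ := hXdet
      exact hne (eq_zero_of_eventually_eq_zero hdhol (hZne z hz) h l hl)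
  have hu0 : ∀ l : ℂ, ρ ≤ ‖l‖ → ‖l‖ ≤ 2 → u l ≠ 0 := by
    intro l h1 h2 h
    by_cases hl : l ∈ Z
    · exact huZ l hl h
    · refine hl ((hZmem l).2 ⟨⟨h1, h2⟩, ?_⟩)
      rw [hdu l (norm_pos_iff.1 (hρ.trans_le h1)), h, mul_zero]
  -- The radius `ρ₁` lies below all zeros collected in `Q`, so that `Q` has a root on a disc
  -- slightly larger than that of radius `ρ`.
  obtain ⟨ρ₁, hρ₁, hρ₁R, hρ₁Z⟩ : ∃ ρ₁, ρ < ρ₁ ∧ ρ₁ < R ∧ ∀ z ∈ Z, ρ₁ < ‖z‖ := by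
    have h1 : ∀ᶠ x in nhdsWithin ρ (Ioi ρ), ∀ z ∈ Z, x < ‖z‖ := by
      refine (Filter.eventually_all_finset Z).2 fun z hz => ?_
      have hlt : ρ < ‖z‖ := lt_of_le_of_ne ((hZmem z).1 hz).1.1 fun h =>
        hdρ z h.symm ((hZmem z).1 hz).2
      exact (Ioo_mem_nhdsGT hlt : Ioo ρ ‖z‖ ∈ _) |> Filter.mem_of_superset <| fun x hx => hx.2
    obtain ⟨x, hx, hx'⟩ := (h1.and (Ioo_mem_nhdsGT hρR)).exists
    exact ⟨x, hx'.1, hx'.2, hx⟩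
  have hball₁ : ball (0 : ℂ) ρ₁ ⊆ ball 0 r := ball_subset_ball (hρ₁R.le.trans hRr)
  have hv₁ : ∀ l ∈ ball (0 : ℂ) ρ₁, v l ≠ 0 := fun l hl =>
    hr₁v (ball_subset_ball (hρ₁R.le.trans hRr₁) hl)
  have hQ₁ : ∀ l ∈ ball (0 : ℂ) ρ₁, Q l ≠ 0 := fun l hl => hQ0 l fun h =>
    (hρ₁Z l h).not_gt (mem_ball_zero_iff.1 hl)
  -- The zeros of `det X` in the annulus would obstruct a root there; the factor `Q` moves them into
  -- `w`, which needs a root of `Q` on the small disc only.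
  obtain ⟨w, hw, hwsq⟩ := exists_sqrt_ball (E := fun l => Q l / v l) (hQ.differentiableOn.div (hv.mono hball₁) hv₁)
    fun l hl => div_ne_zero (hQ₁ l hl) (hv₁ l hl)
  -- the square root on the annulus
  set S : Set ℂ := {l | ρ ≤ ‖l‖ ∧ ‖l‖ < 2} with hS
  have hS0 : ∀ l ∈ S, l ≠ 0 := fun l hl => norm_pos_iff.1 (hρ.trans_le hl.1)
  have hSsub : S ⊆ {l | l ≠ 0} := hS0
  have hρ_mem : ∀ l : ℂ, ‖l‖ = ρ → l ≠ 0 ∧ l ∈ ball (0 : ℂ) ρ₁ ∧ ‖l‖ < r := fun l hl =>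
    ⟨norm_pos_iff.1 (hl ▸ hρ), mem_ball_zero_iff.2 (hl ▸ hρ₁), by linarith⟩
  have hE : ∀ l ∈ S, u l ≠ 0 := fun l hl => hu0 l hl.1 hl.2.le
  have hEc : ContinuousOn (fun l => l ^ k / u l) S :=
    ContinuousOn.div (by fun_prop) (hu.continuousOn.mono hSsub) hE
  -- On `C_ρ` one has `wG = fX` for this `f`. With `det G = λᵏv` and `det X = Qu`, its square is
  -- `(Q/v)(λᵏv)/(Qu) = λᵏ/u`, which has neither zeros nor poles on the annulus. So `f` continues
  -- radially.
  obtain ⟨b, hb, hbsq, hbρ⟩ := exists_continuousOn_sqrt_radial (S := S)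
    (E := fun l => l ^ k / u l) (f := fun l => w l * ((G l * X l).trace / 2) / (-(X l).det)) hρ
    (fun h => hS0 0 h rfl) (by
      intro l hl s hs
      have hl0 : 0 < ‖l‖ := hρ.trans_le hl.1
      have hle : ρ / ‖l‖ ≤ 1 := (div_le_one hl0).2 hl.1
      rw [uIcc_of_le hle] at hs
      have hs0 : 0 ≤ s := (div_nonneg hρ.le hl0.le).trans hs.1
      refine ⟨?_, ?_⟩ <;> rw [norm_mul, norm_real, Real.norm_of_nonneg hs0]
      · exact (div_le_iff₀ hl0).1 hs.1
      · exact (mul_le_of_le_one_left hl0.le hs.2).trans_lt hl.2)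
    hEc (fun l hl => div_ne_zero (pow_ne_zero k (hS0 l hl)) (hE l hl))
    (by
      have hsph : S ∩ sphere 0 ρ ⊆ {l : ℂ | ‖l‖ = ρ} := fun l hl => mem_sphere_zero_iff_norm.1 hl.2
      refine ContinuousOn.mono ?_ hsph
      refine ContinuousOn.div (ContinuousOn.mul (hw.continuousOn.mono fun l hl => (hρ_mem l hl).2.1)
        (hphol.continuousOn.mono fun l hl => ⟨(hρ_mem l hl).1, (hρ_mem l hl).2.2⟩))
        (hdhol.continuousOn.neg.mono fun l hl => (hρ_mem l hl).1)
        fun l hl => neg_ne_zero.2 (hdρ l hl))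
    (by
      intro l hl hlρ
      obtain ⟨hl0, hl1, hlr⟩ := hρ_mem l hlρ
      have h2 := trace_mul_sq_of_commute (hXtr l hl0) (hGtr' l hlr) (hcomm l hl0 hlr) (hdρ l hlρ)
      rw [div_pow, mul_pow, h2, hwsq l hl1, hGv l (hball₁ hl1), sub_zero, neg_sq]
      have hd := hdρ l hlρ
      have hd' := hdu l hl0
      have := hv₁ l hl1
      have := hE l hl
      have := hQ₁ l hl1
      rw [hd'] at hd ⊢
      field_simp)
  have hbd : DifferentiableOn ℂ b {l | ρ < ‖l‖ ∧ ‖l‖ < 2} := by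
    have hsub : {l : ℂ | ρ < ‖l‖ ∧ ‖l‖ < 2} ⊆ S := fun l hl => ⟨hl.1.le, hl.2⟩
    refine differentiableOn_of_sq (E := fun l => l ^ k / u l) ((isOpen_lt continuous_const
      continuous_norm).inter (isOpen_lt continuous_norm continuous_const)) (hb.mono hsub)
      (DifferentiableOn.div (by fun_prop) (hu.mono fun l hl => hS0 l (hsub hl))
        fun l hl => hE l (hsub hl))
      (fun l hl => div_ne_zero (pow_ne_zero k (hS0 l (hsub hl))) (hE l (hsub hl)))
      fun l hl => hbsq l (hsub hl)
  set Y : ℂ → Mat2 := fun l => if ‖l‖ ≤ ρ then w l • G l else b l • X l with hY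
  have hYent : ∀ i j, (fun l => Y l i j) =
      fun l => if ‖l‖ ≤ ρ then w l * G l i j else b l * X l i j := by
    intro i j
    ext l
    simp only [hY]
    split_ifs <;> simp
  have hYnear : ∀ l ∈ ball (0 : ℂ) ρ, Y l = w l • G l := fun l hl => by
    simp only [hY]
    rw [if_pos (mem_ball_zero_iff.1 hl).le]
  have hwG : EntriesIn (holoAlg (ball 0 ρ₁)) fun l => w l • G l :=
    EntriesIn.smul (f := w) hw (hG.mono (holoAlg_anti hball₁))
  have hYhol : EntriesIn (holoAlg (ball 0 2)) Y := by
    intro i j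
    rw [hYent i j, mem_holoAlg]
    have hVo : IsOpen (ball (0 : ℂ) 2 \ {0}) := isOpen_ball.sdiff isClosed_singleton
    have key : DifferentiableOn ℂ (fun l => if ‖l‖ ≤ ρ then w l * G l i j else b l * X l i j)
        (ball (0 : ℂ) 2 \ {0}) := by
      refine differentiableOn_of_off_sphere (ρ := ρ) hVo (by simp)
        (continuousOn_ite_norm_le ?_ ?_ ?_) (differentiableOn_ite_norm_le hVo ?_ ?_)
      · exact (DifferentiableOn.continuousOn (hwG i j)).mono fun l hl =>
          mem_ball_zero_iff.2 (lt_of_le_of_lt hl.2 hρ₁)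
      · refine (hb.mul ((DifferentiableOn.continuousOn (hX i j)).mono hSsub)).mono
          fun l hl => ⟨hl.2, mem_ball_zero_iff.1 hl.1.1⟩
      · intro l hl hlρ
        obtain ⟨hl0, hl1, hlr⟩ := hρ_mem l hlρ
        rw [hbρ l ⟨hlρ.ge, mem_ball_zero_iff.1 hl.1⟩ hlρ]
        have h1 := congrFun (congrFun
          (smul_eq_smul_of_commute (hXtr l hl0) (hGtr' l hlr) (hcomm l hl0 hlr)) i) j
        simp only [Matrix.smul_apply, smul_eq_mul] at h1
        have hd := hdρ l hlρ
        rw [mul_div_assoc, mul_assoc, div_mul_eq_mul_div, ← h1,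
          mul_div_cancel_left₀ _ (neg_ne_zero.2 hd)]
      · exact DifferentiableOn.mono (hwG i j) fun l hl =>
          mem_ball_zero_iff.2 (lt_trans hl.2 hρ₁)
      · exact (hbd.mono fun l hl => ⟨hl.2, mem_ball_zero_iff.1 hl.1.1⟩).mul
          (DifferentiableOn.mono (hX i j) fun l hl => hl.1.2)
    intro l hl
    by_cases hl0 : l = 0
    · subst hl0
      have : DifferentiableAt ℂ (fun l => w l * G l i j) 0 :=
        DifferentiableOn.differentiableAt (hwG i j) (ball_mem_nhds 0 (hρ.trans hρ₁))
      refine (this.congr_of_eventuallyEq ?_).differentiableWithinAt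
      filter_upwards [ball_mem_nhds (0 : ℂ) hρ] with x hx
      rw [if_pos (mem_ball_zero_iff.1 hx).le]
    · exact (key.differentiableAt (hVo.mem_nhds ⟨hl, hl0⟩)).differentiableWithinAt
  refine ⟨Y, w, ρ, hρ, hρR.trans_le hRr, hρR.trans_le hR1, hYhol, ?_,
    hw.mono (ball_subset_ball hρ₁.le), hYnear, ?_⟩
  · intro l hl
    simp only [hY]
    split_ifs with h
    · rw [Matrix.trace_smul, hGtr' l (by linarith), smul_zero]
    · rw [Matrix.trace_smul, hXtr l, smul_zero]
      exact norm_pos_iff.1 (hρ.trans (not_le.1 h))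
  · by_contra hall
    push Not at hall
    have hz0 : ((ρ / 2 : ℝ) : ℂ) ≠ 0 := by exact_mod_cast (half_pos hρ).ne'
    have hzn : ((ρ / 2 : ℝ) : ℂ) ∈ ball (0 : ℂ) ρ := by
      rw [mem_ball_zero_iff, norm_real, Real.norm_of_nonneg (by positivity)]; linarith
    refine hGzero _ (hball₁ (ball_subset_ball hρ₁.le hzn)) ?_
    filter_upwards [isOpen_Cstar.mem_nhds hz0, isOpen_ball.mem_nhds hzn] with l hl hlρ
    have h1 := hall l hlρ hl
    rw [hYnear l hlρ, smul_eq_zero] at h1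
    have hl₁ := ball_subset_ball hρ₁.le hlρ
    refine h1.resolve_left fun h => div_ne_zero (hQ₁ l hl₁) (hv₁ l hl₁) ?_
    have h2 : w l ^ 2 = Q l / v l := hwsq l hl₁
    rw [← h2, h]; norm_num

/-! ### Loops as matrix functions -/

/-- The algebra of the functions that are holomorphic on the disc of radius `r` and continuous up to
its boundary. -/
def diffContAlg (r : ℝ) : Subalgebra ℂ (ℂ → ℂ) where
  carrier := {f | DiffContOnCl ℂ f (ball 0 r)}
  mul_mem' hf hg := DiffContOnCl.smul hf hg
  add_mem' hf hg := DiffContOnCl.add hf hg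
  algebraMap_mem' c := diffContOnCl_const (c := c)

theorem diffContAlg_le_holoAlg (r : ℝ) : diffContAlg r ≤ holoAlg (ball 0 r) :=
  fun _ hf => DiffContOnCl.differentiableOn hf

theorem diffContAlg_le_contAlg (r : ℝ) : diffContAlg r ≤ contAlg (closedBall 0 r) :=
  fun _ hf => DiffContOnCl.continuousOn_ball hf

theorem eqOn_closedBall_of_eqOn_sphere {r : ℝ} (hr : 0 < r) {f g : ℂ → ℂ} (hf : f ∈ diffContAlg r)
    (hg : g ∈ diffContAlg r) (h : EqOn f g (sphere 0 r)) : EqOn f g (closedBall 0 r) := by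
  rw [← closure_ball (0 : ℂ) hr.ne']
  exact Complex.eqOn_closure_of_eqOn_frontier isBounded_ball hf hg (by rwa [frontier_ball _ hr.ne'])

theorem EntriesIn.eqOn_closedBall {r : ℝ} (hr : 0 < r) {A B : ℂ → Mat2}
    (hA : EntriesIn (diffContAlg r) A) (hB : EntriesIn (diffContAlg r) B)
    (h : ∀ l ∈ sphere (0 : ℂ) r, A l = B l) (l : ℂ) (hl : ‖l‖ ≤ r) : A l = B l := by
  ext i j
  exact eqOn_closedBall_of_eqOn_sphere hr (hA i j) (hB i j) (fun l hl => by simp only [h l hl])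
    (mem_closedBall_zero_iff.2 hl)

theorem EntriesIn.comp_neg_diffCont {r : ℝ} {A : ℂ → Mat2} (hA : EntriesIn (diffContAlg r) A) :
    EntriesIn (diffContAlg r) fun l => A (-l) := by
  intro i j
  have h1 : DiffContOnCl ℂ (fun l : ℂ => -l) (ball 0 r) := differentiable_neg.diffContOnCl
  have h2 : DiffContOnCl ℂ (fun l => A l i j) (ball 0 r) := hA i j
  exact h2.comp h1 fun l hl => by simpa using hl

theorem sigma3_mul_sigma3 : sigma3 * sigma3 = 1 := by
  ext i j; fin_cases i <;> fin_cases j <;> simp [sigma3]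

theorem det_sigma3_conj (A : Mat2) : (sigma3 * A * sigma3).det = A.det := by
  rw [Matrix.det_mul, Matrix.det_mul, mul_comm, ← mul_assoc, ← Matrix.det_mul, sigma3_mul_sigma3,
    Matrix.det_one, one_mul]

theorem trace_sigma3_conj (A : Mat2) : (sigma3 * A * sigma3).trace = A.trace := by
  rw [Matrix.trace_mul_comm, ← mul_assoc, sigma3_mul_sigma3, one_mul]

theorem sigma3_conj_mul (A B : Mat2) :
    sigma3 * (A * B) * sigma3 = (sigma3 * A * sigma3) * (sigma3 * B * sigma3) := by
  calc sigma3 * (A * B) * sigma3 = sigma3 * A * 1 * B * sigma3 := by simp only [mul_assoc, one_mul]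
    _ = _ := by rw [← sigma3_mul_sigma3]; simp only [mul_assoc]

theorem adjugate_sigma3_conj (A : Mat2) :
    sigma3 * A.adjugate * sigma3 = (sigma3 * A * sigma3).adjugate := by
  rw [adjugate_eq_trace_sub, adjugate_eq_trace_sub, trace_sigma3_conj, mul_sub, sub_mul,
    mul_smul_comm, smul_mul_assoc, mul_one, sigma3_mul_sigma3]

namespace IsLoopSLPlus

variable {r : ℝ} {h : ℂ → Mat2}

theorem entriesIn (hh : IsLoopSLPlus r h) : EntriesIn (diffContAlg r) h := hh.extends_disc

theorem det_eq_one_closedBall (hr : 0 < r) (hh : IsLoopSLPlus r h) {l : ℂ} (hl : ‖l‖ ≤ r) :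
    (h l).det = 1 :=
  eqOn_closedBall_of_eqOn_sphere hr hh.entriesIn.det_mem ((diffContAlg r).algebraMap_mem 1)
    hh.det_eq_one (mem_closedBall_zero_iff.2 hl)

theorem twisted_closedBall (hr : 0 < r) (hh : IsLoopSLPlus r h) {l : ℂ} (hl : ‖l‖ ≤ r) :
    sigma3 * h (-l) * sigma3 = h l :=
  EntriesIn.eqOn_closedBall hr (((EntriesIn.const _ sigma3).mul hh.entriesIn.comp_neg_diffCont).mul
    (EntriesIn.const _ sigma3)) hh.entriesIn hh.twisted l hl

end IsLoopSLPlus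

theorem IsLoopSUCstar.entriesIn {χ : ℂ → Mat2} (hχ : IsLoopSUCstar χ) :
    EntriesIn (holoAlg {l | l ≠ 0}) χ := hχ.analytic

/-- A function that is holomorphic near the unit circle is smooth on it. -/
theorem contDiff_comp_circleMap {V : Set ℂ} (hV : IsOpen V) (hs : sphere (0 : ℂ) 1 ⊆ V) {f : ℂ → ℂ}
    (hf : DifferentiableOn ℂ f V) : ContDiff ℝ ∞ fun t : ℝ => f (circleMap 0 1 t) := by
  have h1 : ContDiffOn ℝ ∞ f V := (hf.contDiffOn hV).restrict_scalars ℝ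
  refine contDiffOn_univ.1 (h1.comp (contDiff_circleMap 0 1).contDiffOn fun t _ => hs ?_)
  exact circleMap_mem_sphere 0 zero_le_one t

/-- Twisted version of `exists_extension_of_commute`. -/
theorem exists_twisted_extension_of_commute {X : ℂ → Mat2} (hX : EntriesIn (holoAlg {l | l ≠ 0}) X)
    (hXtr : ∀ l, l ≠ 0 → (X l).trace = 0) (hXdet : ∃ l, l ≠ 0 ∧ (X l).det ≠ 0) {r : ℝ}
    (hr : 0 < r) {G : ℂ → Mat2} (hG : EntriesIn (holoAlg (ball 0 r)) G)
    (hGtr : ∀ l ∈ ball (0 : ℂ) r, (G l).trace = 0)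
    (hGtw : ∀ l ∈ ball (0 : ℂ) r, sigma3 * G (-l) * sigma3 = G l)
    (hcomm : ∀ l, l ≠ 0 → ‖l‖ < r → X l * G l = G l * X l)
    (hG0 : ∃ l ∈ ball (0 : ℂ) r, G l ≠ 0) :
    ∃ (Y : ℂ → Mat2) (w : ℂ → ℂ) (ρ : ℝ), 0 < ρ ∧ ρ < r ∧ ρ < 1 ∧
      EntriesIn (holoAlg (ball 0 2)) Y ∧ (∀ l ∈ ball (0 : ℂ) 2, (Y l).trace = 0) ∧
      (∀ l, sigma3 * Y (-l) * sigma3 = Y l) ∧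
      DifferentiableOn ℂ w (ball 0 ρ) ∧ (∀ l ∈ ball (0 : ℂ) ρ, Y l = w l • G l) ∧
      ∃ l ∈ ball (0 : ℂ) ρ, l ≠ 0 ∧ Y l ≠ 0 := by
  obtain ⟨Y, w, ρ, hρ, hρr, hρ1, hY, hYtr, hw, hYw, l₀, hl₀, hl₀0, hYl₀⟩ :=
    exists_extension_of_commute hX hXtr hXdet hr hG hGtr hcomm hG0
  have hneg : ∀ R : ℝ, ∀ l ∈ ball (0 : ℂ) R, -l ∈ ball (0 : ℂ) R := fun R l hl => by simpa using hl
  have hY' : EntriesIn (holoAlg (ball 0 2)) fun l => sigma3 * Y (-l) * sigma3 :=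
    ((EntriesIn.const _ _).mul (hY.comp_neg (hneg 2))).mul (EntriesIn.const _ _)
  have hw' : DifferentiableOn ℂ (fun l => w (-l)) (ball 0 ρ) :=
    hw.comp differentiable_neg.differentiableOn (hneg ρ)
  have hY'w : ∀ l ∈ ball (0 : ℂ) ρ, sigma3 * Y (-l) * sigma3 = w (-l) • G l := fun l hl => by
    rw [hYw _ (hneg ρ l hl), mul_smul_comm, smul_mul_assoc,
      hGtw l (ball_subset_ball hρr.le hl)]
  have hσ : ∀ A : Mat2, sigma3 * (sigma3 * A * sigma3) * sigma3 = A := fun A => by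
    calc _ = (sigma3 * sigma3) * A * (sigma3 * sigma3) := by simp only [mul_assoc]
      _ = A := by rw [sigma3_mul_sigma3, one_mul, mul_one]
  -- Either the twisted part of `Y` is nonzero, or `Y` is antitwisted near the origin and `λ` times
  -- its antitwisted part serves. Both are scalar multiples of `G` near the origin.
  by_cases he : ∃ l ∈ ball (0 : ℂ) ρ, l ≠ 0 ∧ Y l + sigma3 * Y (-l) * sigma3 ≠ 0
  · refine ⟨fun l => Y l + sigma3 * Y (-l) * sigma3, fun l => w l + w (-l), ρ, hρ, hρr, hρ1,
      hY.add hY', fun l hl => ?_, fun l => ?_, hw.add hw', fun l hl => ?_, he⟩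
    · rw [Matrix.trace_add, trace_sigma3_conj, hYtr l hl, hYtr _ (hneg 2 l hl), add_zero]
    · beta_reduce
      rw [neg_neg, mul_add, add_mul, hσ, add_comm]
    · beta_reduce
      rw [add_smul, hYw l hl, hY'w l hl]
  · push Not at he
    refine ⟨fun l => l • (Y l - sigma3 * Y (-l) * sigma3), fun l => l * (w l - w (-l)), ρ, hρ, hρr,
      hρ1, EntriesIn.smul (f := fun l => l) differentiableOn_id (hY.sub hY'), fun l hl => ?_,
      fun l => ?_, differentiableOn_id.mul (hw.sub hw'), fun l hl => ?_, l₀, hl₀, hl₀0, ?_⟩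
    · rw [Matrix.trace_smul, Matrix.trace_sub, trace_sigma3_conj, hYtr l hl,
        hYtr _ (hneg 2 l hl), sub_zero, smul_zero]
    · beta_reduce
      rw [neg_neg, mul_smul_comm, smul_mul_assoc, mul_sub, sub_mul, hσ, neg_smul, ← smul_neg,
        neg_sub]
    · beta_reduce
      rw [hYw l hl, hY'w l hl, ← sub_smul, smul_smul]
    · beta_reduce
      rw [eq_neg_of_add_eq_zero_right (he l₀ hl₀ hl₀0), sub_neg_eq_add, ← two_smul ℂ, smul_smul]
      exact smul_ne_zero (mul_ne_zero hl₀0 two_ne_zero) hYl₀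

/-! ### The Cayley transform -/

theorem mul_self_of_trace_eq_zero {A : Mat2} (hA : A.trace = 0) : A * A = (-A.det) • (1 : Mat2) := by
  have h := Matrix.mul_adjugate A
  rw [adjugate_eq_trace_sub, hA, zero_smul, zero_sub, mul_neg] at h
  rw [neg_smul, ← h, neg_neg]

/-- The Cayley transform `(1 + A) (1 - A)⁻¹` of a trace-free matrix with determinant `δ`, without
the inverse. -/
noncomputable def cayley (δ : ℂ) (A : Mat2) : Mat2 := (1 + δ)⁻¹ • ((1 + A) * (1 + A))

/-- For trace-free `A` one has `(1 + A)(1 - A) = 1 + det A` and `det(1 + A) = 1 + det A`. The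
transform thus has determinant one without the extraction of a root. -/
theorem det_cayley {A : Mat2} (hA : A.trace = 0) (h : 1 + A.det ≠ 0) : (cayley A.det A).det = 1 := by
  have h1 : (1 + A).det = 1 + A.det := by
    rw [Matrix.trace_fin_two] at hA
    simp only [Matrix.det_fin_two, Matrix.add_apply, Matrix.one_apply_eq, ne_eq, zero_ne_one,
      one_ne_zero, not_false_eq_true, Matrix.one_apply_ne, zero_add]
    linear_combination hA
  rw [cayley, Matrix.det_smul, Matrix.det_mul, h1, Fintype.card_fin]
  field_simp

theorem eq_zero_of_cayley_eq_one {A : Mat2} (hA : A.trace = 0) (h : 1 + A.det ≠ 0)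
    (h1 : cayley A.det A = 1) : A = 0 := by
  have h2 : (1 + A) * (1 + A) = (1 + A.det) • (1 : Mat2) := by
    conv_rhs => rw [← h1, cayley, smul_smul, mul_inv_cancel₀ h, one_smul]
  have h3 : A = A.det • (1 : Mat2) := by
    have : (1 + A) * (1 + A) = 1 + (2 : ℂ) • A + A * A := by rw [two_smul]; noncomm_ring
    rw [this, mul_self_of_trace_eq_zero hA] at h2
    have h4 : (2 : ℂ) • A = (2 : ℂ) • (A.det • (1 : Mat2)) := by
      have h5 : (2 : ℂ) • A = 1 + (2 : ℂ) • A + -A.det • (1 : Mat2) - (1 + -A.det • (1 : Mat2)) := by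
        abel
      rw [h5, h2]
      module
    exact smul_right_injective _ two_ne_zero h4
  have h5 := congrArg Matrix.trace h3
  rw [hA, Matrix.trace_smul, Matrix.trace_one, Fintype.card_fin] at h5
  have h6 : A.det = 0 := by simpa using h5.symm
  rw [h3, h6, zero_smul]

/-- The traces of `(1 + A)² = -(1 + det A)` are `2 - 2 det A` and `-2 - 2 det A`. -/
theorem cayley_ne_neg_one {A : Mat2} (hA : A.trace = 0) (h : 1 + A.det ≠ 0) :
    cayley A.det A ≠ -1 := by
  intro h1
  have h2 : (1 + A) * (1 + A) = -((1 + A.det) • (1 : Mat2)) := by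
    rw [← smul_neg, ← h1, cayley, smul_smul, mul_inv_cancel₀ h, one_smul]
  have : (1 + A) * (1 + A) = 1 + (2 : ℂ) • A + A * A := by rw [two_smul]; noncomm_ring
  rw [this, mul_self_of_trace_eq_zero hA] at h2
  have h5 := congrArg Matrix.trace h2
  simp only [Matrix.trace_add, Matrix.trace_smul, Matrix.trace_neg, Matrix.trace_one, hA,
    Fintype.card_fin, smul_eq_mul] at h5
  have h6 : (4 : ℂ) = 0 := by push_cast at h5; linear_combination h5
  norm_num at h6

/-! ### The isotropy group -/

theorem diagU1_mul_conj {u : ℂ} (hu : ‖u‖ = 1) : diagU1 u * diagU1 (starRingEnd ℂ u) = 1 := by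
  have h : u * starRingEnd ℂ u = 1 := by
    rw [mul_conj, normSq_eq_norm_sq, hu]; norm_num
  have h' : starRingEnd ℂ u * u = 1 := by rw [mul_comm, h]
  ext i j
  fin_cases i <;> fin_cases j <;> simp [diagU1, h, h']

theorem adjugate_mul_of_det {A : Mat2} (h : A.det = 1) : A.adjugate * A = 1 := by
  rw [Matrix.adjugate_mul, h, one_smul]

theorem mul_adjugate_of_det {A : Mat2} (h : A.det = 1) : A * A.adjugate = 1 := by
  rw [Matrix.mul_adjugate, h, one_smul]

section Isotropy

variable {X : Type*}

/-- The matrix functions `G` on a disc for which `F⁻¹ G F` extends holomorphically to the origin. -/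
def positiveAlgebra (r : ℝ) (F : X → ℂ → Mat2) : Set (ℂ → Mat2) :=
  {G | EntriesIn (holoAlg (ball 0 r)) G ∧ ∀ z, ∃ B : ℂ → Mat2, EntriesIn (holoAlg (ball 0 r)) B ∧
    ∀ l, l ≠ 0 → ‖l‖ < r → G l * F z l = F z l * B l}

theorem positiveAlgebra.sub_half_trace {r : ℝ} {F : X → ℂ → Mat2} {G : ℂ → Mat2}
    (hG : G ∈ positiveAlgebra r F) :
    (fun l => G l - ((G l).trace / 2) • (1 : Mat2)) ∈ positiveAlgebra r F := by
  have hs : EntriesIn (holoAlg (ball 0 r)) fun l => ((G l).trace / 2) • (1 : Mat2) :=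
    EntriesIn.smul (f := fun l => (G l).trace / 2) (DifferentiableOn.div_const hG.1.trace_mem 2)
      (EntriesIn.const _ 1)
  refine ⟨hG.1.sub hs, fun z => ?_⟩
  obtain ⟨B, hB, h⟩ := hG.2 z
  refine ⟨fun l => B l - ((G l).trace / 2) • (1 : Mat2), hB.sub hs, fun l hl hlr => ?_⟩
  rw [sub_mul, mul_sub, h l hl hlr, smul_mul_assoc, mul_smul_comm, one_mul, mul_one]

variable {F : X → ℂ → Mat2} {z₀ : X} {τ : X ≃ X} {χ : ℂ → Mat2} {u : X → ℂ} {r : ℝ}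

/-- By the normalization `F(τ z₀) = χk` with `k` constant in `λ`, so positivity of `G` at `τ z₀`
says that `χ⁻¹Gχ` extends to the disc. Its positivity at `z` is that of `G` at `τ z`. -/
theorem positiveAlgebra.conj_forward (hF₀ : ∀ l, l ≠ 0 → F z₀ l = 1)
    (hdet : ∀ l, l ≠ 0 → (χ l).det = 1) (hu : ∀ z, ‖u z‖ = 1)
    (hτ : ∀ z l, l ≠ 0 → ‖l‖ < r → F (τ z) l = χ l * F z l * diagU1 (u z)) {G : ℂ → Mat2}
    (hG : G ∈ positiveAlgebra r F) :
    ∃ G' ∈ positiveAlgebra r F, ∀ l, l ≠ 0 → ‖l‖ < r → χ l * G' l = G l * χ l := by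
  obtain ⟨B₁, hB₁, hGB₁⟩ := hG.2 (τ z₀)
  have key : ∀ l, l ≠ 0 → ‖l‖ < r →
      χ l * (diagU1 (u z₀) * B₁ l * diagU1 (starRingEnd ℂ (u z₀))) = G l * χ l := by
    intro l hl hlr
    have h := hGB₁ l hl hlr
    rw [hτ z₀ l hl hlr, hF₀ l hl, mul_one] at h
    calc _ = (χ l * diagU1 (u z₀) * B₁ l) * diagU1 (starRingEnd ℂ (u z₀)) := by
          simp only [mul_assoc]
      _ = G l * χ l * (diagU1 (u z₀) * diagU1 (starRingEnd ℂ (u z₀))) := by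
          rw [← h]; simp only [mul_assoc]
      _ = _ := by rw [diagU1_mul_conj (hu z₀), mul_one]
  refine ⟨fun l => diagU1 (u z₀) * B₁ l * diagU1 (starRingEnd ℂ (u z₀)),
    ⟨((EntriesIn.const _ _).mul hB₁).mul (EntriesIn.const _ _), fun z => ?_⟩, key⟩
  obtain ⟨B, hB, hGB⟩ := hG.2 (τ z)
  refine ⟨fun l => diagU1 (u z) * B l * diagU1 (starRingEnd ℂ (u z)),
    ((EntriesIn.const _ _).mul hB).mul (EntriesIn.const _ _), fun l hl hlr => ?_⟩
  have h := hGB l hl hlr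
  rw [hτ z l hl hlr] at h
  set G' := diagU1 (u z₀) * B₁ l * diagU1 (starRingEnd ℂ (u z₀))
  have hA := adjugate_mul_of_det (hdet l hl)
  calc G' * F z l = (χ l).adjugate * χ l * G' * F z l := by rw [hA, one_mul]
    _ = (χ l).adjugate * (χ l * G') * F z l * (diagU1 (u z) * diagU1 (starRingEnd ℂ (u z))) := by
        rw [diagU1_mul_conj (hu z), mul_one]; simp only [mul_assoc]
    _ = (χ l).adjugate * (G l * (χ l * F z l * diagU1 (u z))) * diagU1 (starRingEnd ℂ (u z)) := by
        rw [key l hl hlr]; simp only [mul_assoc]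
    _ = ((χ l).adjugate * χ l) * (F z l * (diagU1 (u z) * B l * diagU1 (starRingEnd ℂ (u z)))) := by
        rw [h]; simp only [mul_assoc]
    _ = _ := by rw [hA, one_mul]

/-- The same argument with `τ⁻¹`, which carries positivity at `τ⁻¹ z` to `z`. -/
theorem positiveAlgebra.conj_backward (hF₀ : ∀ l, l ≠ 0 → F z₀ l = 1) (hu : ∀ z, ‖u z‖ = 1)
    (hτ : ∀ z l, l ≠ 0 → ‖l‖ < r → F (τ z) l = χ l * F z l * diagU1 (u z)) {G : ℂ → Mat2}
    (hG : G ∈ positiveAlgebra r F) :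
    ∃ G' ∈ positiveAlgebra r F, ∀ l, l ≠ 0 → ‖l‖ < r → χ l * G l = G' l * χ l := by
  have conj : ∀ z, ∃ B : ℂ → Mat2, EntriesIn (holoAlg (ball 0 r)) B ∧
      ∀ l, l ≠ 0 → ‖l‖ < r → χ l * G l * (F (τ.symm z) l * diagU1 (u (τ.symm z))) = F z l * B l := by
    intro z
    obtain ⟨B, hB, hGB⟩ := hG.2 (τ.symm z)
    refine ⟨fun l => diagU1 (starRingEnd ℂ (u (τ.symm z))) * B l * diagU1 (u (τ.symm z)),
      ((EntriesIn.const _ _).mul hB).mul (EntriesIn.const _ _), fun l hl hlr => ?_⟩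
    have h1 := hτ (τ.symm z) l hl hlr
    rw [Equiv.apply_symm_apply] at h1
    calc _ = χ l * (G l * F (τ.symm z) l) * diagU1 (u (τ.symm z)) := by simp only [mul_assoc]
      _ = χ l * F (τ.symm z) l * (diagU1 (u (τ.symm z)) * diagU1 (starRingEnd ℂ (u (τ.symm z)))) *
          B l * diagU1 (u (τ.symm z)) := by
          rw [hGB l hl hlr, diagU1_mul_conj (hu _), mul_one]; simp only [mul_assoc]
      _ = _ := by rw [h1]; simp only [mul_assoc]
  have inv : ∀ z l, l ≠ 0 → ‖l‖ < r →
      χ l * (F (τ.symm z) l * diagU1 (u (τ.symm z))) = F z l := by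
    intro z l hl hlr
    have h1 := hτ (τ.symm z) l hl hlr
    rw [Equiv.apply_symm_apply] at h1
    rw [h1, mul_assoc]
  obtain ⟨B₀, hB₀, h₀⟩ := conj z₀
  have key : ∀ l, l ≠ 0 → ‖l‖ < r → χ l * G l = B₀ l * χ l := by
    intro l hl hlr
    have h1 := inv z₀ l hl hlr
    have h2 := h₀ l hl hlr
    rw [hF₀ l hl] at h1 h2
    rw [one_mul] at h2
    rw [← h2, mul_assoc, mul_eq_one_comm.1 h1, mul_one]
  refine ⟨B₀, ⟨hB₀, fun z => ?_⟩, key⟩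
  obtain ⟨B, hB, hGB⟩ := conj z
  refine ⟨B, hB, fun l hl hlr => ?_⟩
  rw [← hGB l hl hlr, ← inv z l hl hlr, ← mul_assoc, key l hl hlr]

end Isotropy

section Frame

variable {X : Type*} [TopologicalSpace X] [ChartedSpace ℂ X] {F : X → ℂ → Mat2}

theorem IsExtendedFrame.adjugate_mul (hF : IsExtendedFrame F) (z : X) {l : ℂ} (hl : l ≠ 0) :
    (F z l).adjugate * F z l = 1 := adjugate_mul_of_det ((hF.loop z).det_eq_one l hl)

theorem IsExtendedFrame.mul_adjugate (hF : IsExtendedFrame F) (z : X) {l : ℂ} (hl : l ≠ 0) :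
    F z l * (F z l).adjugate = 1 := mul_adjugate_of_det ((hF.loop z).det_eq_one l hl)

/-- If the isotropy group is trivial, then there is no nonzero twisted trace-free matrix function `Y`
on a neighborhood of the closed unit disc for which `F⁻¹ Y F` extends to the origin. -/
theorem eq_zero_of_hasTrivialIso (hF : IsExtendedFrame F) (hIso : HasTrivialIso 1 F)
    {Y : ℂ → Mat2} (hY : EntriesIn (holoAlg (ball 0 2)) Y)
    (hYtr : ∀ l ∈ ball (0 : ℂ) 2, (Y l).trace = 0) (hYtw : ∀ l, sigma3 * Y (-l) * sigma3 = Y l)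
    {ρ : ℝ} (hρ : 0 < ρ)
    (hYF : ∀ z, ∃ B : ℂ → Mat2, EntriesIn (holoAlg (ball 0 ρ)) B ∧
      ∀ l, l ≠ 0 → ‖l‖ < ρ → Y l * F z l = F z l * B l) (l : ℂ) (hl1 : ‖l‖ ≤ 1) :
    Y l = 0 := by
  classical
  have hball : closedBall (0 : ℂ) 1 ⊆ ball 0 2 := closedBall_subset_ball (by norm_num)
  have hsph : sphere (0 : ℂ) 1 ⊆ ball 0 2 := sphere_subset_closedBall.trans hball
  have hsph0 : ∀ l ∈ sphere (0 : ℂ) 1, l ≠ 0 := fun l hl h => by simp [h] at hl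
  -- a small multiple has determinant different from `-1`
  obtain ⟨M, hM⟩ := (isCompact_closedBall (0 : ℂ) 1).exists_bound_of_continuousOn
    ((mem_contAlg.1 (holoAlg_le_contAlg _ hY.det_mem)).mono hball)
  obtain ⟨t, ht0, ht⟩ : ∃ t : ℝ, 0 < t ∧ t ^ 2 * M < 1 := by
    have h1 : Filter.Tendsto (fun t : ℝ => t ^ 2 * M) (nhdsWithin 0 (Ioi 0)) (nhds (0 ^ 2 * M)) :=
      ((continuous_pow 2).mul continuous_const).continuousWithinAt
    rw [zero_pow two_ne_zero, zero_mul] at h1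
    obtain ⟨t, ht, ht'⟩ := ((h1.eventually (gt_mem_nhds one_pos)).and self_mem_nhdsWithin).exists
    exact ⟨t, ht', ht⟩
  have htc : (t : ℂ) ≠ 0 := by exact_mod_cast ht0.ne'
  set A : ℂ → Mat2 := fun l => (t : ℂ) • Y l with hAdef
  have hA : EntriesIn (holoAlg (ball 0 2)) A :=
    EntriesIn.smul (f := fun _ => (t : ℂ)) (differentiableOn_const _) hY
  have hAtr : ∀ l ∈ ball (0 : ℂ) 2, (A l).trace = 0 := fun l hl => by
    simp only [hAdef]
    rw [Matrix.trace_smul, hYtr l hl, smul_zero]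
  have hAtw : ∀ l, sigma3 * A (-l) * sigma3 = A l := fun l => by
    simp only [hAdef]
    rw [mul_smul_comm, smul_mul_assoc, hYtw]
  have hAdet : ∀ l ∈ closedBall (0 : ℂ) 1, 1 + (A l).det ≠ 0 := by
    intro l hl h
    have h1 : (A l).det = -1 := by linear_combination h
    have h2 := hM l hl
    have h3 : ‖(A l).det‖ = t ^ 2 * ‖(Y l).det‖ := by
      simp only [hAdef]
      rw [Matrix.det_smul, Fintype.card_fin, norm_mul, norm_pow, norm_real,
        Real.norm_of_nonneg ht0.le]
    rw [h1, norm_neg, norm_one] at h3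
    have : t ^ 2 * ‖(Y l).det‖ ≤ t ^ 2 * M := by gcongr
    linarith
  set V : Set ℂ := ball 0 2 ∩ (fun l => 1 + (A l).det) ⁻¹' {0}ᶜ with hV
  have hdetd : DifferentiableOn ℂ (fun l => 1 + (A l).det) (ball 0 2) :=
    (differentiableOn_const 1).add hA.det_mem
  have hVo : IsOpen V := hdetd.continuousOn.isOpen_inter_preimage isOpen_ball isOpen_compl_singleton
  have hVball : V ⊆ ball 0 2 := inter_subset_left
  have hVcl : closedBall (0 : ℂ) 1 ⊆ V := fun l hl => ⟨hball hl, hAdet l hl⟩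
  have hVsph : sphere (0 : ℂ) 1 ⊆ V := sphere_subset_closedBall.trans hVcl
  -- Cayley transforms are positive loops
  have hcay : ∀ A' : ℂ → Mat2, EntriesIn (holoAlg (ball 0 2)) A' →
      EntriesIn (holoAlg V) fun l => cayley (A l).det (A' l) := by
    intro A' hA'
    have h1 : EntriesIn (holoAlg V) fun l => 1 + A' l :=
      (EntriesIn.const _ 1).add (hA'.mono (holoAlg_anti hVball))
    exact EntriesIn.smul (f := fun l => (1 + (A l).det)⁻¹)
      ((hdetd.mono hVball).inv fun l hl => hl.2) (h1.mul h1)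
  have hloop : ∀ A' : ℂ → Mat2, EntriesIn (holoAlg (ball 0 2)) A' →
      (∀ l ∈ sphere (0 : ℂ) 1, (A' l).trace = 0) →
      (∀ l ∈ sphere (0 : ℂ) 1, (A' l).det = (A l).det) →
      (∀ l ∈ sphere (0 : ℂ) 1, sigma3 * A' (-l) * sigma3 = A' l) →
      IsLoopSLPlus 1 fun l => cayley (A l).det (A' l) := by
    intro A' hA' htr hdet htw
    refine ⟨⟨fun i j => contDiff_comp_circleMap hVo hVsph (hcay A' hA' i j), ?_, ?_⟩, ?_⟩
    · intro l hl
      rw [← hdet l hl, det_cayley (htr l hl)]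
      rw [hdet l hl]
      exact hAdet l (sphere_subset_closedBall hl)
    · intro l hl
      have h1 : (A (-l)).det = (A l).det := by rw [← hAtw l, det_sigma3_conj]
      have h2 : sigma3 * (1 + A' (-l)) * sigma3 = 1 + A' l := by
        rw [mul_add, add_mul, mul_one, sigma3_mul_sigma3, htw l hl]
      simp only [cayley]
      rw [h1, mul_smul_comm, smul_mul_assoc, sigma3_conj_mul, h2]
    · intro i j
      refine DifferentiableOn.diffContOnCl (DifferentiableOn.mono (hcay A' hA' i j) ?_)
      rwa [closure_ball _ one_ne_zero]
  -- the conjugates `F⁻¹ A F`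
  have hconj : ∀ z, ∃ B : ℂ → Mat2, EntriesIn (holoAlg (ball 0 2)) B ∧
      ∀ l, l ≠ 0 → B l = (F z l).adjugate * A l * F z l := by
    intro z
    obtain ⟨B, hB, hYB⟩ := hYF z
    -- Off the origin `F⁻¹AF` is holomorphic because `F` is; the extension near the origin supplies
    -- the missing value.
    refine ⟨fun l => if l = 0 then (t : ℂ) • B l else (F z l).adjugate * A l * F z l,
      fun i j l hl => ?_, fun l hl => if_neg hl⟩
    have hFz : EntriesIn (holoAlg {l | l ≠ 0}) (F z) := (hF.loop z).entriesIn
    by_cases hl0 : l = 0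
    · subst hl0
      have h1 : DifferentiableAt ℂ (fun l => (t : ℂ) * B l i j) 0 :=
        (DifferentiableOn.differentiableAt (hB i j) (ball_mem_nhds 0 hρ)).const_mul _
      refine (h1.congr_of_eventuallyEq ?_).differentiableWithinAt
      filter_upwards [ball_mem_nhds (0 : ℂ) hρ] with x hx
      split_ifs with hx0
      · rfl
      · simp only [hAdef]
        rw [mul_assoc, smul_mul_assoc, hYB x hx0 (mem_ball_zero_iff.1 hx), mul_smul_comm,
          ← mul_assoc, hF.adjugate_mul z hx0, one_mul, Matrix.smul_apply, smul_eq_mul]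
    · have hsub : ball (0 : ℂ) 2 ∩ {l | l ≠ 0} ∈ nhds l :=
        (isOpen_ball.inter isOpen_Cstar).mem_nhds ⟨hl, hl0⟩
      have h1 : EntriesIn (holoAlg (ball (0 : ℂ) 2 ∩ {l | l ≠ 0})) fun l =>
          (F z l).adjugate * A l * F z l :=
        ((hFz.adjugate.mono (holoAlg_anti inter_subset_right)).mul
          (hA.mono (holoAlg_anti inter_subset_left))).mul
          (hFz.mono (holoAlg_anti inter_subset_right))
      refine ((DifferentiableOn.differentiableAt (h1 i j) hsub).congr_of_eventuallyEq
        ?_).differentiableWithinAt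
      filter_upwards [isOpen_Cstar.mem_nhds hl0] with x hx
      rw [if_neg hx]
  choose B hB hBF using hconj
  have hBtr : ∀ z, ∀ l ∈ sphere (0 : ℂ) 1, (B z l).trace = 0 := by
    intro z l hl
    rw [hBF z l (hsph0 l hl), Matrix.trace_mul_comm, ← mul_assoc, hF.mul_adjugate z (hsph0 l hl),
      one_mul, hAtr l (hsph hl)]
  have hBdet : ∀ z, ∀ l ∈ sphere (0 : ℂ) 1, (B z l).det = (A l).det := by
    intro z l hl
    rw [hBF z l (hsph0 l hl), Matrix.det_mul, Matrix.det_mul, mul_right_comm, ← Matrix.det_mul,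
      hF.adjugate_mul z (hsph0 l hl), Matrix.det_one, one_mul]
  have hBtw : ∀ z, ∀ l ∈ sphere (0 : ℂ) 1, sigma3 * B z (-l) * sigma3 = B z l := by
    intro z l hl
    have hl0 := hsph0 l hl
    rw [hBF z l hl0, hBF z (-l) (neg_ne_zero.2 hl0), sigma3_conj_mul, sigma3_conj_mul,
      adjugate_sigma3_conj, hAtw, (hF.loop z).twisted l hl0]
  -- The Cayley transform is compatible with conjugation, so the positive factor is the transform of
  -- `F⁻¹AF`, which has the same determinant.
  have hmem : (fun l => cayley (A l).det (A l)) ∈ Iso 1 F := by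
    have h1 := hloop A hA (fun l hl => hAtr l (hsph hl)) (fun _ _ => rfl) fun l _ => hAtw l
    refine ⟨h1.toIsLoopSL, hF, fun z l => cayley (A l).det (B z l), fun z =>
      hloop (B z) (hB z) (hBtr z) (hBdet z) (hBtw z), fun z l hl => ?_⟩
    have hl0 := hsph0 l hl
    have h2 : (1 + A l) * F z l = F z l * (1 + B z l) := by
      rw [add_mul, mul_add, one_mul, mul_one, hBF z l hl0, ← mul_assoc, ← mul_assoc,
        hF.mul_adjugate z hl0, one_mul]
    simp only [cayley]
    rw [smul_mul_assoc, mul_smul_comm, mul_assoc, h2, ← mul_assoc, h2, mul_assoc]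
  have hzero : ∀ l ∈ sphere (0 : ℂ) 1, Y l = 0 := by
    intro l hl
    have hdl := hAdet l (sphere_subset_closedBall hl)
    rcases (hIso _).1 hmem with h | h
    · have := eq_zero_of_cayley_eq_one (hAtr l (hsph hl)) hdl (h hl)
      exact (smul_eq_zero.1 this).resolve_left htc
    · exact absurd (h hl) (cayley_ne_neg_one (hAtr l (hsph hl)) hdl)
  refine EntriesIn.eqOn_closedBall one_pos (B := fun _ => 0) ?_ (EntriesIn.const _ 0) hzero l hl1
  intro i j
  refine DifferentiableOn.diffContOnCl (DifferentiableOn.mono (hY i j) ?_)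
  rwa [closure_ball _ one_ne_zero]

/-- Twisted loops `G` for which `F⁻¹ G F` extends to the disc are `±1`, if the isotropy group on the
unit circle is trivial and `F` has a monodromy with nonconstant trace. -/
theorem eq_one_or_neg_one_of_mem_positiveAlgebra {z₀ : X} (hF : IsNormalizedFrame z₀ F)
    (hIso : HasTrivialIso 1 F) {χ : ℂ → Mat2} (hχ : EntriesIn (holoAlg {l | l ≠ 0}) χ)
    (hdet : ∀ l, l ≠ 0 → (χ l).det = 1)
    (hrefl : ∀ l, l ≠ 0 → starRingEnd ℂ (χ (circRefl l)).trace = (χ l).trace)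
    (htr : ¬ ∃ c : ℂ, ∀ l : ℂ, l ≠ 0 → (χ l).trace = c) {r : ℝ} (hr : 0 < r) {τ : X ≃ X} {u : X → ℂ}
    (hu : ∀ z, ‖u z‖ = 1)
    (hτ : ∀ z l, l ≠ 0 → ‖l‖ < r → F (τ z) l = χ l * F z l * diagU1 (u z)) {G : ℂ → Mat2}
    (hG : G ∈ positiveAlgebra r F) (hGc : EntriesIn (contAlg (closedBall 0 r)) G)
    (hGdet : ∀ l ∈ closedBall (0 : ℂ) r, (G l).det = 1)
    (hGtw : ∀ l ∈ ball (0 : ℂ) r, sigma3 * G (-l) * sigma3 = G l) :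
    (∀ l ∈ closedBall (0 : ℂ) r, G l = 1) ∨ ∀ l ∈ closedBall (0 : ℂ) r, G l = -1 := by
  have hFext := hF.toIsExtendedFrame
  set G₀ : ℂ → Mat2 := fun l => G l - ((G l).trace / 2) • (1 : Mat2) with hG₀def
  have hG₀ : G₀ ∈ positiveAlgebra r F := positiveAlgebra.sub_half_trace hG
  have hG₀tr : ∀ l, (G₀ l).trace = 0 := fun l => by
    simp only [hG₀def]
    rw [Matrix.trace_sub, Matrix.trace_smul, Matrix.trace_one, Fintype.card_fin, smul_eq_mul]
    push_cast; ring
  have hzero : ∀ l ∈ ball (0 : ℂ) r, G₀ l = 0 := by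
    by_contra hne
    push Not at hne
    set Y₀ : ℂ → Mat2 := fun l => χ l - ((χ l).trace / 2) • (1 : Mat2) with hY₀def
    have hY₀ : EntriesIn (holoAlg {l | l ≠ 0}) Y₀ := hχ.sub
      (EntriesIn.smul (f := fun l => (χ l).trace / 2) (DifferentiableOn.div_const hχ.trace_mem 2)
        (EntriesIn.const _ 1))
    have hY₀tr : ∀ l, l ≠ 0 → (Y₀ l).trace = 0 := fun l _ => by
      simp only [hY₀def]
      rw [Matrix.trace_sub, Matrix.trace_smul, Matrix.trace_one, Fintype.card_fin, smul_eq_mul]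
      push_cast; ring
    -- The determinant is `1 - (tr χ)²/4`. If it vanished identically, `tr χ` would be constantly
    -- `2` or `-2`, as `ℂ*` is connected.
    have hY₀det : ∃ l, l ≠ 0 ∧ (Y₀ l).det ≠ 0 := by
      by_contra hall
      push Not at hall
      have hsq : ∀ l ∈ {l : ℂ | l ≠ 0}, (χ l).trace ^ 2 = (fun _ => (2 : ℂ)) l ^ 2 := by
        intro l hl
        have h1 := hall l hl
        have h2 := hdet l hl
        simp only [hY₀def, Matrix.det_fin_two, Matrix.trace_fin_two, Matrix.sub_apply,
          Matrix.smul_apply, smul_eq_mul, Matrix.one_apply_eq, ne_eq, zero_ne_one, one_ne_zero,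
          not_false_eq_true, Matrix.one_apply_ne, mul_one, mul_zero, sub_zero] at h1 h2 ⊢
        linear_combination (-4 : ℂ) * h1 + 4 * h2
      have hc : ContinuousOn (fun l => (χ l).trace) {l | l ≠ 0} :=
        (mem_holoAlg.1 hχ.trace_mem).continuousOn
      rcases isPreconnected_Cstar.eq_or_eq_neg_of_sq_eq hc continuousOn_const hsq
        (fun _ => two_ne_zero) with h | h
      · exact htr ⟨2, fun l hl => h hl⟩
      · exact htr ⟨-2, fun l hl => h hl⟩
    have hcommute : ∀ l, l ≠ 0 → ‖l‖ < r → Y₀ l * G₀ l = G₀ l * Y₀ l := by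
      intro l hl hlr
      have h1 := commute_of_conj_invariant hχ hdet hrefl htr hr (positiveAlgebra r F)
        (fun G hG => hG.1)
        (fun G hG => positiveAlgebra.conj_forward hF.normalized hdet hu hτ hG)
        (fun G hG => positiveAlgebra.conj_backward hF.normalized hu hτ hG) hG₀ l hl hlr
      simp only [hY₀def]
      rw [sub_mul, mul_sub (G₀ l), h1, smul_mul_assoc, mul_smul_comm, one_mul, mul_one]
    have hG₀tw : ∀ l ∈ ball (0 : ℂ) r, sigma3 * G₀ (-l) * sigma3 = G₀ l := by
      intro l hl
      simp only [hG₀def]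
      rw [mul_sub, sub_mul, mul_smul_comm, smul_mul_assoc, mul_one, sigma3_mul_sigma3, hGtw l hl,
        ← trace_sigma3_conj, hGtw l hl]
    obtain ⟨Y, w, ρ, hρ, hρr, hρ1, hY, hYtr, hYtw, hw, hYw, l₀, hl₀, hl₀0, hYl₀⟩ :=
      exists_twisted_extension_of_commute hY₀ hY₀tr hY₀det hr hG₀.1 (fun l _ => hG₀tr l) hG₀tw
        hcommute hne
    -- A scalar multiple of `G₀` stays positive against `F`, so trivial isotropy on `C_1` kills the
    -- continuation.
    refine hYl₀ (eq_zero_of_hasTrivialIso hFext hIso hY hYtr hYtw hρ (fun z => ?_) l₀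
      ((mem_ball_zero_iff.1 hl₀).le.trans hρ1.le))
    obtain ⟨B, hB, hGB⟩ := hG₀.2 z
    refine ⟨fun l => w l • B l, EntriesIn.smul (f := w) hw
      (hB.mono (holoAlg_anti (ball_subset_ball hρr.le))), fun l hl hlρ => ?_⟩
    rw [hYw l (mem_ball_zero_iff.2 hlρ), smul_mul_assoc, hGB l hl (hlρ.trans hρr), mul_smul_comm]
  -- `G` is scalar, hence `±1`
  have htrc : ContinuousOn (fun l => (G l).trace / 2) (closedBall 0 r) :=
    (mem_contAlg.1 hGc.trace_mem).div_const 2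
  have hscalar : ∀ l ∈ closedBall (0 : ℂ) r, G l = ((G l).trace / 2) • (1 : Mat2) := by
    intro l hl
    rw [← closure_ball (0 : ℂ) hr.ne'] at hl
    ext i j
    have hc : ContinuousOn (fun l => (((G l).trace / 2) • (1 : Mat2)) i j) (closedBall 0 r) :=
      htrc.mul continuousOn_const
    have heq : EqOn (fun l => G l i j) (fun l => (((G l).trace / 2) • (1 : Mat2)) i j)
        (ball 0 r) := fun l hl => by
      have := hzero l hl
      simp only [hG₀def] at this
      exact congrFun (congrFun (sub_eq_zero.1 this) i) j
    exact heq.of_subset_closure (mem_contAlg.1 (hGc i j)) hc ball_subset_closedBall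
      (closure_ball (0 : ℂ) hr.ne').ge ((closure_ball (0 : ℂ) hr.ne') ▸ hl)
  have hsq : ∀ l ∈ closedBall (0 : ℂ) r, ((G l).trace / 2) ^ 2 = (fun _ => (1 : ℂ)) l ^ 2 := by
    intro l hl
    have h1 := hGdet l hl
    rw [hscalar l hl, Matrix.det_smul, Matrix.det_one, Fintype.card_fin, mul_one] at h1
    rw [h1, one_pow]
  rcases (convex_closedBall (0 : ℂ) r).isPreconnected.eq_or_eq_neg_of_sq_eq htrc continuousOn_const
    hsq (fun _ => one_ne_zero) with h | h
  · refine Or.inl fun l hl => ?_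
    have h1 : (G l).trace / 2 = 1 := h hl
    rw [hscalar l hl, h1, one_smul]
  · refine Or.inr fun l hl => ?_
    have h1 : (G l).trace / 2 = -1 := h hl
    rw [hscalar l hl, h1, neg_smul, one_smul]

end Frame

/-! ### Continuation of conjugated monodromies -/

/-- In this form the unitarity condition is real linear, and it continues off `S¹` by reflection. -/
theorem conjTranspose_eq_adjugate_of_mem {A : Mat2} (hA : A ∈ Matrix.specialUnitaryGroup (Fin 2) ℂ) :
    A.conjTranspose = A.adjugate := by
  obtain ⟨h1, h2⟩ := Matrix.mem_specialUnitaryGroup_iff.1 hA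
  have h3 : A.conjTranspose * A = 1 := Matrix.mem_unitaryGroup_iff'.1 h1
  calc A.conjTranspose = A.conjTranspose * (A * A.adjugate) := by
        rw [mul_adjugate_of_det h2, mul_one]
    _ = A.adjugate := by rw [← mul_assoc, h3, one_mul]

theorem mem_specialUnitaryGroup_of_conjTranspose {A : Mat2} (h : A.conjTranspose = A.adjugate)
    (hdet : A.det = 1) : A ∈ Matrix.specialUnitaryGroup (Fin 2) ℂ := by
  refine Matrix.mem_specialUnitaryGroup_iff.2 ⟨Matrix.mem_unitaryGroup_iff'.2 ?_, hdet⟩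
  change A.conjTranspose * A = 1
  rw [h, adjugate_mul_of_det hdet]

theorem adjugate_adjugate_two (A : Mat2) : A.adjugate.adjugate = A := by
  rw [adjugate_eq_trace_sub A.adjugate, adjugate_eq_trace_sub A, Matrix.trace_sub,
    Matrix.trace_smul, Matrix.trace_one, Fintype.card_fin]
  simp only [smul_eq_mul]
  push_cast
  module

theorem EntriesIn.ite_norm_le {V : Set ℂ} (hV : IsOpen V) (h0 : (0 : ℂ) ∉ V) {A B : ℂ → Mat2} {ρ : ℝ}
    (hAc : EntriesIn (contAlg (V ∩ {l | ‖l‖ ≤ ρ})) A) (hAd : EntriesIn (holoAlg (V ∩ {l | ‖l‖ < ρ})) A)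
    (hBc : EntriesIn (contAlg (V ∩ {l | ρ ≤ ‖l‖})) B) (hBd : EntriesIn (holoAlg (V ∩ {l | ρ < ‖l‖})) B)
    (hAB : ∀ l ∈ V, ‖l‖ = ρ → A l = B l) :
    EntriesIn (holoAlg V) fun l => if ‖l‖ ≤ ρ then A l else B l := by
  intro i j
  have h : (fun l => (if ‖l‖ ≤ ρ then A l else B l) i j) =
      fun l => if ‖l‖ ≤ ρ then A l i j else B l i j := by
    ext l; split_ifs <;> rfl
  rw [h]
  exact differentiableOn_of_off_sphere hV h0 (continuousOn_ite_norm_le (hAc i j) (hBc i j)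
    fun l hl hlρ => by rw [hAB l hl hlρ]) (differentiableOn_ite_norm_le hV (hAd i j) (hBd i j))

theorem EntriesIn.ite_norm_le_cont {V : Set ℂ} {A B : ℂ → Mat2} {ρ : ℝ}
    (hAc : EntriesIn (contAlg (V ∩ {l | ‖l‖ ≤ ρ})) A)
    (hBc : EntriesIn (contAlg (V ∩ {l | ρ ≤ ‖l‖})) B)
    (hAB : ∀ l ∈ V, ‖l‖ = ρ → A l = B l) :
    EntriesIn (contAlg V) fun l => if ‖l‖ ≤ ρ then A l else B l := by
  intro i j
  have h : (fun l => (if ‖l‖ ≤ ρ then A l else B l) i j) =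
      fun l => if ‖l‖ ≤ ρ then A l i j else B l i j := by
    ext l; split_ifs <;> rfl
  rw [h]
  exact continuousOn_ite_norm_le (hAc i j) (hBc i j) fun l hl hlρ => by rw [hAB l hl hlρ]

/-- If a positive loop conjugates `χ` to a unitary loop on `C_r`, then the latter extends to `ℂ*`. -/
theorem exists_conjugate_loop {r : ℝ} (hr : 0 < r) (hr1 : r ≤ 1) {χ ψ h : ℂ → Mat2}
    (hχ : IsLoopSUCstar χ) (hh : IsLoopSLPlus r h) (hψ : IsLoopSU r ψ)
    (hconj : ∀ l ∈ sphere (0 : ℂ) r, h l * χ l = ψ l * h l) :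
    ∃ Ψ : ℂ → Mat2, IsLoopSUCstar Ψ ∧ (∀ l, l ≠ 0 → (Ψ l).trace = (χ l).trace) ∧
      ∀ l, l ≠ 0 → ‖l‖ ≤ r → h l * χ l = Ψ l * h l := by
  have hdet : ∀ l : ℂ, ‖l‖ ≤ r → (h l).det = 1 := fun l hl => hh.det_eq_one_closedBall hr hl
  have h1r : 1 ≤ 1 / r := by rwa [le_div_iff₀ hr, one_mul]
  set K : ℂ → Mat2 := fun l => h l * χ l * (h l).adjugate with hK
  -- `hχh⁻¹` and `ψ` agree on `C_r` and glue to a function on the punctured unit disc. It is unitary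
  -- on `S¹`, so Schwarz reflection `A ↦ (A(1/λ̄)*)⁻¹` continues it to `|λ| > 1`.
  set f : ℂ → Mat2 := fun l => if ‖l‖ ≤ r then K l else ψ l with hf
  set g : ℂ → Mat2 := fun l => (f (circRefl l)).conjTranspose.adjugate with hg
  have hhc : EntriesIn (contAlg (closedBall 0 r)) h := hh.entriesIn.mono (diffContAlg_le_contAlg r)
  have hhd : EntriesIn (holoAlg (ball 0 r)) h := hh.entriesIn.mono (diffContAlg_le_holoAlg r)
  have hKc : EntriesIn (contAlg {l | l ≠ 0 ∧ ‖l‖ ≤ r}) K := by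
    have h1 := hhc.mono (contAlg_anti (V := {l | l ≠ 0 ∧ ‖l‖ ≤ r})
      fun l hl => mem_closedBall_zero_iff.2 hl.2)
    exact (h1.mul ((hχ.entriesIn.mono (holoAlg_le_contAlg _)).mono
      (contAlg_anti fun l hl => hl.1))).mul h1.adjugate
  have hKd : EntriesIn (holoAlg {l | l ≠ 0 ∧ ‖l‖ < r}) K := by
    have h1 := hhd.mono (holoAlg_anti (V := {l | l ≠ 0 ∧ ‖l‖ < r})
      fun l hl => mem_ball_zero_iff.2 hl.2)
    exact (h1.mul (hχ.entriesIn.mono (holoAlg_anti fun l hl => hl.1))).mul h1.adjugate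
  have hKψ : ∀ l : ℂ, ‖l‖ = r → K l = ψ l := fun l hl => by
    simp only [hK]
    rw [hconj l (mem_sphere_zero_iff_norm.2 hl), mul_assoc, mul_adjugate_of_det (hdet l hl.le),
      mul_one]
  have hψc : EntriesIn (contAlg {l | r ≤ ‖l‖ ∧ ‖l‖ ≤ 1}) ψ :=
    EntriesIn.mono (S := contAlg {l | r ≤ ‖l‖ ∧ ‖l‖ ≤ 1 / r}) hψ.continuousOn
      (contAlg_anti fun l hl => ⟨hl.1, hl.2.trans h1r⟩)
  have hψd : EntriesIn (holoAlg {l | r < ‖l‖ ∧ ‖l‖ < 1}) ψ :=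
    EntriesIn.mono (S := holoAlg {l | r < ‖l‖ ∧ ‖l‖ < 1 / r}) hψ.analytic
      (holoAlg_anti fun l hl => ⟨hl.1, hl.2.trans_le h1r⟩)
  have hfc : EntriesIn (contAlg {l | l ≠ 0 ∧ ‖l‖ ≤ 1}) f :=
    EntriesIn.ite_norm_le_cont (hKc.mono (contAlg_anti fun l hl => ⟨hl.1.1, hl.2⟩))
      (hψc.mono (contAlg_anti fun l hl => ⟨hl.2, hl.1.2⟩)) fun l _ hl => hKψ l hl
  have hopen : IsOpen {l : ℂ | l ≠ 0 ∧ ‖l‖ < 1} :=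
    isOpen_Cstar.inter (isOpen_lt continuous_norm continuous_const)
  have hfd : EntriesIn (holoAlg {l | l ≠ 0 ∧ ‖l‖ < 1}) f :=
    EntriesIn.ite_norm_le hopen (fun h => h.1 rfl)
      (hKc.mono (contAlg_anti fun l hl => ⟨hl.1.1, hl.2⟩))
      (hKd.mono (holoAlg_anti fun l hl => ⟨hl.1.1, hl.2⟩))
      (hψc.mono (contAlg_anti fun l hl => ⟨hl.2, hl.1.2.le⟩))
      (hψd.mono (holoAlg_anti fun l hl => ⟨hl.2, hl.1.2⟩)) fun l _ hl => hKψ l hl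
  have hfu : ∀ l : ℂ, ‖l‖ = 1 → f l ∈ Matrix.specialUnitaryGroup (Fin 2) ℂ := by
    intro l hl
    have h1 := hψ.unitary l (mem_sphere_zero_iff_norm.2 hl)
    simp only [hf]
    split_ifs with hlr
    · rwa [hKψ l (le_antisymm hlr (hl ▸ hr1))]
    · exact h1
  have hne : ∀ l : ℂ, 1 ≤ ‖l‖ → l ≠ 0 := fun l hl => norm_pos_iff.1 (one_pos.trans_le hl)
  have hgc : EntriesIn (contAlg {l | 1 ≤ ‖l‖}) g := by
    refine EntriesIn.adjugate fun i j => ?_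
    refine continuous_conj.comp_continuousOn (ContinuousOn.comp (g := fun l => f l j i) (hfc j i)
      (continuousOn_circRefl.mono hne) fun l hl => ⟨circRefl_ne_zero (hne l hl), ?_⟩)
    rw [norm_circRefl]
    exact inv_le_one_of_one_le₀ hl
  have hgd : EntriesIn (holoAlg {l | 1 < ‖l‖}) g := by
    refine EntriesIn.adjugate fun i j l hl => ?_
    have hl0 := hne l (le_of_lt hl)
    refine (differentiableAt_conj_comp_circRefl (f := fun l => f l j i) hl0
      (DifferentiableOn.differentiableAt (hfd j i)
        (hopen.mem_nhds ⟨circRefl_ne_zero hl0, ?_⟩))).differentiableWithinAt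
    rw [norm_circRefl]
    exact inv_lt_one_of_one_lt₀ hl
  have hfg : ∀ l : ℂ, ‖l‖ = 1 → f l = g l := fun l hl => by
    simp only [hg]
    rw [circRefl_eq_self hl, conjTranspose_eq_adjugate_of_mem (hfu l hl), adjugate_adjugate_two]
  set Ψ : ℂ → Mat2 := fun l => if ‖l‖ ≤ 1 then f l else g l with hΨdef
  have hΨ : EntriesIn (holoAlg {l | l ≠ 0}) Ψ :=
    EntriesIn.ite_norm_le isOpen_Cstar (fun h => h rfl) hfc hfd
      (hgc.mono (contAlg_anti fun l hl => hl.2)) (hgd.mono (holoAlg_anti fun l hl => hl.2))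
      fun l _ hl => hfg l hl
  have hΨK : ∀ l : ℂ, ‖l‖ ≤ r → Ψ l = K l := fun l hl => by
    simp only [hΨdef, hf]
    rw [if_pos (hl.trans hr1), if_pos hl]
  have scalar : ∀ f : ℂ → ℂ, DifferentiableOn ℂ f {l | l ≠ 0} →
      (∀ l, l ≠ 0 → ‖l‖ < r → f l = 0) → ∀ l, l ≠ 0 → f l = 0 := fun f hf h l hl =>
    eq_zero_of_eqOn_puncturedBall hf hr h l hl
  refine ⟨Ψ, ⟨hΨ, ?_, ?_, ?_⟩, ?_, ?_⟩
  · intro l hl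
    refine sub_eq_zero.1 (scalar (fun l => (Ψ l).det - 1) (DifferentiableOn.sub_const hΨ.det_mem 1)
      (fun l hl hlr => ?_) l hl)
    simp only [hΨK l hlr.le, hK]
    rw [Matrix.det_mul, Matrix.det_mul, mul_right_comm, ← Matrix.det_mul,
      mul_adjugate_of_det (hdet l hlr.le), hχ.det_eq_one l hl, Matrix.det_one, one_mul, sub_self]
  · refine EntriesIn.eq_of_eqOn_puncturedBall hr (((EntriesIn.const _ _).mul
      (EntriesIn.comp_neg (V := {l : ℂ | l ≠ 0}) (fun l (hl : l ≠ 0) => neg_ne_zero.2 hl) hΨ)).mul (EntriesIn.const _ _)) hΨ fun l hl hlr => ?_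
    rw [hΨK l hlr.le, hΨK (-l) (by simpa using hlr.le)]
    simp only [hK]
    rw [sigma3_conj_mul, sigma3_conj_mul, adjugate_sigma3_conj, hh.twisted_closedBall hr hlr.le,
      hχ.twisted l hl]
  · intro l hl
    have hl1 := mem_sphere_zero_iff_norm.1 hl
    simp only [hΨdef]
    rw [if_pos hl1.le]
    exact hfu l hl1
  · intro l hl
    refine sub_eq_zero.1 (scalar (fun l => (Ψ l).trace - (χ l).trace)
      (DifferentiableOn.sub hΨ.trace_mem hχ.entriesIn.trace_mem) (fun l hl hlr => ?_) l hl)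
    simp only [hΨK l hlr.le, hK]
    rw [Matrix.trace_mul_comm, ← mul_assoc, adjugate_mul_of_det (hdet l hlr.le), one_mul, sub_self]
  · intro l hl hlr
    rw [hΨK l hlr]
    simp only [hK]
    rw [mul_assoc, adjugate_mul_of_det (hdet l hlr), mul_one]

/-! ### Quaternionic loops -/

/-- Holomorphic matrix functions on `ℂ*` that take values in the quaternions `ℝ · SU(2)` on the unit
circle. -/
structure IsQuatLoop (Y : ℂ → Mat2) : Prop where
  holo : EntriesIn (holoAlg {l | l ≠ 0}) Y
  quat : ∀ l, l ≠ 0 → (Y (circRefl l)).conjTranspose = (Y l).adjugate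

/-- Holomorphic functions on `ℂ*` that are real on the unit circle. -/
structure IsRealLoop (n : ℂ → ℂ) : Prop where
  holo : DifferentiableOn ℂ n {l | l ≠ 0}
  real : ∀ l, l ≠ 0 → starRingEnd ℂ (n (circRefl l)) = n l

/-- `Y` is twisted up to the sign `s`. -/
def IsTwisted (s : ℂ) (Y : ℂ → Mat2) : Prop :=
  ∀ l, l ≠ 0 → sigma3 * Y (-l) * sigma3 = s • Y l

/-- Linearity of the adjugate in size two makes quaternionic loops closed under sums. -/
theorem adjugate_add_two (A B : Mat2) : (A + B).adjugate = A.adjugate + B.adjugate := by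
  rw [adjugate_eq_trace_sub, adjugate_eq_trace_sub, adjugate_eq_trace_sub, Matrix.trace_add,
    add_smul]
  abel

theorem adjugate_smul_two (c : ℂ) (A : Mat2) : (c • A).adjugate = c • A.adjugate := by
  rw [adjugate_eq_trace_sub, adjugate_eq_trace_sub, Matrix.trace_smul, smul_sub, smul_smul,
    smul_eq_mul]

namespace IsQuatLoop

variable {Y Z : ℂ → Mat2} {n : ℂ → ℂ}

theorem add (hY : IsQuatLoop Y) (hZ : IsQuatLoop Z) : IsQuatLoop fun l => Y l + Z l :=
  ⟨hY.holo.add hZ.holo, fun l hl => by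
    rw [Matrix.conjTranspose_add, hY.quat l hl, hZ.quat l hl, adjugate_add_two]⟩

theorem mul (hY : IsQuatLoop Y) (hZ : IsQuatLoop Z) : IsQuatLoop fun l => Y l * Z l :=
  ⟨hY.holo.mul hZ.holo, fun l hl => by
    rw [Matrix.conjTranspose_mul, hY.quat l hl, hZ.quat l hl, Matrix.adjugate_mul_distrib]⟩

theorem smul (hn : IsRealLoop n) (hY : IsQuatLoop Y) : IsQuatLoop fun l => n l • Y l :=
  ⟨EntriesIn.smul hn.holo hY.holo, fun l hl => by
    rw [Matrix.conjTranspose_smul, hY.quat l hl, adjugate_smul_two]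
    congr 1
    exact hn.real l hl⟩

theorem one : IsQuatLoop fun _ => 1 :=
  ⟨EntriesIn.const _ 1, fun l _ => by rw [Matrix.conjTranspose_one, Matrix.adjugate_one]⟩

theorem of_isLoopSUCstar {χ : ℂ → Mat2} (hχ : IsLoopSUCstar χ) : IsQuatLoop χ := by
  refine ⟨hχ.entriesIn, fun l hl => ?_⟩
  ext i j
  rw [← sub_eq_zero]
  refine eq_zero_of_eqOn_sphere_Cstar
    (f := fun l => (χ (circRefl l)).conjTranspose i j - (χ l).adjugate i j)
    (DifferentiableOn.sub (hχ.entriesIn.conjTranspose_circRefl i j) (hχ.entriesIn.adjugate i j))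
    one_pos (fun l hl => ?_) l hl
  rw [circRefl_eq_self (mem_sphere_zero_iff_norm.1 hl),
    conjTranspose_eq_adjugate_of_mem (hχ.unitary l hl), sub_self]

theorem isRealLoop_det (hY : IsQuatLoop Y) : IsRealLoop fun l => (Y l).det :=
  ⟨hY.holo.det_mem, fun l hl => by
    have h := congrArg Matrix.det (hY.quat l hl)
    rw [Matrix.det_conjTranspose, Matrix.det_adjugate] at h
    simpa using h⟩

theorem isRealLoop_trace (hY : IsQuatLoop Y) : IsRealLoop fun l => (Y l).trace :=
  ⟨hY.holo.trace_mem, fun l hl => by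
    have h := congrArg Matrix.trace (hY.quat l hl)
    rw [Matrix.trace_conjTranspose, adjugate_eq_trace_sub, Matrix.trace_sub, Matrix.trace_smul,
      Matrix.trace_one, Fintype.card_fin] at h
    simp only [smul_eq_mul] at h
    push_cast at h
    change star _ = _
    rw [h]; ring⟩

/-- On `S¹` the second row is determined by the first, and the determinant is the quaternion norm.
Hence on `S¹` the zeros of the loop are those of its determinant. -/
theorem det_eq (hY : IsQuatLoop Y) {l : ℂ} (hl : ‖l‖ = 1) :
    (Y l).det = ((‖Y l 0 0‖ ^ 2 + ‖Y l 0 1‖ ^ 2 : ℝ) : ℂ) := by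
  have hl0 : l ≠ 0 := norm_pos_iff.1 (hl ▸ one_pos)
  have h := hY.quat l hl0
  rw [circRefl_eq_self hl] at h
  have h1 := congrFun (congrFun h 0) 0
  have h2 := congrFun (congrFun h 1) 0
  simp only [Matrix.conjTranspose_apply, Matrix.adjugate_fin_two] at h1 h2
  simp at h1 h2
  rw [Matrix.det_fin_two, ← h1, show Y l 1 0 = -(starRingEnd ℂ) (Y l 0 1) by rw [h2, neg_neg]]
  push_cast
  rw [← mul_conj', ← mul_conj']
  ring

theorem eq_zero_iff_det (hY : IsQuatLoop Y) {l : ℂ} (hl : ‖l‖ = 1) :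
    Y l = 0 ↔ (Y l).det = 0 := by
  refine ⟨fun h => by rw [h]; simp, fun hdet => ?_⟩
  have hl0 : l ≠ 0 := norm_pos_iff.1 (hl ▸ one_pos)
  have h := hY.quat l hl0
  rw [circRefl_eq_self hl] at h
  have h1 := congrFun (congrFun h 0) 0
  have h2 := congrFun (congrFun h 1) 0
  simp only [Matrix.conjTranspose_apply, Matrix.adjugate_fin_two] at h1 h2
  simp at h1 h2
  rw [hY.det_eq hl, ofReal_eq_zero] at hdet
  have h00 : Y l 0 0 = 0 := norm_eq_zero.1 (by nlinarith [sq_nonneg ‖Y l 0 0‖, sq_nonneg ‖Y l 0 1‖])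
  have h01 : Y l 0 1 = 0 := norm_eq_zero.1 (by nlinarith [sq_nonneg ‖Y l 0 0‖, sq_nonneg ‖Y l 0 1‖])
  rw [h00] at h1
  rw [h01] at h2
  ext i j
  fin_cases i <;> fin_cases j
  · exact h00
  · exact h01
  · simpa using h2.symm
  · simpa using h1.symm

theorem det_pos (hY : IsQuatLoop Y) {l : ℂ} (hl : ‖l‖ = 1) (h : Y l ≠ 0) : 0 < (Y l).det.re := by
  have h1 : (Y l).det ≠ 0 := fun h' => h ((hY.eq_zero_iff_det hl).2 h')
  rw [hY.det_eq hl] at h1 ⊢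
  rw [ofReal_re]
  exact lt_of_le_of_ne (by positivity) fun h' => h1 (by rw [← h', ofReal_zero])

end IsQuatLoop

theorem eq_zero_of_mul_eq_zero {n f : ℂ → ℂ} (hn : DifferentiableOn ℂ n {l | l ≠ 0})
    (hn0 : ∃ l, l ≠ 0 ∧ n l ≠ 0) (hf : DifferentiableOn ℂ f {l | l ≠ 0})
    (h : ∀ l, l ≠ 0 → n l * f l = 0) (l : ℂ) (hl : l ≠ 0) : f l = 0 := by
  obtain ⟨z, hz, hnz⟩ := hn0
  refine eq_zero_of_eventually_eq_zero hf hz ?_ l hl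
  filter_upwards [isOpen_Cstar.mem_nhds hz, (hn.continuousOn.continuousAt
    (isOpen_Cstar.mem_nhds hz)).eventually_ne hnz] with w hw hnw
  exact (mul_eq_zero.1 (h w hw)).resolve_left hnw

/-- The factor `n` can be cancelled near a point where it is nonzero; the identity theorem does the
rest. -/
theorem EntriesIn.eq_of_smul_eq {n : ℂ → ℂ} {A B : ℂ → Mat2} (hn : DifferentiableOn ℂ n {l | l ≠ 0})
    (hn0 : ∃ l, l ≠ 0 ∧ n l ≠ 0) (hA : EntriesIn (holoAlg {l | l ≠ 0}) A)
    (hB : EntriesIn (holoAlg {l | l ≠ 0}) B) (h : ∀ l, l ≠ 0 → n l • A l = n l • B l) (l : ℂ)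
    (hl : l ≠ 0) : A l = B l := by
  ext i j
  rw [← sub_eq_zero]
  refine eq_zero_of_mul_eq_zero (f := fun l => A l i j - B l i j) hn hn0
    ((hA i j).sub (hB i j)) (fun l hl => ?_) l hl
  have := congrFun (congrFun (h l hl) i) j
  simp only [Matrix.smul_apply, smul_eq_mul] at this
  rw [mul_sub, this, sub_self]

/-- The function `2 sin(arg λ₀ - arg λ)` on the unit circle, with simple zeros at `±λ₀`. -/
noncomputable def sinLoop (z l : ℂ) : ℂ := I * (l / z - z / l)

theorem isRealLoop_sinLoop {z : ℂ} (hz : ‖z‖ = 1) : IsRealLoop (sinLoop z) := by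
  have hz0 : z ≠ 0 := norm_pos_iff.1 (hz ▸ one_pos)
  refine ⟨?_, fun l hl => ?_⟩
  · exact DifferentiableOn.const_mul (DifferentiableOn.sub (by fun_prop)
      (DifferentiableOn.div (by fun_prop) (by fun_prop) fun l hl => hl)) I
  · have hzc : starRingEnd ℂ z = z⁻¹ := (inv_eq_conj hz).symm
    simp only [sinLoop, circRefl, map_mul, map_sub, map_div₀, map_inv₀, conj_conj, conj_I, hzc]
    field_simp
    ring

theorem sinLoop_neg (z l : ℂ) : sinLoop z (-l) = -sinLoop z l := by
  simp only [sinLoop, neg_div, div_neg]; ring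

theorem sinLoop_ne_zero {z l : ℂ} (hz : z ≠ 0) (hl : l ≠ 0) (h1 : l ≠ z) (h2 : l ≠ -z) :
    sinLoop z l ≠ 0 := by
  have : sinLoop z l = I * ((l - z) * (l + z)) / (l * z) := by
    simp only [sinLoop]; field_simp; ring
  rw [this]
  exact div_ne_zero (mul_ne_zero I_ne_zero (mul_ne_zero (sub_ne_zero.2 h1)
    (fun h => h2 (eq_neg_of_add_eq_zero_left h)))) (mul_ne_zero hl hz)

theorem exists_factor_sinLoop {z : ℂ} (hz : z ≠ 0) {f : ℂ → ℂ}
    (hf : DifferentiableOn ℂ f {l | l ≠ 0}) (h1 : f z = 0) (h2 : f (-z) = 0) :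
    ∃ g, DifferentiableOn ℂ g {l | l ≠ 0} ∧ ∀ l, l ≠ 0 → f l = sinLoop z l * g l := by
  have d1 := (Complex.differentiableOn_dslope (isOpen_Cstar.mem_nhds hz)).2 hf
  have e1 : ∀ l, f l = (l - z) * dslope f z l := fun l => by
    have := sub_smul_dslope f z l
    rw [h1, sub_zero, smul_eq_mul] at this
    exact this.symm
  have h3 : dslope f z (-z) = 0 := by
    have := e1 (-z)
    rw [h2, eq_comm, mul_eq_zero] at this
    refine this.resolve_left fun h => hz ?_
    have : (-2 : ℂ) * z = 0 := by linear_combination h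
    simpa using this
  have d2 := (Complex.differentiableOn_dslope (isOpen_Cstar.mem_nhds (neg_ne_zero.2 hz))).2 d1
  have e2 : ∀ l, dslope f z l = (l + z) * dslope (dslope f z) (-z) l := fun l => by
    have := sub_smul_dslope (dslope f z) (-z) l
    rw [h3, sub_zero, smul_eq_mul, sub_neg_eq_add] at this
    exact this.symm
  refine ⟨fun l => -I * l * z * dslope (dslope f z) (-z) l, ?_, fun l hl => ?_⟩
  · exact DifferentiableOn.mul (by fun_prop) d2
  · rw [e1 l, e2 l]
    simp only [sinLoop]
    field_simp
    linear_combination ((l - z) * (l + z) * dslope (dslope f z) (-z) l) * I_mul_I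

theorem IsQuatLoop.of_smul {n : ℂ → ℂ} {Y Y' : ℂ → Mat2} (hn : IsRealLoop n)
    (hn0 : ∃ l, l ≠ 0 ∧ n l ≠ 0) (hY : IsQuatLoop Y) (hY' : EntriesIn (holoAlg {l | l ≠ 0}) Y')
    (h : ∀ l, l ≠ 0 → Y l = n l • Y' l) : IsQuatLoop Y' := by
  refine ⟨hY', EntriesIn.eq_of_smul_eq hn.holo hn0 hY'.conjTranspose_circRefl hY'.adjugate
    fun l hl => ?_⟩
  rw [← adjugate_smul_two, ← h l hl, ← hY.quat l hl, h _ (circRefl_ne_zero hl),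
    Matrix.conjTranspose_smul]
  congr 1
  exact (hn.real l hl).symm

theorem IsTwisted.det_neg {s : ℂ} {Y : ℂ → Mat2} (hY : IsTwisted s Y) (hs : s ^ 2 = 1) {l : ℂ}
    (hl : l ≠ 0) : (Y (-l)).det = (Y l).det := by
  rw [← det_sigma3_conj, hY l hl, Matrix.det_smul, Fintype.card_fin, hs, one_mul]

/-- The zeros of a quaternionic loop on the unit circle can be divided out by a real function. -/
theorem exists_ne_zero_on_circle {Y : ℂ → Mat2} (hY : IsQuatLoop Y) {s : ℂ} (hs : s ^ 2 = 1)
    (hYs : IsTwisted s Y) (hY0 : ∃ l, l ≠ 0 ∧ Y l ≠ 0) :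
    ∃ (n : ℂ → ℂ) (Y' : ℂ → Mat2) (s' : ℂ), DifferentiableOn ℂ n {l | l ≠ 0} ∧
      (∀ l, l ≠ 0 → Y l = n l • Y' l) ∧ IsQuatLoop Y' ∧ s' ^ 2 = 1 ∧ IsTwisted s' Y' ∧
      ∀ l : ℂ, ‖l‖ = 1 → Y' l ≠ 0 := by
  have hne : ∀ l : ℂ, ‖l‖ = 1 → l ≠ 0 := fun l hl => norm_pos_iff.1 (hl ▸ one_pos)
  have det_ne : ∀ Y : ℂ → Mat2, IsQuatLoop Y → (∃ l, l ≠ 0 ∧ Y l ≠ 0) →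
      ∃ l, l ≠ 0 ∧ (Y l).det ≠ 0 := by
    intro Y hY ⟨l, hl, hYl⟩
    by_contra hall
    push Not at hall
    refine hYl ?_
    ext i j
    refine eq_zero_of_eqOn_sphere_Cstar (hY.holo i j) one_pos (fun l hl => ?_) l hl
    have hl1 := mem_sphere_zero_iff_norm.1 hl
    rw [(hY.eq_zero_iff_det hl1).2 (hall l (hne l hl1)), Matrix.zero_apply]
  have hfin := finite_zeros_annulus (mem_holoAlg.1 hY.holo.det_mem) (det_ne Y hY hY0) one_pos 1
  set Z := hfin.toFinset
  have hZ : ∀ l : ℂ, ‖l‖ = 1 → (Y l).det = 0 → l ∈ Z := fun l hl h =>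
    hfin.mem_toFinset.2 ⟨⟨hl.ge, hl.le⟩, h⟩
  have hZ0 : ∀ z ∈ Z, z ≠ 0 := fun z hz =>
    norm_pos_iff.1 (one_pos.trans_le (hfin.mem_toFinset.1 hz).1.1)
  -- Only the inclusion of the zeros in `Z` is kept: the same `Z` serves for the quotients in the
  -- induction.
  clear_value Z
  clear hfin
  -- Induction on the total vanishing order of `det Y` on `Z`: dividing `Y` by `sinLoop z` lowers
  -- it.
  obtain ⟨N, hN⟩ : ∃ N, ∑ z ∈ Z, analyticOrderNatAt (fun l => (Y l).det) z = N := ⟨_, rfl⟩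
  induction N using Nat.strong_induction_on generalizing Y s with
  | _ N ih =>
    by_cases hall : ∀ l : ℂ, ‖l‖ = 1 → Y l ≠ 0
    · exact ⟨fun _ => 1, Y, s, differentiableOn_const _, fun l _ => (one_smul _ _).symm, hY, hs, hYs,
        hall⟩
    push Not at hall
    obtain ⟨z, hz, hYz⟩ := hall
    have hz0 := hne z hz
    have hs0 : s ≠ 0 := fun h => by rw [h] at hs; norm_num at hs
    -- The determinant is even by the twist, so zeros come in pairs `±z`, as those of `sinLoop z`
    -- do.
    have hYz' : Y (-z) = 0 := by
      have h1 : ‖-z‖ = 1 := by rwa [norm_neg]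
      rw [hY.eq_zero_iff_det h1, hYs.det_neg hs hz0, ← hY.eq_zero_iff_det hz]
      exact hYz
    have hfac : ∀ i j, ∃ g, DifferentiableOn ℂ g {l | l ≠ 0} ∧
        ∀ l, l ≠ 0 → Y l i j = sinLoop z l * g l := fun i j =>
      exists_factor_sinLoop hz0 (hY.holo i j) (by rw [hYz, Matrix.zero_apply])
        (by rw [hYz', Matrix.zero_apply])
    choose g hg hYg using hfac
    set Y' : ℂ → Mat2 := fun l => Matrix.of fun i j => g i j l with hY'def
    have hY'h : EntriesIn (holoAlg {l | l ≠ 0}) Y' := hg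
    have hYY' : ∀ l, l ≠ 0 → Y l = sinLoop z l • Y' l := fun l hl => by
      ext i j; exact hYg i j l hl
    have hreal := isRealLoop_sinLoop hz
    have hn0 : ∃ l, l ≠ 0 ∧ sinLoop z l ≠ 0 := by
      refine ⟨2, two_ne_zero, sinLoop_ne_zero hz0 two_ne_zero ?_ ?_⟩ <;> rintro h
      · rw [← h] at hz; norm_num at hz
      · have : ‖(2 : ℂ)‖ = 1 := by rw [h, norm_neg, hz]
        norm_num at this
    have hY' : IsQuatLoop Y' := IsQuatLoop.of_smul hreal hn0 hY hY'h hYY'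
    -- The divisor `sinLoop z` is odd, so each division reverses the sign of the twist.
    have hs' : (-s) ^ 2 = 1 := by rw [neg_sq, hs]
    have hY's : IsTwisted (-s) Y' := by
      refine EntriesIn.eq_of_smul_eq hreal.holo hn0 (((EntriesIn.const _ _).mul
        (EntriesIn.comp_neg (V := {l : ℂ | l ≠ 0}) (fun l (hl : l ≠ 0) => neg_ne_zero.2 hl) hY'h)).mul (EntriesIn.const _ _))
        (EntriesIn.smul (f := fun _ => -s) (differentiableOn_const _) hY'h) fun l hl => ?_
      have h1 := hYs l hl
      rw [hYY' l hl, hYY' (-l) (neg_ne_zero.2 hl), sinLoop_neg, mul_smul_comm, smul_mul_assoc,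
        smul_comm s] at h1
      rw [neg_smul, smul_neg, ← h1, neg_smul, neg_neg]
    have hY'0 : ∃ l, l ≠ 0 ∧ Y' l ≠ 0 := by
      obtain ⟨l, hl, h⟩ := hY0
      exact ⟨l, hl, fun h' => h (by rw [hYY' l hl, h', smul_zero])⟩
    have hdet : ∀ l, l ≠ 0 → (Y l).det = sinLoop z l ^ 2 * (Y' l).det := fun l hl => by
      rw [hYY' l hl, Matrix.det_smul, Fintype.card_fin]
    have han : ∀ x, x ≠ 0 → AnalyticAt ℂ (fun l => (Y' l).det) x := fun x hx =>
      DifferentiableOn.analyticAt hY'.holo.det_mem (isOpen_Cstar.mem_nhds hx)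
    have hsin : ∀ x, x ≠ 0 → AnalyticAt ℂ (fun l => sinLoop z l ^ 2) x := fun x hx =>
      DifferentiableOn.analyticAt (hreal.holo.pow 2) (isOpen_Cstar.mem_nhds hx)
    have hord : ∀ x, x ≠ 0 → analyticOrderNatAt (fun l => (Y l).det) x =
        analyticOrderNatAt (fun l => sinLoop z l ^ 2) x +
          analyticOrderNatAt (fun l => (Y' l).det) x := by
      intro x hx
      rw [← analyticOrderNatAt_mul (hsin x hx) (han x hx)]
      · simp only [analyticOrderNatAt]
        congr 1
        refine analyticOrderAt_congr ?_
        filter_upwards [isOpen_Cstar.mem_nhds hx] with l hl using hdet l hl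
      · rw [Ne, analyticOrderAt_eq_top]
        intro h
        obtain ⟨l, hl, hnl⟩ := hn0
        refine hnl ?_
        have := eq_zero_of_eventually_eq_zero (f := fun l => sinLoop z l ^ 2) (hreal.holo.pow 2) hx h
          l hl
        simpa using this
      · rw [Ne, analyticOrderAt_eq_top]
        intro h
        obtain ⟨l, hl, hnl⟩ := det_ne Y' hY' hY'0
        exact hnl (eq_zero_of_eventually_eq_zero hY'.holo.det_mem hx h l hl)
    have hzZ : z ∈ Z := hZ z hz ((hY.eq_zero_iff_det hz).1 hYz)
    have hlt : ∑ x ∈ Z, analyticOrderNatAt (fun l => (Y' l).det) x < N := by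
      rw [← hN]
      refine Finset.sum_lt_sum (fun x hx => ?_) ⟨z, hzZ, ?_⟩
      · rw [hord x (hZ0 x hx)]; exact Nat.le_add_left _ _
      · rw [hord z hz0]
        refine Nat.lt_add_of_pos_left (Nat.pos_of_ne_zero ?_)
        have h1 : analyticOrderAt (fun l => sinLoop z l ^ 2) z ≠ 0 := by
          rw [analyticOrderAt_ne_zero]
          exact ⟨hsin z hz0, by simp [sinLoop, div_self hz0]⟩
        have h2 : analyticOrderAt (fun l => sinLoop z l ^ 2) z ≠ ⊤ := by
          rw [Ne, analyticOrderAt_eq_top]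
          intro h
          obtain ⟨l, hl, hnl⟩ := hn0
          refine hnl ?_
          have := eq_zero_of_eventually_eq_zero (f := fun l => sinLoop z l ^ 2) (hreal.holo.pow 2)
            hz0 h l hl
          simpa using this
        rw [analyticOrderNatAt, Ne, ENat.toNat_eq_zero, not_or]
        exact ⟨h1, h2⟩
    obtain ⟨n, Y'', s'', hn, hYn, hq, hs'', ht, hnz⟩ := ih _ hlt hY' hs' hY's hY'0
      (fun l hl h => hZ l hl (by rw [hdet l (hne l hl), h, mul_zero])) rfl
    exact ⟨fun l => sinLoop z l * n l, Y'', s'', hreal.holo.mul hn, fun l hl => by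
      rw [hYY' l hl, hYn l hl, smul_smul], hq, hs'', ht, hnz⟩

/-! ### The topology of cut planes -/

theorem eq_ofReal_mul_iff {α l : ℂ} (hα : α ≠ 0) (t : ℝ) : l = t * α ↔ l / α = t :=
  (div_eq_iff hα).symm

theorem isClosed_image_ofReal_mul {α : ℂ} (hα : α ≠ 0) {T : Set ℝ} (hT : IsClosed T) :
    IsClosed {l : ℂ | ∃ t ∈ T, l = (t : ℂ) * α} := by
  have h : {l : ℂ | ∃ t ∈ T, l = (t : ℂ) * α} =
      (fun l : ℂ => l / α) ⁻¹' ((fun t : ℝ => (t : ℂ)) '' T) := by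
    ext l
    simp only [mem_ofPred_eq, mem_preimage, mem_image, eq_ofReal_mul_iff hα]
    exact ⟨fun ⟨t, ht, h⟩ => ⟨t, ht, h.symm⟩, fun ⟨t, ht, h⟩ => ⟨t, ht, h.symm⟩⟩
  rw [h]
  exact (isometry_ofReal.isClosedEmbedding.isClosedMap _ hT).preimage (by fun_prop)

theorem norm_ofReal_mul {t : ℝ} (ht : 0 < t) (α : ℂ) : ‖(t : ℂ) * α‖ = t * ‖α‖ := by
  rw [norm_mul, norm_real, Real.norm_of_nonneg ht.le]

namespace IsBranchSet

variable {r : ℝ} {P : Set ℂ}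

theorem isOpen_cutPlane (hP : IsBranchSet r P) : IsOpen (cutPlane P) := by
  rw [isOpen_iff_mem_nhds]
  rintro l₀ ⟨hl₀, hcut⟩
  have hn : 0 < ‖l₀‖ := norm_pos_iff.2 hl₀
  -- A cut that meets the annulus `ρ < |λ| < 1/ρ` around `l₀` starts at a point of `P` in its
  -- closure. So only finitely many cuts come near `l₀`.
  obtain ⟨ρ, hρ, h1, h2⟩ : ∃ ρ : ℝ, 0 < ρ ∧ ρ < ‖l₀‖ ∧ ‖l₀‖ < 1 / ρ := by
    refine ⟨min (‖l₀‖ / 2) (1 / (2 * ‖l₀‖)), by positivity,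
      (min_le_left _ _).trans_lt (by linarith), ?_⟩
    rw [lt_div_iff₀ (by positivity)]
    calc ‖l₀‖ * min (‖l₀‖ / 2) (1 / (2 * ‖l₀‖)) ≤ ‖l₀‖ * (1 / (2 * ‖l₀‖)) := by
          gcongr; exact min_le_right _ _
      _ < 1 := by field_simp; norm_num
  have hev : ∀ᶠ l in nhds l₀, ∀ α ∈ {α ∈ P | ρ ≤ ‖α‖ ∧ ‖α‖ ≤ 1 / ρ},
      (‖α‖ < 1 → ∀ t : ℝ, 0 < t → t ≤ 1 → l ≠ t * α) ∧
      (1 < ‖α‖ → ∀ t : ℝ, 1 ≤ t → l ≠ t * α) := by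
    refine (Filter.eventually_all_finite (hP.locally_finite ρ hρ)).2 fun α hα => ?_
    have hα0 := hP.ne_zero α hα.1
    obtain ⟨hc1, hc2⟩ := hcut α hα.1
    refine Filter.Eventually.and ?_ ?_
    · by_cases hlt : ‖α‖ < 1
      -- The origin is added to make the cut closed; `l₀ ≠ 0` avoids it.
      · have hmem : {l : ℂ | ∃ t ∈ Icc (0 : ℝ) 1, l = (t : ℂ) * α}ᶜ ∈ nhds l₀ := by
          refine (isClosed_image_ofReal_mul hα0 isClosed_Icc).isOpen_compl.mem_nhds ?_
          rintro ⟨t, ht, h⟩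
          rcases ht.1.eq_or_lt with h0 | h0
          · exact hl₀ (by rw [h, ← h0, ofReal_zero, zero_mul])
          · exact hc1 hlt t h0 ht.2 h
        filter_upwards [hmem] with l hl _ t ht0 ht1 h
        exact hl ⟨t, ⟨ht0.le, ht1⟩, h⟩
      · exact Filter.Eventually.of_forall fun _ h => absurd h hlt
    · by_cases hlt : 1 < ‖α‖
      · have hmem : {l : ℂ | ∃ t ∈ Ici (1 : ℝ), l = (t : ℂ) * α}ᶜ ∈ nhds l₀ := by
          refine (isClosed_image_ofReal_mul hα0 isClosed_Ici).isOpen_compl.mem_nhds ?_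
          rintro ⟨t, ht, h⟩
          exact hc2 hlt t ht h
        filter_upwards [hmem] with l hl _ t ht h
        exact hl ⟨t, ht, h⟩
      · exact Filter.Eventually.of_forall fun _ h => absurd h hlt
  filter_upwards [hev, isOpen_Cstar.mem_nhds hl₀, continuous_norm.continuousAt.eventually_const_lt h1,
    continuous_norm.continuousAt.eventually_lt_const h2] with l hl hl0 hl1 hl2
  refine ⟨hl0, fun α hα => ⟨fun hlt t ht0 ht1 h => ?_, fun hlt t ht1 h => ?_⟩⟩
  · have hn : ‖l‖ = t * ‖α‖ := h ▸ norm_ofReal_mul ht0 α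
    have h3 : ‖l‖ ≤ ‖α‖ := hn ▸ mul_le_of_le_one_left (norm_nonneg _) ht1
    refine (hl α ⟨hα, hl1.le.trans h3, hlt.le.trans ?_⟩).1 hlt t ht0 ht1 h
    rw [le_div_iff₀ hρ, one_mul]
    exact hl1.le.trans (h3.trans hlt.le)
  · have hn : ‖l‖ = t * ‖α‖ := h ▸ norm_ofReal_mul (one_pos.trans_le ht1) α
    have h3 : ‖α‖ ≤ ‖l‖ := hn ▸ le_mul_of_one_le_left (norm_nonneg _) ht1
    refine (hl α ⟨hα, ?_, h3.trans hl2.le⟩).2 hlt t ht1 h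
    have h4 : 1 < 1 / ρ := hlt.trans_le (h3.trans hl2.le)
    rw [lt_div_iff₀ hρ, one_mul] at h4
    exact h4.le.trans hlt.le

theorem neg_mem_cutPlane (hP : IsBranchSet r P) {l : ℂ} (hl : l ∈ cutPlane P) :
    -l ∈ cutPlane P := by
  refine ⟨neg_ne_zero.2 hl.1, fun α hα => ?_⟩
  have h := hl.2 (-α) (hP.neg α hα)
  rw [norm_neg] at h
  exact ⟨fun h1 t h2 h3 h4 => h.1 h1 t h2 h3 (by rw [mul_neg, ← h4, neg_neg]),
    fun h1 t h2 h4 => h.2 h1 t h2 (by rw [mul_neg, ← h4, neg_neg])⟩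

end IsBranchSet

theorem sphere_subset_cutPlane (P : Set ℂ) : sphere (0 : ℂ) 1 ⊆ cutPlane P := by
  intro l hl
  have hl1 := mem_sphere_zero_iff_norm.1 hl
  refine ⟨norm_pos_iff.1 (hl1 ▸ one_pos), fun α _ => ⟨fun hlt t ht0 ht1 h => ?_,
    fun hlt t ht1 h => ?_⟩⟩
  · rw [h, norm_ofReal_mul ht0] at hl1
    nlinarith [norm_nonneg α]
  · rw [h, norm_ofReal_mul (one_pos.trans_le ht1)] at hl1
    nlinarith [norm_nonneg α]

/-- The cuts lead away from `S¹`, so a point that moves radially towards `S¹` does not run into one.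
-/
theorem ofReal_mul_mem_cutPlane {P : Set ℂ} {l : ℂ} (hl : l ∈ cutPlane P) {s : ℝ}
    (hs : s ∈ uIcc (1 / ‖l‖) 1) : (s : ℂ) * l ∈ cutPlane P := by
  have hn : 0 < ‖l‖ := norm_pos_iff.2 hl.1
  have hs0 : 0 < s := (lt_min (by positivity) one_pos).trans_le hs.1
  have hs' : (s : ℂ) ≠ 0 := ofReal_ne_zero.2 hs0.ne'
  have hsl : ∀ t : ℝ, ∀ α : ℂ, (s : ℂ) * l = t * α → l = ((t / s : ℝ) : ℂ) * α := fun t α h => by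
    push_cast
    field_simp
    rw [mul_comm, h]
  refine ⟨mul_ne_zero hs' hl.1, fun α hα => ⟨fun hlt t ht0 ht1 h => ?_, fun hlt t ht1 h => ?_⟩⟩
  · refine (hl.2 α hα).1 hlt (t / s) (by positivity) ?_ (hsl t α h)
    have h1 : s * ‖l‖ = t * ‖α‖ := by rw [← norm_ofReal_mul hs0, h, norm_ofReal_mul ht0]
    have h2 : s < 1 / ‖l‖ := by
      rw [lt_div_iff₀ hn, h1]; nlinarith [norm_nonneg α]
    have h3 : 1 ≤ s := (min_le_iff.1 hs.1).resolve_left (not_le.2 h2)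
    exact (div_le_one hs0).2 (ht1.trans h3)
  · refine (hl.2 α hα).2 hlt (t / s) ?_ (hsl t α h)
    have h1 : s * ‖l‖ = t * ‖α‖ := by
      rw [← norm_ofReal_mul hs0, h, norm_ofReal_mul (one_pos.trans_le ht1)]
    have h2 : 1 / ‖l‖ < s := by
      rw [div_lt_iff₀ hn, h1]; nlinarith [norm_nonneg α]
    have h3 : s ≤ 1 := (le_max_iff.1 hs.2).resolve_left (not_le.2 h2)
    exact (one_le_div hs0).2 (h3.trans ht1)

/-- Radial segments join all points to the connected circle `S¹`. -/
theorem isPreconnected_cutPlane (P : Set ℂ) : IsPreconnected (cutPlane P) := by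
  refine isPreconnected_of_forall (1 : ℂ) fun y hy => ?_
  have hn : 0 < ‖y‖ := norm_pos_iff.2 hy.1
  refine ⟨sphere 0 1 ∪ (fun s : ℝ => (s : ℂ) * y) '' uIcc (1 / ‖y‖) 1,
    union_subset (sphere_subset_cutPlane P) ?_, Or.inl (by simp),
    Or.inr ⟨1, right_mem_uIcc, by simp⟩, ?_⟩
  · rintro _ ⟨s, hs, rfl⟩
    exact ofReal_mul_mem_cutPlane hy hs
  · refine IsPreconnected.union (((1 / ‖y‖ : ℝ) : ℂ) * y) ?_ ⟨1 / ‖y‖, left_mem_uIcc, rfl⟩ ?_ ?_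
    · exact mem_sphere_zero_iff_norm.2 (norm_radial one_pos hy.1)
    · exact isPreconnected_sphere (by rw [rank_real_complex]; norm_num) 0 1
    · exact isPreconnected_uIcc.image _ (by fun_prop)

/-- The zeros of a real, even function on `ℂ*` without zeros on the unit circle form a set of
branch points. -/
theorem isBranchSet_zeros {E : ℂ → ℂ} (hE : IsRealLoop E) (hneg : ∀ l, l ≠ 0 → E (-l) = E l)
    (h1 : ∀ l : ℂ, ‖l‖ = 1 → E l ≠ 0) : IsBranchSet 1 {l | l ≠ 0 ∧ E l = 0} where
  ne_zero _ hα := hα.1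
  locally_finite ρ hρ := by
    refine (finite_zeros_annulus hE.holo ⟨1, one_ne_zero, h1 1 norm_one⟩ hρ (1 / ρ)).subset ?_
    exact fun α hα => ⟨hα.2, hα.1.2⟩
  reflect α hα := by
    rw [one_div]
    refine ⟨circRefl_ne_zero hα.1, ?_⟩
    have := hE.real α hα.1
    rwa [hα.2, map_eq_zero] at this
  neg α hα := ⟨neg_ne_zero.2 hα.1, (hneg α hα.1).trans hα.2⟩
  avoids α hα := by
    rw [div_one]
    exact lt_or_gt_of_ne fun h => h1 α h hα.2

theorem ne_zero_of_mem_cutPlane_zeros {E : ℂ → ℂ} (h1 : ∀ l : ℂ, ‖l‖ = 1 → E l ≠ 0) {l : ℂ}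
    (hl : l ∈ cutPlane {l | l ≠ 0 ∧ E l = 0}) : E l ≠ 0 := by
  intro h
  rcases lt_trichotomy ‖l‖ 1 with hlt | heq | hlt
  · exact (hl.2 l ⟨hl.1, h⟩).1 hlt 1 one_pos le_rfl (by simp)
  · exact h1 l heq h
  · exact (hl.2 l ⟨hl.1, h⟩).2 hlt 1 le_rfl (by simp)

/-- A real, even function on `ℂ*` that is positive on the unit circle has an even holomorphic square
root on the plane that is cut at its zeros. -/
theorem exists_sqrt_cutPlane {E : ℂ → ℂ} (hE : IsRealLoop E) (hneg : ∀ l, l ≠ 0 → E (-l) = E l)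
    (h1 : ∀ l : ℂ, ‖l‖ = 1 → 0 < (E l).re) :
    ∃ b : ℂ → ℂ, DifferentiableOn ℂ b (cutPlane {l | l ≠ 0 ∧ E l = 0}) ∧
      (∀ l ∈ cutPlane {l | l ≠ 0 ∧ E l = 0}, b l ^ 2 = E l ∧ b (-l) = b l) ∧
      ∀ l : ℂ, ‖l‖ = 1 → starRingEnd ℂ (b l) = b l := by
  have hE1 : ∀ l : ℂ, ‖l‖ = 1 → E l ≠ 0 := fun l hl h => by
    have := h1 l hl
    rw [h, zero_re] at this
    exact this.false
  have hP := isBranchSet_zeros hE hneg hE1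
  set S := cutPlane {l | l ≠ 0 ∧ E l = 0} with hS
  have hE0 : ∀ l ∈ S, E l ≠ 0 := fun l hl => ne_zero_of_mem_cutPlane_zeros hE1 hl
  have hES : DifferentiableOn ℂ E S := hE.holo.mono fun l hl => hl.1
  -- `E` is real and positive on `S¹`. The positive root there is extended radially.
  obtain ⟨b, hbc, hbE, hb1⟩ := exists_continuousOn_sqrt_radial (f := fun l => (√(E l).re : ℂ))
    one_pos (fun h => h.1 rfl) (fun l hl s hs => ofReal_mul_mem_cutPlane hl hs) hES.continuousOn hE0
    (continuous_ofReal.comp_continuousOn (Real.continuous_sqrt.comp_continuousOn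
      (continuous_re.comp_continuousOn (hES.continuousOn.mono inter_subset_left))))
    (fun l hl hl1 => by
      have h2 := hE.real l hl.1
      rw [circRefl_eq_self hl1, conj_eq_iff_re] at h2
      rw [← ofReal_pow, Real.sq_sqrt (h1 l hl1).le, h2])
  have hbneg : ∀ l ∈ S, -l ∈ S := fun l hl => hP.neg_mem_cutPlane hl
  have hs1 : ∀ l : ℂ, ‖l‖ = 1 → l ∈ S := fun l hl =>
    sphere_subset_cutPlane _ (mem_sphere_zero_iff_norm.2 hl)
  refine ⟨b, differentiableOn_of_sq hP.isOpen_cutPlane hbc hES hE0 hbE,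
    fun l hl => ⟨hbE l hl, ?_⟩, fun l hl => ?_⟩
  -- `b(-λ)` and `b(λ)` are roots of the same function on a connected set, and both are the positive
  -- root at `λ = 1`.
  · refine (isPreconnected_cutPlane _).eq_of_sq_eq (f := fun l => b (-l)) (g := b)
      (hbc.comp continuous_neg.continuousOn hbneg) hbc (fun l hl => ?_) (fun hl h => ?_)
      (hs1 1 norm_one) ?_ hl
    · simp only [Pi.pow_apply]
      rw [hbE _ (hbneg l hl), hbE l hl, hneg l hl.1]
    · exact hE0 _ hl (by rw [← hbE _ hl, h]; norm_num)
    · have h3 : ‖(-1 : ℂ)‖ = 1 := by simp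
      change b (-1) = b 1
      rw [hb1 _ (hs1 _ h3) h3, hb1 _ (hs1 _ norm_one) norm_one, hneg 1 one_ne_zero]
  · rw [hb1 l (hs1 l hl) hl, conj_ofReal]

/-! ### Intertwining unitary loops with the same trace -/

namespace IsTwisted

variable {s t : ℂ} {Y Z : ℂ → Mat2}

theorem mul (hY : IsTwisted s Y) (hZ : IsTwisted t Z) : IsTwisted (s * t) fun l => Y l * Z l :=
  fun l hl => by rw [sigma3_conj_mul, hY l hl, hZ l hl, smul_mul_smul_comm]

theorem add (hY : IsTwisted s Y) (hZ : IsTwisted s Z) : IsTwisted s fun l => Y l + Z l :=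
  fun l hl => by rw [mul_add, add_mul, hY l hl, hZ l hl, smul_add]

theorem smul {n : ℂ → ℂ} (hn : ∀ l, n (-l) = t * n l) (hY : IsTwisted s Y) :
    IsTwisted (t * s) fun l => n l • Y l :=
  fun l hl => by rw [mul_smul_comm, smul_mul_assoc, hY l hl, hn, smul_smul, smul_smul]; ring_nf

theorem one : IsTwisted 1 fun _ => 1 :=
  fun l _ => by rw [mul_one, sigma3_mul_sigma3, one_smul]

end IsTwisted

theorem IsQuatLoop.mul_ne_zero {Y Z : ℂ → Mat2} (hY : IsQuatLoop Y) (hZ : IsQuatLoop Z) {l : ℂ}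
    (hl : ‖l‖ = 1) (hYl : Y l ≠ 0) (hZl : Z l ≠ 0) : Y l * Z l ≠ 0 := by
  rw [Ne, (hY.mul hZ).eq_zero_iff_det hl, Matrix.det_mul, mul_eq_zero, not_or]
  exact ⟨fun h => hYl ((hY.eq_zero_iff_det hl).2 h), fun h => hZl ((hZ.eq_zero_iff_det hl).2 h)⟩

theorem isQuatLoop_I_sigma3 : IsQuatLoop fun _ => I • sigma3 := by
  refine ⟨EntriesIn.const _ _, fun l _ => ?_⟩
  ext i j
  fin_cases i <;> fin_cases j <;> simp [sigma3, Matrix.adjugate_fin_two]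

theorem isTwisted_I_sigma3 : IsTwisted 1 fun _ => I • sigma3 := fun l _ => by
  rw [mul_smul_comm, smul_mul_assoc, sigma3_mul_sigma3, one_mul, one_smul]

/-- An off-diagonal twisted quaternionic loop. -/
noncomputable def offDiagLoop (l : ℂ) : Mat2 := !![0, l; -l⁻¹, 0]

theorem isQuatLoop_offDiagLoop : IsQuatLoop offDiagLoop := by
  refine ⟨fun i j => ?_, fun l hl => ?_⟩
  · rw [mem_holoAlg]
    fin_cases i <;> fin_cases j <;> simp [offDiagLoop]
    · exact differentiableOn_id
    · exact differentiableOn_inv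
  · ext i j
    fin_cases i <;> fin_cases j <;> simp [offDiagLoop, circRefl, Matrix.adjugate_fin_two]

theorem isTwisted_offDiagLoop : IsTwisted 1 offDiagLoop := fun l _ => by
  ext i j
  fin_cases i <;> fin_cases j <;> simp [offDiagLoop, sigma3, Matrix.mul_apply, Fin.sum_univ_two]

/-- A trace-free matrix that commutes with `σ₃` and with an invertible off-diagonal matrix is
zero. -/
theorem eq_zero_of_commute {A : Mat2} (htr : A.trace = 0) (h1 : A * sigma3 = sigma3 * A) {l : ℂ}
    (hl : l ≠ 0) (h2 : A * offDiagLoop l = offDiagLoop l * A) : A = 0 := by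
  have h01 := congrFun (congrFun h1 0) 1
  have h10 := congrFun (congrFun h1 1) 0
  have k01 := congrFun (congrFun h2 0) 1
  simp [sigma3, offDiagLoop, Matrix.mul_apply, Fin.sum_univ_two, Matrix.trace_fin_two] at *
  have e01 : A 0 1 = 0 := by linear_combination (-1 / 2) * h01
  have e10 : A 1 0 = 0 := by linear_combination (1 / 2) * h10
  have e : A 0 0 = A 1 1 := mul_right_cancel₀ hl (k01.trans (mul_comm _ _))
  have e00 : A 0 0 = 0 := by linear_combination (1 / 2) * htr + (1 / 2) * e
  ext i j
  fin_cases i <;> fin_cases j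
  · exact e00
  · exact e01
  · exact e10
  · exact e.symm.trans e00

/-- One of the choices `1`, `iσ₃`, `offDiagLoop` for `a` works: if `a = 1` fails, then `X' = -X`,
and if the other two fail as well, the trace-free `X` commutes with both of them and vanishes. -/
theorem exists_ne_zero_intertwiner {X X' : ℂ → Mat2} (htr : ∀ l, l ≠ 0 → (X l).trace = 0)
    (hX0 : ∃ l, l ≠ 0 ∧ X l ≠ 0) :
    ∃ a : ℂ → Mat2, IsQuatLoop a ∧ IsTwisted 1 a ∧ ∃ l, l ≠ 0 ∧ X' l * a l + a l * X l ≠ 0 := by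
  by_contra hall
  push Not at hall
  obtain ⟨l, hl, hXl⟩ := hX0
  have h1 := hall _ IsQuatLoop.one IsTwisted.one l hl
  rw [mul_one, one_mul, add_eq_zero_iff_eq_neg] at h1
  have h2 := hall _ isQuatLoop_I_sigma3 isTwisted_I_sigma3 l hl
  have h3 := hall _ isQuatLoop_offDiagLoop isTwisted_offDiagLoop l hl
  rw [h1, neg_mul, neg_add_eq_zero] at h2 h3
  rw [mul_smul_comm, smul_mul_assoc] at h2
  exact hXl (eq_zero_of_commute (htr l hl) (smul_right_injective _ I_ne_zero h2) hl h3)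

theorem isRealLoop_add_inv : IsRealLoop fun l => l + l⁻¹ :=
  ⟨differentiableOn_id.add differentiableOn_inv, fun l _ => by
    simp only [circRefl, map_add, map_inv₀, conj_conj, inv_inv]; ring⟩

theorem isRealLoop_I_mul_sub_inv : IsRealLoop fun l => I * (l - l⁻¹) :=
  ⟨DifferentiableOn.const_mul (differentiableOn_id.sub differentiableOn_inv) I, fun l _ => by
    simp only [circRefl, map_mul, conj_I, map_sub, map_inv₀, conj_conj, inv_inv]; ring⟩

/-- Two twisted trace-free quaternionic loops with the same determinant are intertwined by a
twisted quaternionic loop without zeros on the unit circle. -/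
theorem exists_quat_intertwiner {X X' : ℂ → Mat2} (hX : IsQuatLoop X) (hX' : IsQuatLoop X')
    (hXs : IsTwisted 1 X) (hXs' : IsTwisted 1 X') (htr : ∀ l, l ≠ 0 → (X l).trace = 0)
    (htr' : ∀ l, l ≠ 0 → (X' l).trace = 0) (hdet : ∀ l, l ≠ 0 → (X' l).det = (X l).det)
    (hX0 : ∃ l, l ≠ 0 ∧ X l ≠ 0) :
    ∃ V : ℂ → Mat2, IsQuatLoop V ∧ IsTwisted 1 V ∧ (∀ l : ℂ, ‖l‖ = 1 → V l ≠ 0) ∧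
      ∀ l, l ≠ 0 → X' l * V l = V l * X l := by
  have hexists_ne : ∀ {n : ℂ → ℂ} {Y Y' : ℂ → Mat2}, (∀ l, l ≠ 0 → Y l = n l • Y' l) →
      (∃ l, l ≠ 0 ∧ Y l ≠ 0) → ∃ l, l ≠ 0 ∧ n l ≠ 0 := fun h ⟨l, hl, hYl⟩ =>
    ⟨l, hl, fun hn => hYl (by rw [h l hl, hn, zero_smul])⟩
  obtain ⟨a, ha, has, hW0⟩ := exists_ne_zero_intertwiner (X' := X') htr hX0
  obtain ⟨n, W, s, hn, hWn, hW, hs, hWs, hW1⟩ := exists_ne_zero_on_circle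
    ((hX'.mul ha).add (ha.mul hX)) (one_pow 2)
    (by simpa only [one_mul] using (hXs'.mul has).add (has.mul hXs)) hW0
  -- By `X² = X'² = -det X`, both `X'(X'a + aX)` and `(X'a + aX)X` equal `X'aX - (det X)a`.
  have hWX : ∀ l, l ≠ 0 → X' l * W l = W l * X l := by
    refine EntriesIn.eq_of_smul_eq hn (hexists_ne hWn hW0) (hX'.holo.mul hW.holo)
      (hW.holo.mul hX.holo) fun l hl => ?_
    rw [← mul_smul_comm, ← smul_mul_assoc, ← hWn l hl, mul_add, add_mul, ← mul_assoc, ← mul_assoc,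
      mul_self_of_trace_eq_zero (htr' l hl), mul_assoc (a l), mul_self_of_trace_eq_zero (htr l hl),
      hdet l hl, smul_mul_assoc, mul_smul_comm, one_mul, mul_one, add_comm, mul_assoc]
  rcases mul_self_eq_one_iff.1 (sq s ▸ hs) with rfl | rfl
  · exact ⟨W, hW, hWs, hW1, hWX⟩
  -- If the division has made `W` antitwisted, this is repaired by an antitwisted factor that
  -- commutes with `X` and has no zeros on `S¹`. If `X` divided by its zeros is antitwisted, it is
  -- such a factor.
  obtain ⟨m, Z, t, hm, hXm, hZ, ht, hZs, hZ1⟩ := exists_ne_zero_on_circle hX (one_pow 2) hXs hX0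
  have hZtr : ∀ l, l ≠ 0 → (Z l).trace = 0 :=
    eq_zero_of_mul_eq_zero hm (hexists_ne hXm hX0) hZ.holo.trace_mem fun l hl => by
      rw [← smul_eq_mul, ← Matrix.trace_smul, ← hXm l hl, htr l hl]
  have hcomm : ∀ l, l ≠ 0 → Z l * X l = X l * Z l := fun l hl => by
    rw [hXm l hl, mul_smul_comm, smul_mul_assoc]
  rcases mul_self_eq_one_iff.1 (sq t ▸ ht) with rfl | rfl
  -- Otherwise `Z` is combined with `1` by two odd real functions, `2 cos` and `-2 sin` of the
  -- argument on `S¹`. They have no common zero, and `Z` is trace-free without zeros on `S¹`, so the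
  -- combination has none either.
  · have hq : IsQuatLoop fun l => (l + l⁻¹) • (1 : Mat2) + (I * (l - l⁻¹)) • Z l :=
      (IsQuatLoop.one.smul isRealLoop_add_inv).add (hZ.smul isRealLoop_I_mul_sub_inv)
    have hqs : IsTwisted (-1) fun l => (l + l⁻¹) • (1 : Mat2) + (I * (l - l⁻¹)) • Z l := by
      simpa only [mul_one] using (IsTwisted.one.smul (n := fun l => l + l⁻¹) (t := -1)
        (fun l => by rw [inv_neg]; ring)).add (hZs.smul (n := fun l => I * (l - l⁻¹)) (t := -1)
        (fun l => by rw [inv_neg]; ring))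
    refine ⟨_, hW.mul hq, by simpa only [neg_mul_neg, one_mul] using hWs.mul hqs, fun l hl => ?_,
      fun l hl => ?_⟩
    · have hl0 : l ≠ 0 := norm_pos_iff.1 (hl ▸ one_pos)
      refine hW.mul_ne_zero hq hl (hW1 l hl) fun h => ?_
      have h1 := congrArg Matrix.trace h
      rw [Matrix.trace_add, Matrix.trace_smul, Matrix.trace_smul, hZtr l hl0, smul_zero, add_zero,
        Matrix.trace_one, Matrix.trace_zero, Fintype.card_fin] at h1
      have h2 : l + l⁻¹ = 0 := by simpa using h1
      rw [h2, zero_smul, zero_add, smul_eq_zero] at h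
      have h3 : l - l⁻¹ = 0 := by simpa using h.resolve_right (hZ1 l hl)
      exact hl0 (by linear_combination (1 / 2) * h2 + (1 / 2) * h3)
    · rw [← mul_assoc, hWX l hl, mul_assoc, mul_assoc]
      congr 1
      rw [mul_add, add_mul, mul_smul_comm, mul_smul_comm, smul_mul_assoc, smul_mul_assoc,
        hcomm l hl, mul_one, one_mul]
  · refine ⟨_, hW.mul hZ, by simpa only [neg_mul_neg, one_mul] using hWs.mul hZs,
      fun l hl => hW.mul_ne_zero hZ hl (hW1 l hl) (hZ1 l hl), fun l hl => ?_⟩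
    rw [← mul_assoc, hWX l hl, mul_assoc, mul_assoc, hcomm l hl]

/-- Two unitary loops on `ℂ*` with the same non-constant trace are conjugate by a unitary loop that
is holomorphic on a cut plane. -/
theorem exists_isLoopSU_intertwiner {χ ψ : ℂ → Mat2} (hχ : IsLoopSUCstar χ) (hψ : IsLoopSUCstar ψ)
    (heq : ∀ l, l ≠ 0 → (ψ l).trace = (χ l).trace)
    (htr : ¬ ∃ c : ℂ, ∀ l : ℂ, l ≠ 0 → (χ l).trace = c) :
    ∃ (P : Set ℂ) (U : ℂ → Mat2), IsBranchSet 1 P ∧ IsLoopSU 1 U ∧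
      EntriesIn (holoAlg (cutPlane P)) U ∧ ∀ l ∈ cutPlane P,
        U l * χ l = ψ l * U l ∧ (U l).det = 1 ∧ sigma3 * U (-l) * sigma3 = U l := by
  have hhalf : ∀ {φ : ℂ → Mat2}, IsLoopSUCstar φ →
      IsQuatLoop (fun l => φ l - ((φ l).trace / 2) • (1 : Mat2)) ∧
      IsTwisted 1 (fun l => φ l - ((φ l).trace / 2) • (1 : Mat2)) ∧
      ∀ l, l ≠ 0 → (φ l - ((φ l).trace / 2) • (1 : Mat2)).trace = 0 ∧
        (φ l - ((φ l).trace / 2) • (1 : Mat2)).det = 1 - (φ l).trace ^ 2 / 4 := by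
    intro φ hφ
    have hq := IsQuatLoop.of_isLoopSUCstar hφ
    have hreal : IsRealLoop fun l => -((φ l).trace / 2) :=
      ⟨(DifferentiableOn.div_const hq.holo.trace_mem 2).neg, fun l hl => by
        rw [map_neg, map_div₀, hq.isRealLoop_trace.real l hl, map_ofNat]⟩
    have hφtr : ∀ l, l ≠ 0 → (φ (-l)).trace = (φ l).trace := fun l hl => by
      rw [← trace_sigma3_conj, hφ.twisted l hl]
    refine ⟨?_, fun l hl => ?_, fun l hl => ⟨?_, ?_⟩⟩
    · simpa only [neg_smul, ← sub_eq_add_neg] using hq.add (IsQuatLoop.one.smul hreal)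
    · rw [mul_sub, sub_mul, hφ.twisted l hl, hφtr l hl, mul_smul_comm, smul_mul_assoc, mul_one,
        sigma3_mul_sigma3, one_smul]
    · rw [Matrix.trace_sub, Matrix.trace_smul, Matrix.trace_one, Fintype.card_fin, smul_eq_mul]
      push_cast; ring
    · have h := hφ.det_eq_one l hl
      rw [Matrix.det_fin_two] at h ⊢
      simp [Matrix.trace_fin_two]
      linear_combination h
  obtain ⟨hX, hXs, hXt⟩ := hhalf hχ
  obtain ⟨hX', hXs', hXt'⟩ := hhalf hψ
  obtain ⟨V, hV, hVs, hV1, hVX⟩ := exists_quat_intertwiner hX hX' hXs hXs'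
    (fun l hl => (hXt l hl).1) (fun l hl => (hXt' l hl).1)
    (fun l hl => by rw [(hXt l hl).2, (hXt' l hl).2, heq l hl]) (by
      by_contra hall
      push Not at hall
      have hsq : EqOn ((fun l => (χ l).trace) ^ 2) ((fun _ => (2 : ℂ)) ^ 2) {l | l ≠ 0} := by
        intro l hl
        have h1 := (hXt l hl).2
        rw [hall l hl, Matrix.det_zero] at h1
        simp only [Pi.pow_apply]
        linear_combination 4 * h1
      have hcont : ContinuousOn (fun l => (χ l).trace) {l | l ≠ 0} :=
        DifferentiableOn.continuousOn hχ.entriesIn.trace_mem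
      rcases isPreconnected_Cstar.eq_or_eq_neg_of_sq_eq hcont continuousOn_const hsq
        (fun _ => two_ne_zero) with h | h
      · exact htr ⟨2, fun l hl => h hl⟩
      · exact htr ⟨-2, fun l hl => h hl⟩)
  have hVint : ∀ l, l ≠ 0 → V l * χ l = ψ l * V l := fun l hl => by
    have h := hVX l hl
    rw [sub_mul, mul_sub, heq l hl, smul_mul_assoc, mul_smul_comm, one_mul, mul_one] at h
    exact (sub_left_injective h).symm
  have hEneg : ∀ l, l ≠ 0 → (V (-l)).det = (V l).det := fun l hl => hVs.det_neg (one_pow 2) hl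
  have hE1 : ∀ l : ℂ, ‖l‖ = 1 → 0 < (V l).det.re := fun l hl => hV.det_pos hl (hV1 l hl)
  have hE0 : ∀ l : ℂ, ‖l‖ = 1 → (V l).det ≠ 0 := fun l hl h => by
    have := hE1 l hl
    rw [h, zero_re] at this
    exact this.false
  have hP := isBranchSet_zeros hV.isRealLoop_det hEneg hE0
  obtain ⟨b, hb, hbE, hbr⟩ := exists_sqrt_cutPlane hV.isRealLoop_det hEneg hE1
  set P := {l | l ≠ 0 ∧ (V l).det = 0}
  have hb0 : ∀ l ∈ cutPlane P, b l ≠ 0 := fun l hl h =>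
    ne_zero_of_mem_cutPlane_zeros hE0 hl (by rw [← (hbE l hl).1, h]; norm_num)
  have hUh : EntriesIn (holoAlg (cutPlane P)) fun l => (b l)⁻¹ • V l :=
    EntriesIn.smul (hb.inv hb0) (hV.holo.mono (holoAlg_anti fun l hl => hl.1))
  have hUdet : ∀ l ∈ cutPlane P, ((b l)⁻¹ • V l).det = 1 := fun l hl => by
    rw [Matrix.det_smul, Fintype.card_fin, ← (hbE l hl).1, inv_pow,
      inv_mul_cancel₀ (pow_ne_zero 2 (hb0 l hl))]
  have hUtw : ∀ l ∈ cutPlane P, sigma3 * ((b (-l))⁻¹ • V (-l)) * sigma3 = (b l)⁻¹ • V l :=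
    fun l hl => by
      rw [mul_smul_comm, smul_mul_assoc, hVs l hl.1, one_smul, (hbE l hl).2]
  have hs := sphere_subset_cutPlane P
  refine ⟨P, fun l => (b l)⁻¹ • V l, hP, ?_, hUh, fun l hl => ⟨?_, hUdet l hl, hUtw l hl⟩⟩
  · refine { smooth := fun i j => contDiff_comp_circleMap hP.isOpen_cutPlane hs (hUh i j)
             det_eq_one := fun l hl => hUdet l (hs hl)
             twisted := fun l hl => hUtw l (hs hl)
             continuousOn := fun i j => ?_
             analytic := fun i j l hl => ?_
             unitary := fun l hl => ?_ }
    -- For radius `1` the closed annulus is the unit circle and the open annulus is empty.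
    · refine (mem_holoAlg.1 (hUh i j)).continuousOn.mono fun l hl => hs ?_
      exact mem_sphere_zero_iff_norm.2 (le_antisymm (by simpa using hl.2) hl.1)
    · rw [div_one] at hl
      exact absurd (hl.1.trans hl.2) (lt_irrefl _)
    · have hl1 := mem_sphere_zero_iff_norm.1 hl
      refine mem_specialUnitaryGroup_of_conjTranspose ?_ (hUdet l (hs hl))
      have h := hV.quat l (hs hl).1
      rw [circRefl_eq_self hl1] at h
      rw [Matrix.conjTranspose_smul, h, adjugate_smul_two]
      congr 1
      change starRingEnd ℂ _ = _
      rw [map_inv₀, hbr l hl1]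
  · rw [smul_mul_assoc, mul_smul_comm, hVint l hl.1]

/-! ### Dressing and monodromy -/

theorem mul_left_cancel_of_det {A B C : Mat2} (hA : A.det = 1) (h : A * B = A * C) : B = C := by
  have := congrArg (A.adjugate * ·) h
  simpa only [← mul_assoc, adjugate_mul_of_det hA, one_mul] using this

theorem det_diagU1 {u : ℂ} (hu : ‖u‖ = 1) : (diagU1 u).det = 1 := by
  rw [diagU1, Matrix.det_fin_two_of, mul_zero, sub_zero, mul_conj, normSq_eq_norm_sq, hu]
  norm_num

theorem sigma3_mul_diagU1_mul_sigma3 (u : ℂ) : sigma3 * diagU1 u * sigma3 = diagU1 u := by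
  ext i j
  fin_cases i <;> fin_cases j <;> simp [sigma3, diagU1, Matrix.mul_apply, Fin.sum_univ_two]

theorem IsLoopSU.neg {r : ℝ} {ψ : ℂ → Mat2} (hψ : IsLoopSU r ψ) : IsLoopSU r fun l => -ψ l where
  smooth i j := (hψ.smooth i j).neg
  det_eq_one l hl := by rw [Matrix.det_neg, hψ.det_eq_one l hl, Fintype.card_fin]; norm_num
  twisted l hl := by rw [mul_neg, neg_mul, hψ.twisted l hl]
  continuousOn i j := (hψ.continuousOn i j).neg
  analytic i j := (hψ.analytic i j).neg
  unitary l hl := by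
    obtain ⟨h1, h2⟩ := Matrix.mem_specialUnitaryGroup_iff.1 (hψ.unitary l hl)
    refine Matrix.mem_specialUnitaryGroup_iff.2 ⟨Matrix.mem_unitaryGroup_iff'.2 ?_, ?_⟩
    · rw [star_neg, neg_mul_neg]
      exact Matrix.mem_unitaryGroup_iff'.1 h1
    · rw [Matrix.det_neg, h2, Fintype.card_fin]
      norm_num

section

variable {X : Type*} [TopologicalSpace X] [ChartedSpace ℂ X] {F Fhat : X → ℂ → Mat2} {z₀ : X}
  {r : ℝ} {χ h : ℂ → Mat2} {τ : X ≃ X}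

/-- If a frame with trivial isotropy and its dressing by `h` both have a monodromy, then `h`
conjugates the monodromies up to sign. -/
theorem exists_isLoopSU_conj_of_isDressing (hF : IsNormalizedFrame z₀ F) (hIso : HasTrivialIso 1 F)
    (hr : 0 < r) (hχ : IsLoopSUCstar χ) (hχF : IsMonodromy r F τ χ)
    (htr : ¬ ∃ c : ℂ, ∀ l : ℂ, l ≠ 0 → (χ l).trace = c) (hh : IsLoopSLPlus r h)
    (hdress : IsDressing r z₀ h F Fhat) {χhat : ℂ → Mat2} (hmon : IsMonodromy r Fhat τ χhat) :
    ∃ ψ : ℂ → Mat2, IsLoopSU r ψ ∧ ∀ l ∈ sphere (0 : ℂ) r, h l * χ l = ψ l * h l := by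
  obtain ⟨⟨-, B, hB, hFB⟩, -⟩ := hdress
  obtain ⟨-, u, -, hu, hτ⟩ := hχF
  obtain ⟨hχhat, v, -, hv, hτv⟩ := hmon
  have hne : ∀ l ∈ sphere (0 : ℂ) r, l ≠ 0 := fun l hl => ne_of_mem_sphere hl hr.ne'
  have huc : ∀ z, ‖starRingEnd ℂ (u z)‖ = 1 := fun z => by rw [norm_conj, hu z]
  -- This is `F⁻¹GF` for `G = (χ̂h)⁻¹hχ`, computed by comparing `hF = F̂B` at `z` and `τ z`. It is
  -- visibly positive, and `G` is its value at `z₀` because `F(z₀) = 1`.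
  set B' : X → ℂ → Mat2 := fun z l =>
    (B z l).adjugate * diagU1 (v z) * B (τ z) l * diagU1 (starRingEnd ℂ (u z)) with hB'
  have hBd : ∀ z, ∀ l : ℂ, ‖l‖ ≤ r → (B z l).det = 1 := fun z l hl =>
    (hB z).det_eq_one_closedBall hr hl
  have hB'e : ∀ z, EntriesIn (diffContAlg r) (B' z) := fun z =>
    (((hB z).entriesIn.adjugate.mul (EntriesIn.const _ _)).mul (hB (τ z)).entriesIn).mul
      (EntriesIn.const _ _)
  have hsph : ∀ l ∈ sphere (0 : ℂ) r, ‖l‖ ≤ r := fun l hl => (mem_sphere_zero_iff_norm.1 hl).le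
  have key : ∀ z, ∀ l ∈ sphere (0 : ℂ) r,
      h l * χ l * F z l = χhat l * h l * (F z l * B' z l) := by
    intro z l hl
    have h1 := hFB (τ z) l hl
    rw [hτ z l hl, hτv z l hl] at h1
    calc h l * χ l * F z l
        = h l * (χ l * F z l * diagU1 (u z)) * diagU1 (starRingEnd ℂ (u z)) := by
          rw [mul_assoc _ _ (diagU1 _), mul_assoc _ (diagU1 _), diagU1_mul_conj (hu z), mul_one,
            mul_assoc]
      _ = χhat l * (Fhat z l * (B z l * (B z l).adjugate)) * diagU1 (v z) * B (τ z) l *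
            diagU1 (starRingEnd ℂ (u z)) := by
          rw [h1, mul_adjugate_of_det (hBd z l (hsph l hl)), mul_one]
      _ = χhat l * (h l * F z l * (B z l).adjugate) * diagU1 (v z) * B (τ z) l *
            diagU1 (starRingEnd ℂ (u z)) := by
          rw [hFB z l hl, mul_assoc (Fhat z l)]
      _ = _ := by simp only [hB', mul_assoc]
  have hhχ : ∀ l ∈ sphere (0 : ℂ) r, h l * χ l = χhat l * h l * B' z₀ l := fun l hl => by
    have := key z₀ l hl
    rwa [hF.normalized l (hne l hl), mul_one, one_mul] at this
  have hGF : ∀ z, ∀ l ∈ sphere (0 : ℂ) r, B' z₀ l * F z l = F z l * B' z l := by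
    intro z l hl
    refine mul_left_cancel_of_det (A := χhat l * h l) ?_ ?_
    · rw [Matrix.det_mul, hχhat.det_eq_one l hl, hh.det_eq_one l hl, one_mul]
    · rw [← key z l hl, hhχ l hl]
      simp only [mul_assoc]
  have hcl : ∀ {A : ℂ → Mat2}, EntriesIn (diffContAlg r) A →
      EntriesIn (contAlg {l | l ≠ 0 ∧ ‖l‖ ≤ r}) A ∧ EntriesIn (holoAlg {l | l ≠ 0 ∧ ‖l‖ < r}) A :=
    fun hA => ⟨hA.mono ((diffContAlg_le_contAlg r).trans (contAlg_anti fun l hl =>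
      mem_closedBall_zero_iff.2 hl.2)), hA.mono ((diffContAlg_le_holoAlg r).trans (holoAlg_anti
      fun l hl => mem_ball_zero_iff.2 hl.2))⟩
  have hst : ∀ {A : ℂ → Mat2}, EntriesIn (holoAlg {l | l ≠ 0}) A →
      EntriesIn (contAlg {l | l ≠ 0 ∧ ‖l‖ ≤ r}) A ∧ EntriesIn (holoAlg {l | l ≠ 0 ∧ ‖l‖ < r}) A :=
    fun hA => ⟨hA.mono ((holoAlg_le_contAlg _).trans (contAlg_anti fun l hl => hl.1)),
      hA.mono (holoAlg_anti fun l hl => hl.1)⟩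
  have hFe : ∀ z, EntriesIn (holoAlg {l | l ≠ 0}) (F z) := fun z => (hF.loop z).entriesIn
  have hG : B' z₀ ∈ positiveAlgebra r F := by
    refine ⟨(hB'e z₀).mono (diffContAlg_le_holoAlg r), fun z =>
      ⟨B' z, (hB'e z).mono (diffContAlg_le_holoAlg r), fun l hl hlr => ?_⟩⟩
    exact EntriesIn.eq_of_eqOn_sphere hr ((hcl (hB'e z₀)).1.mul (hst (hFe z)).1)
      ((hcl (hB'e z₀)).2.mul (hst (hFe z)).2) ((hst (hFe z)).1.mul (hcl (hB'e z)).1)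
      ((hst (hFe z)).2.mul (hcl (hB'e z)).2) (hGF z) l hl hlr.le
  have hτ' : ∀ z l, l ≠ 0 → ‖l‖ < r → F (τ z) l = χ l * F z l * diagU1 (u z) := by
    intro z l hl hlr
    have hR := (hχ.entriesIn.mul (hFe z)).mul (EntriesIn.const _ (diagU1 (u z)))
    exact EntriesIn.eq_of_eqOn_sphere hr (hst (hFe _)).1 (hst (hFe _)).2 (hst hR).1 (hst hR).2
      (hτ z) l hl hlr.le
  have hGdet : ∀ l ∈ closedBall (0 : ℂ) r, (B' z₀ l).det = 1 := by
    intro l hl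
    have hl' := mem_closedBall_zero_iff.1 hl
    simp only [hB', Matrix.det_mul, Matrix.det_adjugate, hBd _ l hl', det_diagU1 (hv _),
      det_diagU1 (huc _), one_pow, mul_one]
  have hGtw : ∀ l ∈ ball (0 : ℂ) r, sigma3 * B' z₀ (-l) * sigma3 = B' z₀ l := by
    intro l hl
    have hl' := (mem_ball_zero_iff.1 hl).le
    simp only [hB']
    rw [sigma3_conj_mul, sigma3_conj_mul, sigma3_conj_mul, adjugate_sigma3_conj,
      (hB _).twisted_closedBall hr hl', (hB _).twisted_closedBall hr hl',
      sigma3_mul_diagU1_mul_sigma3, sigma3_mul_diagU1_mul_sigma3]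
  rcases eq_one_or_neg_one_of_mem_positiveAlgebra hF hIso hχ.entriesIn hχ.det_eq_one
    (IsQuatLoop.of_isLoopSUCstar hχ).isRealLoop_trace.real htr hr hu hτ' hG
    ((hB'e z₀).mono (diffContAlg_le_contAlg r)) hGdet hGtw with h1 | h1
  · exact ⟨χhat, hχhat, fun l hl => by
      rw [hhχ l hl, h1 l (sphere_subset_closedBall hl), mul_one]⟩
  · exact ⟨_, hχhat.neg, fun l hl => by
      rw [hhχ l hl, h1 l (sphere_subset_closedBall hl), mul_neg, mul_one, neg_mul]⟩

end

theorem mainTheorem2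
    {M X : Type*}
    [TopologicalSpace M] [T2Space M] [ConnectedSpace M]
    [ChartedSpace ℂ M] [IsManifold 𝓘(ℂ, ℂ) ω M]
    [TopologicalSpace X] [T2Space X] [SimplyConnectedSpace X]
    [ChartedSpace ℂ X] [IsManifold 𝓘(ℂ, ℂ) ω X]
    (p : X → M) (hp : IsCoveringMap p) (hp' : MDifferentiable 𝓘(ℂ, ℂ) 𝓘(ℂ, ℂ) p)
    (τ : X ≃ₜ X) (hτ : ∀ x, p (τ x) = p x)
    (z₀ : X) (F : X → ℂ → Mat2) (hF : IsNormalizedFrame z₀ F)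
    (hIso : HasTrivialIso 1 F)
    (r : ℝ) (hr : 0 < r) (hr1 : r ≤ 1)
    (χ : ℂ → Mat2) (hχ : IsLoopSUCstar χ) (hχF : IsMonodromy r F τ χ)
    (htr : ¬ ∃ c : ℂ, ∀ l : ℂ, l ≠ 0 → (χ l).trace = c)
    (h : ℂ → Mat2) (hh : IsLoopSLPlus r h)
    (Fhat : X → ℂ → Mat2) (hdress : IsDressing r z₀ h F Fhat)
    (hmon : ∃ χhat : ℂ → Mat2, IsMonodromy r Fhat τ χhat) :
    ∃ (r' : ℝ) (P : Set ℂ) (U C : ℂ → Mat2),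
      r ≤ r' ∧ r' ≤ 1 ∧ IsBranchSet r' P ∧
      -- `U` is the meromorphic extension to the cut plane of an element of `Λ_{r'} SU(2)_σ`
      IsLoopSU r' U ∧ (∀ i j, MeromorphicOn (fun l => U l i j) (cutPlane P)) ∧
      (∀ i j, MeromorphicOn (fun l => C l i j) (cutPlane P ∩ ball 0 r)) ∧
      -- the factorization on all segmented circles of radius at most `r`, off the poles of `U`
      ∀ l ∈ cutPlane P, ‖l‖ ≤ r → (∀ i j, AnalyticAt ℂ (fun w => U w i j) l) →
        h l = U l * C l ∧ C l * χ l = χ l * C l ∧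
        (C l).det = 1 ∧ sigma3 * C (-l) * sigma3 = C l := by
  obtain ⟨χhat, hχhat⟩ := hmon
  obtain ⟨ψ, hψ, hconj⟩ := exists_isLoopSU_conj_of_isDressing (τ := τ.toEquiv) hF hIso hr hχ hχF htr
    hh hdress hχhat
  obtain ⟨Ψ, hΨ, hΨtr, hΨconj⟩ := exists_conjugate_loop hr hr1 hχ hh hψ hconj
  obtain ⟨P, U, hP, hU, hUh, hUP⟩ := exists_isLoopSU_intertwiner hχ hΨ hΨtr htr
  have mero : ∀ {V : Set ℂ}, IsOpen V → ∀ {A : ℂ → Mat2}, EntriesIn (holoAlg V) A → ∀ i j,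
      MeromorphicOn (fun l => A l i j) V := fun hV A hA i j =>
    (DifferentiableOn.analyticOnNhd (hA i j) hV).meromorphicOn
  -- `U` is holomorphic with determinant one on the whole cut plane, so `C = U⁻¹h` is defined
  -- wherever `h` is.
  refine ⟨1, P, U, fun l => (U l).adjugate * h l, hr1, le_rfl, hP, hU, mero hP.isOpen_cutPlane hUh,
    mero (hP.isOpen_cutPlane.inter isOpen_ball) ((hUh.adjugate.mono (holoAlg_anti
      inter_subset_left)).mul (hh.entriesIn.mono ((diffContAlg_le_holoAlg r).trans (holoAlg_anti
      inter_subset_right)))), fun l hl hlr _ => ?_⟩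
  obtain ⟨hUχ, hUdet, hUtw⟩ := hUP l hl
  refine ⟨?_, ?_, ?_, ?_⟩
  · rw [← mul_assoc, mul_adjugate_of_det hUdet, one_mul]
  -- Both `U` and `h` conjugate `χ` into `Ψ`, so `U⁻¹h` commutes with `χ`.
  · refine mul_left_cancel_of_det hUdet ?_
    change U l * ((U l).adjugate * h l * χ l) = U l * (χ l * ((U l).adjugate * h l))
    rw [mul_assoc, ← mul_assoc (U l), mul_adjugate_of_det hUdet, one_mul, ← mul_assoc (U l), hUχ,
      mul_assoc (Ψ l), ← mul_assoc (U l), mul_adjugate_of_det hUdet, one_mul, hΨconj l hl.1 hlr]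
  · rw [Matrix.det_mul, Matrix.det_adjugate, hUdet, hh.det_eq_one_closedBall hr hlr, one_pow,
      one_mul]
  · rw [sigma3_conj_mul, adjugate_sigma3_conj, hUtw, hh.twisted_closedBall hr hlr]
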